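/- **Setting.** Let $(\Omega,\mathcal F,\mathbb P)$ be a complete probability space with complete filtrations $(\mathcal F_n)_{n\ge0}$ and $(\mathcal G_n)_{n\ge1}$ (all null sets belong to each of these $\sigma$-algebras) such that $\mathcal G_n\subset\mathcal F_n$ for $n\ge1$, and let $\mathcal F_n^+:=\sigma(\mathcal F_n\cup\mathcal G_{n+1})$. Properties of random objects are understood $\mathbb P$-almost surely; in particular a random function $f(x,\omega)$, $x\in S$, is called $\mathcal B(S)\times\mathcal G_n$-measurable if, for almost all $\omega$, it coincides on all of $S$ with a jointly measurable function. For $n\ge1$ let $\rho_n$ be a strictly positive $\mathcal F_n$-measurable random variable with $\mathbb E[\rho_n|\mathcal F_{n-1}^+]=1$, conditionally independent of $\mathcal F_{n-1}^+$ given $\mathcal G_n$ (that is, $\mathbb P(\rho_n\in B|\mathcal F_{n-1}^+)=\mathbb P(\rho_n\in B|\mathcal G_n)$ for all Borel sets $B$), and conditionally atomless (its regular conditional law given $\mathcal G_n$ a.s. has no atoms). Write $F_X(x|\mathcal H):=\mathbb P(X\le x|\mathcal H)$ for (regular) conditional cdfs, $F_n(\cdot|\mathcal G_n)$ for that of $\rho_n$,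 and $F_n^{-1}(q|\mathcal G_n):=\sup\{x:F_n(x|\mathcal G_n)\le q\}$, $0<q<1$. For a random variable $\xi\ge0$, $\mathcal A_n(\xi)$ is the set of $\mathcal F_n$-measurable $X\ge0$ with $\mathbb E[\rho_nX|\mathcal F_{n-1}^+]=\xi$ (conditional expectation of nonnegative random variables; no integrability is required). $\mathcal A$ is the set of processes $(X_n)_{n\ge0}$ with $X_0\ge0$ $\mathcal F_0$-measurable and $X_n\in\mathcal A_n(X_{n-1})$ for $n\ge1$. For $n\ge1$ let $W_n(p,\omega)$ be a $\mathcal B([0,1])\times\mathcal G_n$-measurable random function such that a.s. $W_n(\cdot,\omega):[0,1]\to[0,1]$ is continuously differentiable and strictly increasing with $W_n(0,\omega)=0$, $W_n(1,\omega)=1$. Put $$\mathcal U=\{U\in C^2((0,\infty)):U'>0,\ U''<0,\ U'(0+)=\infty,\ U'(\infty)=0\},$$ $$\mathcal I=\{I\in C^1((0,\infty)):I'<0,\ I(0+)=\infty,\ I(\infty)=0\}.$$ For $U\in\mathcal U$ put $U(0):=\lim_{x\downarrow0}U(x)\in[-\infty,\infty)$. **Definition.** Random functions $(U_n)_{n\ge0}$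 form a *rank-dependent predictable forward performance process* (RDPFPP) if: (i) $U_0\in\mathcal U$ is deterministic and, for $n\ge1$, $U_n$ is $\mathcal B((0,\infty))\times\mathcal G_n$-measurable with $U_n(\cdot,\omega)\in\mathcal U$ for almost all $\omega$; (ii) for all $(X_n)\in\mathcal A$ and $n\ge1$, a.s. the following integral (over $[0,\infty)$) is well-defined in $[-\infty,\infty)$ and $$U_{n-1}(X_{n-1})\ \ge\ \int_0^\infty U_n(\xi)\,d\big(1-W_n(1-F_{X_n}(\xi|\mathcal F_{n-1}^+))\big);$$ (iii) there is a process $(X_n^*)\in\mathcal A$ with all $X^*_n>0$, called an *optimal wealth process*, for which these integrals are well-defined and equality holds in (ii) for all $n\ge1$. Let $\Phi_n(q,\omega):=-\int_0^{W_n^{-1}(1-q,\omega)}F_n^{-1}(p|\mathcal G_n)(\omega)\,dp$ for $q\in[0,1]$, let $\hat\Phi_n(\cdot,\omega)$ be the concave envelope of $\Phi_n(\cdot,\omega)$ on $[0,1]$, and $\hat\Phi_n'$ its (a.e. defined) derivative. **Theorem.** Let $U_0\in\mathcal U$, $I_0:=(U_0')^{-1}$, and let the random functions $(I_n)_{n\ge1}$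 satisfy, for all $n\ge1$: (i) $I_n$ is $\mathcal B((0,\infty))\times\mathcal G_n$-measurable and $I_n(\cdot,\omega)\in\mathcal I$ for almost all $\omega$; (ii) for almost all $\omega$ and all $y>0$, $\int_0^1I_n(y\hat\Phi_n'(\eta,\omega),\omega)\,\hat\Phi_n'(\eta,\omega)\,d\eta=I_{n-1}(y,\omega)$; (iii) for almost all $\omega$ and all $x>0$, the function $p\mapsto\int_{I_n(\hat\Phi_n'(p,\omega),\omega)}^xI_n^{-1}(\xi,\omega)\,d\xi$ is Lebesgue integrable on $(0,1)$. Let $(U_n)_{n\ge1}$ be given a.s. by the recursion $$U_n(x,\omega)=U_{n-1}(I_{n-1}(1,\omega),\omega)+\int_0^1\int_{I_n(\hat\Phi_n'(p,\omega),\omega)}^xI_n^{-1}(\xi,\omega)\,d\xi\,dp,\qquad x>0.$$ Then: (a) $(U_n)_{n\ge0}$ is an RDPFPP. (b) For every $x_0>0$, the process given by $X_0^*=x_0$ and $$X_n^*=I_n\Big(U_{n-1}'(X_{n-1}^*)\,\hat\Phi_n'\big(1-W_n(F_n(\rho_n|\mathcal G_n))\big)\Big),\qquad n\ge1,$$ is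 an optimal wealth process. (c) For a deterministic wealth at the beginning of a period, the same holds over that period with the conditional cdf given $\mathcal G_n$: for all $n\ge1$, $x>0$ and $X\in\mathcal A_n(x)$, a.s. the following integral is well-defined in $[-\infty,\infty)$ and $$U_{n-1}(x)\ge\int_0^\infty U_n(\xi)\,d\big(1-W_n(1-F_X(\xi|\mathcal G_n))\big),$$ and $\tilde X_{n,x}:=I_n\big(U_{n-1}'(x)\,\hat\Phi_n'(1-W_n(F_n(\rho_n|\mathcal G_n)))\big)$ belongs to $\mathcal A_n(x)$ and attains equality a.s. -/

import Mathlib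

open MeasureTheory ProbabilityTheory Set Filter Topology

namespace RDPFPP

noncomputable section

/-! ### Deterministic notions -/

/-- The classical utility functions: `U ∈ C²((0,∞))`, `U' > 0`, `U'' < 0`, `U'(0+) = ∞`,
`U'(∞) = 0`.  Only the values on `(0,∞)` matter. -/
structure IsUtility (U : ℝ → ℝ) : Prop where
  contDiffOn : ContDiffOn ℝ 2 U (Ioi 0)
  deriv_pos : ∀ x, 0 < x → 0 < deriv U x
  deriv2_neg : ∀ x, 0 < x → deriv (deriv U) x < 0
  deriv_zero : Tendsto (deriv U) (𝓝[>] 0) atTop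
  deriv_top : Tendsto (deriv U) atTop (𝓝 0)

/-- The inverse marginals: `I ∈ C¹((0,∞))`, `I' < 0`, `I(0+) = ∞`, `I(∞) = 0`. -/
structure IsInverseMarginal (I : ℝ → ℝ) : Prop where
  contDiffOn : ContDiffOn ℝ 1 I (Ioi 0)
  deriv_neg : ∀ y, 0 < y → deriv I y < 0
  zero : Tendsto I (𝓝[>] 0) atTop
  top : Tendsto I atTop (𝓝 0)

/-- The inverse function of a bijection of `(0,∞)`. -/
def posInv (f : ℝ → ℝ) : ℝ → ℝ := Function.invFunOn f (Ioi 0)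

/-- A probability weighting function: a continuously differentiable, strictly increasing
`w : [0,1] → [0,1]` with `w 0 = 0`, `w 1 = 1`.  Only the values on `[0,1]` matter. -/
structure IsWeighting (w : ℝ → ℝ) : Prop where
  contDiffOn : ContDiffOn ℝ 1 w (Icc 0 1)
  strictMonoOn : StrictMonoOn w (Icc 0 1)
  map_zero : w 0 = 0
  map_one : w 1 = 1

/-- The inverse of a weighting function on `[0,1]`. -/
def weightInv (w : ℝ → ℝ) : ℝ → ℝ := Function.invFunOn w (Icc 0 1)

/-- The quantile function `q ↦ sup {x : F(x) ≤ q}`, `0 < q < 1`, of a law `μ` on `ℝ` with cdf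
`F(x) = μ (-∞, x]`. -/
def quantile (μ : Measure ℝ) (q : ℝ) : ℝ := sSup {x : ℝ | μ.real (Iic x) ≤ q}

/-- `Φ(q) = - ∫_0^{w⁻¹(1-q)} F⁻¹(p) dp`, with `F⁻¹` the quantile function of `μ`. -/
def Phi (w : ℝ → ℝ) (μ : Measure ℝ) (q : ℝ) : ℝ :=
  -∫ p in (0 : ℝ)..(weightInv w (1 - q)), quantile μ p

/-- The concave envelope on `[0,1]`: the supremum of the values at `q` of the chords over
intervals `[α, β] ∋ q`, with `0 ≤ α < β ≤ 1`. -/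
def concaveEnvelope (φ : ℝ → ℝ) (q : ℝ) : ℝ :=
  sSup {z : ℝ | ∃ α ∈ Icc 0 q, ∃ β ∈ Icc q 1, α < β ∧
    z = ((β - q) * φ α + (q - α) * φ β) / (β - α)}

open Classical in
/-- The distorted law of `μ`: the Lebesgue-Stieltjes measure `d(1 - w(1 - F(ξ)))`, where `F` is the
cdf of `μ`.  (For a weighting function `w` and a probability law `μ` the function
`ξ ↦ 1 - w(1 - F(ξ))` is monotone and right-continuous; the other branch is never used then.) -/
def distortedLaw (w : ℝ → ℝ) (μ : Measure ℝ) : Measure ℝ :=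
  if h : Monotone (fun ξ : ℝ => 1 - w (1 - μ.real (Iic ξ))) then h.stieltjesFunction.measure else 0

/-- An increasing utility function on `(0,∞)` extended to `[0,∞)` by its limit at `0+`, which is the
infimum of its values and may be `-∞`. -/
def extend (u : ℝ → ℝ) (x : ℝ) : EReal :=
  if 0 < x then (u x : EReal) else ⨅ z : Ioi (0 : ℝ), ((u z : ℝ) : EReal)

/-- The positive part `∫_{[0,∞)} u⁺ dν`. -/
def posPart (u : ℝ → ℝ) (ν : Measure ℝ) : ENNReal :=
  ∫⁻ ξ in Ici (0 : ℝ), (extend u ξ).toENNReal ∂ν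

/-- The negative part `∫_{[0,∞)} u⁻ dν`. -/
def negPart (u : ℝ → ℝ) (ν : Measure ℝ) : ENNReal :=
  ∫⁻ ξ in Ici (0 : ℝ), (-extend u ξ).toENNReal ∂ν

/-- The integral `∫_{[0,∞)} u dν ∈ [-∞, ∞)`, meaningful if `posPart u ν < ∞`. -/
def extIntegral (u : ℝ → ℝ) (ν : Measure ℝ) : EReal :=
  ((posPart u ν : ENNReal) : EReal) - ((negPart u ν : ENNReal) : EReal)

/-! ### Random functions and conditional laws -/

section Random

variable {Ω : Type*} {mΩ : MeasurableSpace Ω}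

/-- `f(x, ω)`, `x ∈ S`, is a random function measurable with respect to `B(S) × m`; as every
property of random objects this is understood up to a `P`-null set of `ω`'s: `f` agrees for almost
all `ω`, at all `x ∈ S` simultaneously, with a jointly measurable function. -/
def IsRandomFunction (P : Measure Ω) (m : MeasurableSpace Ω) (S : Set ℝ) (f : Ω → ℝ → ℝ) : Prop :=
  ∃ g : Ω × ℝ → ℝ, Measurable[m.prod (borel ℝ)] g ∧ ∀ᵐ ω ∂P, ∀ x ∈ S, f ω x = g (ω, x)

/-- The (regular) conditional law of the random variable `X` given the sub-σ-algebra `m`. -/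
def condLaw (P : Measure Ω) [IsFiniteMeasure P] (m : MeasurableSpace Ω) (X : Ω → ℝ) (ω : Ω) :
    Measure ℝ :=
  @condDistrib Ω Ω ℝ _ _ _ mΩ m X id P _ ω

/-- The conditional cdf `F_X(x | m)(ω) = P(X ≤ x | m)(ω)`. -/
def condCdf (P : Measure Ω) [IsFiniteMeasure P] (m : MeasurableSpace Ω) (X : Ω → ℝ) (ω : Ω)
    (x : ℝ) : ℝ :=
  (condLaw P m X ω).real (Iic x)

/-- The σ-algebra `F_n⁺` generated by `F_n ∪ G_{n+1}`. -/
abbrev plus (F G : Filtration ℕ mΩ) (n : ℕ) : MeasurableSpace Ω := F n ⊔ G (n + 1)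

/-- The conditionally complete market model.  `(F_n)_{n ≥ 0}` and `(G_n)_{n ≥ 1}` are complete
filtrations, `(ρ_n)_{n ≥ 1}` are the conditional state-price densities.  (`G 0` and `ρ 0` play no
role.) -/
structure IsMarket (P : Measure Ω) [IsFiniteMeasure P] (F G : Filtration ℕ mΩ)
    (ρ : ℕ → Ω → ℝ) : Prop where
  complete_F : ∀ n, ∀ s : Set Ω, P s = 0 → MeasurableSet[F n] s
  complete_G : ∀ n, 1 ≤ n → ∀ s : Set Ω, P s = 0 → MeasurableSet[G n] s
  G_le_F : ∀ n, 1 ≤ n → G n ≤ F n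
  measurable_rho : ∀ n, Measurable[F (n + 1)] (ρ (n + 1))
  rho_pos : ∀ n, ∀ᵐ ω ∂P, 0 < ρ (n + 1) ω
  /-- `ρ_{n+1}` is (conditionally) atomless: its conditional law given `G_{n+1}` has no atoms. -/
  atomless : ∀ n, ∀ᵐ ω ∂P, ∀ x : ℝ, condLaw P (G (n + 1)) (ρ (n + 1)) ω {x} = 0
  condExp_rho : ∀ n, P[ρ (n + 1) | plus F G n] =ᵐ[P] fun _ => 1
  /-- `ρ_{n+1}` is conditionally independent of `F_n⁺` given `G_{n+1}`. -/
  condIndep : ∀ n, ∀ B : Set ℝ, MeasurableSet B →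
    P[(ρ (n + 1) ⁻¹' B).indicator (fun _ => (1 : ℝ)) | plus F G n] =ᵐ[P]
      P[(ρ (n + 1) ⁻¹' B).indicator (fun _ => (1 : ℝ)) | G (n + 1)]

/-- `X ∈ A_{n+1}(ξ)`: admissible wealth at time `n + 1` starting with wealth `ξ` at time `n`.  The
conditional expectation is that of a nonnegative random variable, which need not be integrable. -/
structure IsAdmissibleStep (P : Measure Ω) (F G : Filtration ℕ mΩ) (ρ : ℕ → Ω → ℝ) (n : ℕ)
    (ξ X : Ω → ℝ) : Prop where
  measurable : Measurable[F (n + 1)] X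
  nonneg : ∀ᵐ ω ∂P, 0 ≤ X ω
  budget : condLExp (plus F G n) P (fun ω => ENNReal.ofReal (ρ (n + 1) ω * X ω)) =ᵐ[P]
    fun ω => ENNReal.ofReal (ξ ω)

/-- `X ∈ A`: admissible wealth processes. -/
structure IsAdmissible (P : Measure Ω) (F G : Filtration ℕ mΩ) (ρ : ℕ → Ω → ℝ)
    (X : ℕ → Ω → ℝ) : Prop where
  measurable_zero : Measurable[F 0] (X 0)
  nonneg_zero : ∀ᵐ ω ∂P, 0 ≤ X 0 ω
  step : ∀ n, IsAdmissibleStep P F G ρ n (X n) (X (n + 1))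

/-- The random probability weighting functions `(W_n)_{n ≥ 1}`, revealed with `G_n`. -/
structure IsRandomWeighting (P : Measure Ω) (G : Filtration ℕ mΩ) (W : ℕ → Ω → ℝ → ℝ) : Prop where
  measurable : ∀ n, IsRandomFunction P (G (n + 1)) (Icc 0 1) (W (n + 1))
  isWeighting : ∀ n, ∀ᵐ ω ∂P, IsWeighting (W (n + 1) ω)

/-- The derivative `Φ̂_n'(p, ω)` of the concave envelope `Φ̂_n(·, ω)` of `Φ_n(·, ω)`. -/
def phiHatDeriv (P : Measure Ω) [IsFiniteMeasure P] (G : Filtration ℕ mΩ) (ρ : ℕ → Ω → ℝ)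
    (W : ℕ → Ω → ℝ → ℝ) (n : ℕ) (ω : Ω) (p : ℝ) : ℝ :=
  deriv (concaveEnvelope (Phi (W n ω) (condLaw P (G n) (ρ n) ω))) p

/-- The law `d(1 - w(ω)(1 - F_X(ξ | m)(ω)))`. -/
def rdLaw (P : Measure Ω) [IsFiniteMeasure P] (m : MeasurableSpace Ω) (w : Ω → ℝ → ℝ)
    (X : Ω → ℝ) (ω : Ω) : Measure ℝ :=
  distortedLaw (w ω) (condLaw P m X ω)

/-- The conditional rank-dependent utility
`∫_0^∞ u(ξ, ω) d(1 - w(1 - F_X(ξ | m)(ω), ω))` of the wealth `X`. -/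
def rdUtility (P : Measure Ω) [IsFiniteMeasure P] (m : MeasurableSpace Ω) (u w : Ω → ℝ → ℝ)
    (X : Ω → ℝ) (ω : Ω) : EReal :=
  extIntegral (u ω) (rdLaw P m w X ω)

/-- `X` is an optimal wealth process for `(U_n)`: an admissible wealth process with values in the
domain `(0,∞)` of the utilities, whose rank-dependent utility over each period, conditionally on the
information `F_n⁺` at the beginning of that period, is well-defined and equal to `U_n(X_n)`. -/
structure IsOptimalWealth (P : Measure Ω) [IsFiniteMeasure P] (F G : Filtration ℕ mΩ)
    (ρ : ℕ → Ω → ℝ) (W U : ℕ → Ω → ℝ → ℝ) (X : ℕ → Ω → ℝ) : Prop where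
  admissible : IsAdmissible P F G ρ X
  pos : ∀ n, ∀ᵐ ω ∂P, 0 < X n ω
  wellDefined : ∀ n, ∀ᵐ ω ∂P,
    posPart (U (n + 1) ω) (rdLaw P (plus F G n) (W (n + 1)) (X (n + 1)) ω) < ⊤
  optimal : ∀ n, ∀ᵐ ω ∂P, ((U n ω (X n ω) : ℝ) : EReal) =
    rdUtility P (plus F G n) (U (n + 1)) (W (n + 1)) (X (n + 1)) ω

/-- `(U_n)_{n ≥ 0}` is a rank-dependent predictable forward performance process. -/
structure IsRDPFPP (P : Measure Ω) [IsFiniteMeasure P] (F G : Filtration ℕ mΩ)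
    (ρ : ℕ → Ω → ℝ) (W U : ℕ → Ω → ℝ → ℝ) : Prop where
  /-- The initial utility is deterministic. -/
  initial : ∃ u : ℝ → ℝ, IsUtility u ∧ ∀ᵐ ω ∂P, ∀ x, 0 < x → U 0 ω x = u x
  measurable : ∀ n, IsRandomFunction P (G (n + 1)) (Ioi 0) (U (n + 1))
  isUtility : ∀ n, ∀ᵐ ω ∂P, IsUtility (U (n + 1) ω)
  /-- For every admissible wealth process the integral is well-defined in `[-∞, ∞)` and satisfies
  the inequality. -/
  supermartingale : ∀ X : ℕ → Ω → ℝ, IsAdmissible P F G ρ X → ∀ n, ∀ᵐ ω ∂P,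
    posPart (U (n + 1) ω) (rdLaw P (plus F G n) (W (n + 1)) (X (n + 1)) ω) < ⊤ ∧
    rdUtility P (plus F G n) (U (n + 1)) (W (n + 1)) (X (n + 1)) ω ≤ extend (U n ω) (X n ω)
  exists_optimal : ∃ X : ℕ → Ω → ℝ, IsOptimalWealth P F G ρ W U X

/-- The map `x ↦ I_{n+1}(U_n'(x) Φ̂_{n+1}'(1 - W_{n+1}(F_{n+1}(ρ_{n+1} | G_{n+1}))))`. -/
def nextWealth (P : Measure Ω) [IsFiniteMeasure P] (G : Filtration ℕ mΩ) (ρ : ℕ → Ω → ℝ)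
    (W I U : ℕ → Ω → ℝ → ℝ) (n : ℕ) (ω : Ω) (x : ℝ) : ℝ :=
  I (n + 1) ω (deriv (U n ω) x * phiHatDeriv P G ρ W (n + 1) ω
    (1 - W (n + 1) ω (condCdf P (G (n + 1)) (ρ (n + 1)) ω (ρ (n + 1) ω))))

end Random

end

end RDPFPP

namespace RDPFPP

/-! ### The concave envelope -/

section Envelope

variable {φ : ℝ → ℝ} {q : ℝ}

/-! Once the information at the beginning of a period is fixed, everything reduces to a
deterministic problem with a pricing law `μ` for `ρ`, a weighting `w`, the utility `u` with `I =
(u')⁻¹` at the end of the period and `U` with `J = (U')⁻¹` at its start. Let `R` be the right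
derivative of the concave envelope `Φ̂`. It exists throughout `(0,1)`, is positive and decreasing,
and differs from `deriv` (junk at kinks) only on a countable set.

Upper bound. Let `Q` be the quantile function of the distorted law of a payoff `X`. At level `t`,
with `a` the distorted cdf at `t`, the Hardy-Littlewood inequality bounds the expectation of `ρ` on
`{X > t}` below by `-Φ(a)`. Since `Φ ≤ Φ̂` and `Φ̂(1) = 0`, this is at least `-Φ̂(a) = ∫_a^1 R`.
Summing over `t` shows that the price of `X` is at least `∫ R Q`
(`lintegral_envelopeSlope_mul_quantile_le`). With the conjugate `V(s) = u(I(s)) - s I(s)`, Fenchel's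
inequality `u(Q) ≤ V(yR) + yRQ` then bounds the rank-dependent utility of a payoff of price at most
`ξ` by `∫ V(yR) + y ξ` (`extIntegral_distortedLaw_le`).

Consistency between periods. As `V' = -I`, condition (ii) says that `∫ V(yR)` has the same
`y`-derivative as the conjugate of `U`. The additive constant in the recursion makes the two agree
at `y = 1`, hence everywhere (`integral_conjugate`). Minimizing the bound over `y` gives `U(ξ)`.

Attainment. The payoff `I(y R(1 - w(F(ρ))))` with `y = U'(ξ)` gives equality throughout: it
decreases in `ρ`, it does not vary where `Φ̂ > Φ` because `R` is constant there, and it gives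
equality in Fenchel pointwise (`optimal_payoff`).

Randomness. Conditional independence makes the law of `ρ` given `F_n⁺` equal to that given
`G_{n+1}`, so the deterministic result is applied for almost every `ω` to regular conditional laws.
The joint conditional law of `(ρ, X)` provides the coupling. Joint measurability follows by writing
inverses, quantiles and envelopes as countable suprema and slopes as limits along a sequence. -/

lemma chord_le_of_le_affine {c s α β : ℝ} (h : ∀ z ∈ Icc (0 : ℝ) 1, φ z ≤ c + s * z)
    (hα : α ∈ Icc 0 q) (hβ : β ∈ Icc q 1) (hαβ : α < β) :
    ((β - q) * φ α + (q - α) * φ β) / (β - α) ≤ c + s * q := by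
  rw [div_le_iff₀ (by linarith)]
  have h1 := mul_le_mul_of_nonneg_left (h α ⟨hα.1, by linarith [hα.2, hβ.1, hβ.2]⟩)
    (sub_nonneg.2 hβ.1)
  have h2 := mul_le_mul_of_nonneg_left (h β ⟨by linarith [hα.1, hα.2, hβ.1], hβ.2⟩)
    (sub_nonneg.2 hα.2)
  linarith

lemma concaveEnvelope_set_nonempty (φ : ℝ → ℝ) (hq : q ∈ Icc (0 : ℝ) 1) :
    {z : ℝ | ∃ α ∈ Icc 0 q, ∃ β ∈ Icc q 1, α < β ∧
      z = ((β - q) * φ α + (q - α) * φ β) / (β - α)}.Nonempty :=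
  ⟨_, 0, ⟨le_rfl, hq.1⟩, 1, ⟨hq.2, le_rfl⟩, one_pos, rfl⟩

lemma concaveEnvelope_le_affine {c s : ℝ} (h : ∀ z ∈ Icc (0 : ℝ) 1, φ z ≤ c + s * z)
    (hq : q ∈ Icc (0 : ℝ) 1) : concaveEnvelope φ q ≤ c + s * q := by
  refine csSup_le (concaveEnvelope_set_nonempty φ hq) ?_
  rintro z ⟨α, hα, β, hβ, hαβ, rfl⟩
  exact chord_le_of_le_affine h hα hβ hαβ

/-- Continuity enters only through boundedness on `[0,1]`, without which the defining supremum would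
take a junk value. -/
lemma chord_le_concaveEnvelope (hφ : ContinuousOn φ (Icc 0 1)) {α β : ℝ}
    (hα : α ∈ Icc 0 q) (hβ : β ∈ Icc q 1) (hαβ : α < β) :
    ((β - q) * φ α + (q - α) * φ β) / (β - α) ≤ concaveEnvelope φ q := by
  obtain ⟨M, hM⟩ := (isCompact_Icc.image_of_continuousOn hφ).bddAbove
  refine le_csSup ⟨M + 0 * q, ?_⟩ ⟨α, hα, β, hβ, hαβ, rfl⟩
  rintro z ⟨α, hα, β, hβ, hαβ, rfl⟩
  exact chord_le_of_le_affine (fun z hz => by simpa using hM (mem_image_of_mem φ hz)) hα hβ hαβ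

lemma le_concaveEnvelope (hφ : ContinuousOn φ (Icc 0 1)) (hq : q ∈ Icc (0 : ℝ) 1) :
    φ q ≤ concaveEnvelope φ q := by
  rcases hq.2.lt_or_eq with h | h
  · have := chord_le_concaveEnvelope hφ (q := q) (α := q) (β := 1) ⟨hq.1, le_rfl⟩ ⟨hq.2, le_rfl⟩ h
    rwa [sub_self, zero_mul, add_zero, mul_div_cancel_left₀ _ (by linarith)] at this
  · have := chord_le_concaveEnvelope hφ (q := q) (α := 0) (β := 1) ⟨le_rfl, hq.1⟩ ⟨hq.2, le_rfl⟩
      one_pos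
    simpa [h] using this

lemma concaveEnvelope_zero (φ : ℝ → ℝ) : concaveEnvelope φ 0 = φ 0 := by
  refine csSup_eq_of_forall_le_of_forall_lt_exists_gt
    (concaveEnvelope_set_nonempty φ (by simp)) ?_ ?_
  · rintro z ⟨α, hα, β, hβ, hαβ, rfl⟩
    obtain rfl : α = 0 := le_antisymm hα.2 hα.1
    simp [mul_div_cancel_left₀ _ hαβ.ne']
  · intro w hw
    exact ⟨φ 0, ⟨0, by simp, 1, by simp, one_pos, by simp⟩, hw⟩

lemma concaveEnvelope_one (φ : ℝ → ℝ) : concaveEnvelope φ 1 = φ 1 := by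
  refine csSup_eq_of_forall_le_of_forall_lt_exists_gt
    (concaveEnvelope_set_nonempty φ (by simp)) ?_ ?_
  · rintro z ⟨α, hα, β, hβ, hαβ, rfl⟩
    obtain rfl : β = 1 := le_antisymm hβ.2 hβ.1
    simp [mul_div_cancel_left₀ _ (sub_pos.2 hαβ).ne']
  · intro w hw
    exact ⟨φ 1, ⟨0, by simp, 1, by simp, one_pos, by simp⟩, hw⟩

/-- A supporting line. The point of the envelope lies on or above every chord of `φ` across `q`, so
its slopes to the graph on the right are at most those on the left, and the supremum of the former
separates them. -/
lemma exists_affine_majorant (hφ : ContinuousOn φ (Icc 0 1)) (hq : q ∈ Ioo (0 : ℝ) 1) :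
    ∃ s, ∀ z ∈ Icc (0 : ℝ) 1, φ z ≤ concaveEnvelope φ q + s * (z - q) := by
  set v := concaveEnvelope φ q with hv
  have key : ∀ α ∈ Ico 0 q, ∀ β ∈ Ioc q 1, (φ β - v) / (β - q) ≤ (v - φ α) / (q - α) := by
    intro α hα β hβ
    have h := chord_le_concaveEnvelope hφ (q := q) (α := α) (β := β)
      ⟨hα.1, hα.2.le⟩ ⟨hβ.1.le, hβ.2⟩ (hα.2.trans hβ.1)
    rw [← hv, div_le_iff₀ (by linarith [hα.2, hβ.1])] at h
    rw [div_le_div_iff₀ (by linarith [hβ.1]) (by linarith [hα.2])]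
    linarith
  set S := (fun β => (φ β - v) / (β - q)) '' Ioc q 1
  have hS : S.Nonempty := ⟨_, mem_image_of_mem _ ⟨hq.2, le_rfl⟩⟩
  have hup : ∀ α ∈ Ico 0 q, (v - φ α) / (q - α) ∈ upperBounds S := by
    rintro α hα _ ⟨β, hβ, rfl⟩
    exact key α hα β hβ
  refine ⟨sSup S, fun z hz => ?_⟩
  rcases lt_trichotomy z q with h | h | h
  · have := csSup_le hS (hup z ⟨hz.1, h⟩)
    rw [le_div_iff₀ (by linarith)] at this
    linarith
  · subst h
    simpa using le_concaveEnvelope hφ hz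
  · have := le_csSup ⟨_, hup 0 ⟨le_rfl, hq.1⟩⟩ (mem_image_of_mem (fun β => (φ β - v) / (β - q))
      (show z ∈ Ioc q 1 from ⟨h, hz.2⟩))
    change _ ≤ sSup S at this
    rw [div_le_iff₀ (by linarith)] at this
    linarith

/-- The supporting line at an interior point dominates `φ`, hence the envelope, and meets the
envelope at that point. -/
lemma concaveOn_concaveEnvelope (hφ : ContinuousOn φ (Icc 0 1)) :
    ConcaveOn ℝ (Icc 0 1) (concaveEnvelope φ) := by
  refine ⟨convex_Icc 0 1, fun x hx y hy a b ha hb hab => ?_⟩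
  simp only [smul_eq_mul]
  have hq : a * x + b * y ∈ Icc (0 : ℝ) 1 := (convex_Icc (0 : ℝ) 1) hx hy ha hb hab
  obtain ⟨q, hq'⟩ : ∃ q, q = a * x + b * y := ⟨_, rfl⟩
  rw [← hq'] at hq ⊢
  have hax := mul_nonneg ha hx.1
  have hby := mul_nonneg hb hy.1
  have hax1 := mul_nonneg ha (sub_nonneg.2 hx.2)
  have hby1 := mul_nonneg hb (sub_nonneg.2 hy.2)
  -- At an endpoint a supporting line may fail to exist, but a convex combination reaches `0` or `1`
  -- only trivially.
  rcases hq.1.eq_or_lt with h0 | h0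
  · have h1 : a * x = 0 := by linarith
    have h2 : b * y = 0 := by linarith
    rw [← h0]
    rcases mul_eq_zero.1 h1 with h1 | h1 <;> rcases mul_eq_zero.1 h2 with h2 | h2 <;> subst h1 <;>
      subst h2
    · norm_num at hab
    · simp [show b = 1 by linarith]
    · simp [show a = 1 by linarith]
    · rw [← add_mul, hab, one_mul]
  rcases hq.2.eq_or_lt with h1 | h1
  · have h1' : a * (1 - x) = 0 := by nlinarith
    have h2' : b * (1 - y) = 0 := by nlinarith
    rw [h1]
    rcases mul_eq_zero.1 h1' with h1 | h1 <;> rcases mul_eq_zero.1 h2' with h2 | h2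
    · linarith
    · simp [h1, show y = 1 by linarith, show b = 1 by linarith]
    · simp [h2, show x = 1 by linarith, show a = 1 by linarith]
    · rw [show x = 1 by linarith, show y = 1 by linarith, ← add_mul, hab, one_mul]
  obtain ⟨s, hs⟩ := exists_affine_majorant hφ ⟨h0, h1⟩
  have hm : ∀ z ∈ Icc (0 : ℝ) 1, φ z ≤ (concaveEnvelope φ q - s * q) + s * z := fun z hz => by
    linarith [hs z hz]
  have hx' := mul_le_mul_of_nonneg_left (concaveEnvelope_le_affine hm hx) ha
  have hy' := mul_le_mul_of_nonneg_left (concaveEnvelope_le_affine hm hy) hb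
  have : a * (concaveEnvelope φ q - s * q + s * x) + b * (concaveEnvelope φ q - s * q + s * y)
      = concaveEnvelope φ q := by
    have hb' : b = 1 - a := by linarith
    subst hb'
    rw [hq']
    ring
  linarith

lemma concaveEnvelope_le_one (hm : MonotoneOn φ (Icc 0 1)) (hq : q ∈ Icc (0 : ℝ) 1) :
    concaveEnvelope φ q ≤ φ 1 := by
  have := concaveEnvelope_le_affine (c := φ 1) (s := 0)
    (fun z hz => by simpa using hm hz (right_mem_Icc.2 zero_le_one) hz.2) hq
  simpa using this

/-- The line with value `φ r` at `0` and `φ 1` at `r`, for `r` halfway between `q` and `1`,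
majorizes `φ` and is still below `φ 1` at `q`. This strictness is what makes the slopes positive. -/
lemma concaveEnvelope_lt_one (hm : StrictMonoOn φ (Icc 0 1)) (hq : q ∈ Ico (0 : ℝ) 1) :
    concaveEnvelope φ q < φ 1 := by
  have h1 : (1 : ℝ) ∈ Icc (0 : ℝ) 1 := right_mem_Icc.2 zero_le_one
  set r := (1 + q) / 2 with hr
  have hr1 : r < 1 := by linarith [hq.2]
  have hqr : q < r := by linarith [hq.2]
  have hr0 : 0 < r := by linarith [hq.1]
  have hrm : r ∈ Icc (0 : ℝ) 1 := ⟨hr0.le, hr1.le⟩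
  have hpos : 0 < φ 1 - φ r := sub_pos.2 (hm hrm h1 hr1)
  have := concaveEnvelope_le_affine (φ := φ) (c := φ r) (s := (φ 1 - φ r) / r) ?_
    ⟨hq.1, hq.2.le⟩
  · refine this.trans_lt ?_
    have h2 : (φ 1 - φ r) / r * q < φ 1 - φ r := by
      rw [div_mul_eq_mul_div, div_lt_iff₀ hr0]
      exact mul_lt_mul_of_pos_left hqr hpos
    linarith
  · intro z hz
    rcases le_total z r with h | h
    · have := hm.monotoneOn hz hrm h
      have : 0 ≤ (φ 1 - φ r) / r * z := mul_nonneg (div_nonneg hpos.le hr0.le) hz.1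
      linarith
    · have := hm.monotoneOn hz h1 hz.2
      have : φ 1 - φ r ≤ (φ 1 - φ r) / r * z := by
        rw [div_mul_eq_mul_div, le_div_iff₀ hr0]
        exact mul_le_mul_of_nonneg_left h hpos.le
      linarith

/-- Concavity gives continuity only in the interior. At `1` the envelope is squeezed between `φ` and
`φ 1`; at `0` it lies below a steep line starting at some `a'` slightly above `φ 0`. -/
lemma continuousOn_concaveEnvelope (hφ : ContinuousOn φ (Icc 0 1)) (hm : MonotoneOn φ (Icc 0 1)) :
    ContinuousOn (concaveEnvelope φ) (Icc 0 1) := by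
  have h1m : (1 : ℝ) ∈ Icc (0 : ℝ) 1 := right_mem_Icc.2 zero_le_one
  have h0m : (0 : ℝ) ∈ Icc (0 : ℝ) 1 := left_mem_Icc.2 zero_le_one
  intro q hq
  rcases hq.1.eq_or_lt with rfl | h0
  · have hc := hφ 0 h0m
    unfold ContinuousWithinAt at hc ⊢
    rw [concaveEnvelope_zero]
    rw [tendsto_order] at hc ⊢
    constructor
    · intro a ha
      filter_upwards [hc.1 a ha, self_mem_nhdsWithin] with z hz hz'
      exact hz.trans_le (le_concaveEnvelope hφ hz')
    · intro a ha
      obtain ⟨a', ha', ha'a⟩ := exists_between ha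
      have := hc.2 a' ha'
      rw [eventually_nhdsWithin_iff, Metric.eventually_nhds_iff] at this
      obtain ⟨δ, hδ, hδ'⟩ := this
      set K := (φ 1 - φ 0) / δ with hK
      have hφ01 : φ 0 ≤ φ 1 := hm h0m h1m zero_le_one
      have hKn : 0 ≤ K := div_nonneg (sub_nonneg.2 hφ01) hδ.le
      have hmaj : ∀ z ∈ Icc (0 : ℝ) 1, φ z ≤ a' + K * z := by
        intro z hz
        rcases lt_or_ge z δ with h | h
        · have h2 := hδ' (y := z) (by simpa [abs_of_nonneg hz.1] using h) hz
          have := mul_nonneg hKn hz.1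
          linarith
        · have h2 := hm hz h1m hz.2
          have : φ 1 - φ 0 ≤ K * z := by
            rw [hK, div_mul_eq_mul_div, le_div_iff₀ hδ]
            exact mul_le_mul_of_nonneg_left h (sub_nonneg.2 hφ01)
          linarith
      have ht : Tendsto (fun z => a' + K * z) (𝓝[Icc 0 1] 0) (𝓝 (a' + K * 0)) :=
        (Continuous.tendsto (by fun_prop) 0).mono_left nhdsWithin_le_nhds
      rw [mul_zero, add_zero] at ht
      filter_upwards [(tendsto_order.1 ht).2 a ha'a, self_mem_nhdsWithin] with z hz hz'
      exact (concaveEnvelope_le_affine hmaj hz').trans_lt hz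
  rcases hq.2.eq_or_lt with rfl | h1
  · have hc := hφ 1 h1m
    unfold ContinuousWithinAt at hc ⊢
    rw [concaveEnvelope_one]
    refine tendsto_of_tendsto_of_tendsto_of_le_of_le' hc tendsto_const_nhds ?_ ?_
    · filter_upwards [self_mem_nhdsWithin] with z hz using le_concaveEnvelope hφ hz
    · filter_upwards [self_mem_nhdsWithin] with z hz using concaveEnvelope_le_one hm hz
  · have := (concaveOn_concaveEnvelope hφ).continuousOn_interior
    rw [interior_Icc] at this
    exact (this.continuousAt (Ioo_mem_nhds h0 h1)).continuousWithinAt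

/-- Where the envelope lies strictly above the function it is affine. -/
lemma concaveEnvelope_affine_of_lt (hφ : ContinuousOn φ (Icc 0 1)) (hq : q ∈ Ioo (0 : ℝ) 1)
    (hlt : φ q < concaveEnvelope φ q) :
    ∃ α β c s, 0 ≤ α ∧ α < q ∧ q < β ∧ β ≤ 1 ∧ ∀ z ∈ Ioo α β, concaveEnvelope φ z = c + s * z := by
  set v := concaveEnvelope φ q with hv
  have hqm : q ∈ Icc (0 : ℝ) 1 := ⟨hq.1.le, hq.2.le⟩
  set ε := (v - φ q) / 2 with hε
  have hεp : 0 < ε := by simp only [hε]; linarith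
  obtain ⟨δ', hδ', hδφ⟩ := Metric.continuousWithinAt_iff.1 (hφ q hqm) ε hεp
  set δ := min δ' 1 with hδ
  have hδ0 : 0 < δ := lt_min hδ' one_pos
  -- Chords shorter than `δ` have values at most `φ q + ε`, strictly below the envelope, so the
  -- supremum is attained on the compact set of longer chords. The cap `δ ≤ 1` keeps `(0, 1)` in
  -- this set.
  set K : Set (ℝ × ℝ) := (Icc 0 q ×ˢ Icc q 1) ∩ {p | δ ≤ p.2 - p.1} with hK
  have hKc : IsCompact K := (isCompact_Icc.prod isCompact_Icc).inter_right
    (isClosed_le continuous_const (by fun_prop))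
  have hKne : K.Nonempty := ⟨(0, 1), ⟨⟨le_rfl, hq.1.le⟩, ⟨hq.2.le, le_rfl⟩⟩, by simp [hδ]⟩
  set g : ℝ × ℝ → ℝ := fun p => ((p.2 - q) * φ p.1 + (q - p.1) * φ p.2) / (p.2 - p.1) with hg
  have hgc : ContinuousOn g K := by
    have c1 : ContinuousOn (fun p : ℝ × ℝ => φ p.1) K := hφ.comp continuousOn_fst
      (fun p hp => ⟨hp.1.1.1, hp.1.1.2.trans hq.2.le⟩)
    have c2 : ContinuousOn (fun p : ℝ × ℝ => φ p.2) K := hφ.comp continuousOn_snd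
      (fun p hp => ⟨hq.1.le.trans hp.1.2.1, hp.1.2.2⟩)
    refine ContinuousOn.div ?_ (by fun_prop) ?_
    · exact ((by fun_prop : ContinuousOn (fun p : ℝ × ℝ => p.2 - q) K).mul c1).add
        ((by fun_prop : ContinuousOn (fun p : ℝ × ℝ => q - p.1) K).mul c2)
    · intro p hp
      have : δ ≤ p.2 - p.1 := hp.2
      linarith
  obtain ⟨p, hpK, hpmax⟩ := hKc.exists_isMaxOn hKne hgc
  have hpd : δ ≤ p.2 - p.1 := hpK.2
  have hgle : g p ≤ v := chord_le_concaveEnvelope hφ hpK.1.1 hpK.1.2 (by linarith)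
  have hvle : v ≤ max (g p) (φ q + ε) := by
    refine csSup_le (concaveEnvelope_set_nonempty φ hqm) ?_
    rintro z ⟨α, hα, β, hβ, hαβ, rfl⟩
    rcases le_or_gt δ (β - α) with h | h
    · exact le_max_of_le_left (hpmax (show (α, β) ∈ K from ⟨⟨hα, hβ⟩, h⟩))
    · refine le_max_of_le_right ?_
      have h' : β - α < δ' := h.trans_le (min_le_left _ _)
      have hα1 := hδφ (x := α) ⟨hα.1, hα.2.trans hq.2.le⟩
        (by rw [Real.dist_eq, abs_lt]; constructor <;> linarith [hα.2, hβ.1])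
      have hβ1 := hδφ (x := β) ⟨hq.1.le.trans hβ.1, hβ.2⟩
        (by rw [Real.dist_eq, abs_lt]; constructor <;> linarith [hα.2, hβ.1])
      rw [Real.dist_eq, abs_lt] at hα1 hβ1
      rw [div_le_iff₀ (by linarith)]
      have e1 := mul_le_mul_of_nonneg_left (show φ α ≤ φ q + ε by linarith) (sub_nonneg.2 hβ.1)
      have e2 := mul_le_mul_of_nonneg_left (show φ β ≤ φ q + ε by linarith) (sub_nonneg.2 hα.2)
      linarith
  have hgp : g p = v := by
    rcases le_max_iff.1 hvle with h | h
    · exact le_antisymm hgle h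
    · simp only [hε] at h; linarith
  -- A maximal chord with an end at `q` would have value `φ q` there, below the envelope.
  have hα : p.1 < q := by
    refine lt_of_le_of_ne hpK.1.1.2 fun h => ?_
    simp only [hg, h, sub_self, zero_mul, add_zero] at hgp
    rw [mul_div_cancel_left₀ _ (by rw [h] at hpd; linarith)] at hgp
    linarith
  have hβ : q < p.2 := by
    refine lt_of_le_of_ne hpK.1.2.1 fun h => ?_
    simp only [hg, ← h, sub_self, zero_mul, zero_add] at hgp
    rw [mul_div_cancel_left₀ _ (by linarith)] at hgp
    linarith
  obtain ⟨s, hs⟩ := exists_affine_majorant hφ hq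
  rw [← hv] at hs
  have hpα : p.1 ∈ Icc (0 : ℝ) 1 := ⟨hpK.1.1.1, by linarith [hq.2]⟩
  have hpβ : p.2 ∈ Icc (0 : ℝ) 1 := ⟨by linarith [hq.1], hpK.1.2.2⟩
  have hsα := hs _ hpα
  have hsβ := hs _ hpβ
  have hd : 0 < p.2 - p.1 := by linarith
  have hgp' : (p.2 - q) * φ p.1 + (q - p.1) * φ p.2 = v * (p.2 - p.1) := by
    rw [← hgp]; simp only [hg]; field_simp
  -- The supporting line dominates both ends of the maximal chord and meets the chord at `q`, so it
  -- passes through both ends. Chord and line then squeeze the envelope in between.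
  have eα : φ p.1 = v + s * (p.1 - q) := by
    refine le_antisymm hsα (le_of_mul_le_mul_left ?_ (sub_pos.2 hβ))
    have := mul_le_mul_of_nonneg_left hsβ (sub_nonneg.2 hα.le)
    linarith
  have eβ : φ p.2 = v + s * (p.2 - q) := by
    refine le_antisymm hsβ (le_of_mul_le_mul_left ?_ (sub_pos.2 hα))
    have := mul_le_mul_of_nonneg_left hsα (sub_nonneg.2 hβ.le)
    linarith
  refine ⟨p.1, p.2, v - s * q, s, hpα.1, hα, hβ, hpβ.2, fun z hz => le_antisymm ?_ ?_⟩
  · exact concaveEnvelope_le_affine (fun y hy => by linarith [hs y hy])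
      ⟨hpα.1.trans hz.1.le, hz.2.le.trans hpβ.2⟩
  · have := chord_le_concaveEnvelope hφ (q := z) (α := p.1) (β := p.2)
      ⟨hpα.1, hz.1.le⟩ ⟨hz.2.le, hpβ.2⟩ (by linarith)
    refine le_trans (le_of_eq ?_) this
    rw [eα, eβ]
    field_simp
    ring

/-- The right derivative of the concave envelope. -/
noncomputable def envelopeSlope (φ : ℝ → ℝ) (q : ℝ) : ℝ :=
  derivWithin (concaveEnvelope φ) (Ioi q) q

lemma hasDerivWithinAt_envelopeSlope (hφ : ContinuousOn φ (Icc 0 1)) (hq : q ∈ Ioo (0 : ℝ) 1) :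
    HasDerivWithinAt (concaveEnvelope φ) (envelopeSlope φ q) (Ioi q) q := by
  have := (concaveOn_concaveEnvelope hφ).neg.hasDerivWithinAt_rightDeriv_of_mem_interior
    (x := q) (by rwa [interior_Icc])
  have h2 := this.differentiableWithinAt.fun_neg
  simp only [Pi.neg_apply, neg_neg] at h2
  exact h2.hasDerivWithinAt

lemma slope_le_envelopeSlope (hφ : ContinuousOn φ (Icc 0 1)) (hq : q ∈ Ioo (0 : ℝ) 1) {z : ℝ}
    (hz : z ∈ Icc (0 : ℝ) 1) (hqz : q < z) :
    slope (concaveEnvelope φ) q z ≤ envelopeSlope φ q :=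
  (concaveOn_concaveEnvelope hφ).slope_le_of_hasDerivWithinAt_Ioi ⟨hq.1.le, hq.2.le⟩ hz hqz
    (hasDerivWithinAt_envelopeSlope hφ hq)

/-- The chord to `1` already has positive slope, and the right derivative is at least as large. -/
lemma envelopeSlope_pos (hφ : ContinuousOn φ (Icc 0 1)) (hm : StrictMonoOn φ (Icc 0 1))
    (hq : q ∈ Ioo (0 : ℝ) 1) : 0 < envelopeSlope φ q := by
  refine lt_of_lt_of_le ?_
    (slope_le_envelopeSlope hφ hq (right_mem_Icc.2 zero_le_one) hq.2)
  rw [slope_def_field, concaveEnvelope_one]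
  exact div_pos (sub_pos.2 (concaveEnvelope_lt_one hm ⟨hq.1.le, hq.2⟩)) (sub_pos.2 hq.2)

lemma antitoneOn_envelopeSlope (hφ : ContinuousOn φ (Icc 0 1)) :
    AntitoneOn (envelopeSlope φ) (Ioo 0 1) := by
  have h := (concaveOn_concaveEnvelope hφ).neg.monotoneOn_rightDeriv
  rw [interior_Icc] at h
  intro x hx y hy hxy
  have := h hx hy hxy
  simp only [Pi.neg_def, derivWithin.fun_neg] at this
  exact neg_le_neg_iff.1 this

/-- The concave envelope is differentiable where its right derivative has no jump. -/
lemma hasDerivAt_concaveEnvelope (hφ : ContinuousOn φ (Icc 0 1)) (hq : q ∈ Ioo (0 : ℝ) 1)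
    (h : ∀ ε > 0, ∃ z ∈ Ioo 0 q, envelopeSlope φ z < envelopeSlope φ q + ε) :
    HasDerivAt (concaveEnvelope φ) (envelopeSlope φ q) q := by
  have hcon := concaveOn_concaveEnvelope hφ
  have hleft : HasDerivWithinAt (concaveEnvelope φ)
      (derivWithin (concaveEnvelope φ) (Iio q) q) (Iio q) q := by
    have := hcon.neg.hasDerivWithinAt_leftDeriv_of_mem_interior (x := q) (by rwa [interior_Icc])
    have h2 := this.differentiableWithinAt.fun_neg
    simp only [Pi.neg_apply, neg_neg] at h2
    exact h2.hasDerivWithinAt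
  have hqm : q ∈ Icc (0 : ℝ) 1 := ⟨hq.1.le, hq.2.le⟩
  set l := derivWithin (concaveEnvelope φ) (Iio q) q
  -- The left derivative at `q` is at most the slope between `z` and `q`, which is at most the right
  -- derivative at `z`.
  have hl1 : l ≤ envelopeSlope φ q := by
    refine le_of_forall_pos_lt_add fun ε hε => ?_
    obtain ⟨z, hz, hlt⟩ := h ε hε
    have hz' : z ∈ Ioo (0 : ℝ) 1 := ⟨hz.1, hz.2.trans hq.2⟩
    exact ((hcon.le_slope_of_hasDerivWithinAt_Iio ⟨hz'.1.le, hz'.2.le⟩ hqm hz.2 hleft).trans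
      (slope_le_envelopeSlope hφ hz' hqm hz.2)).trans_lt hlt
  have hl2 : envelopeSlope φ q ≤ l := by
    have := hcon.neg.leftDeriv_le_rightDeriv_of_mem_interior (x := q) (by rwa [interior_Icc])
    simp only [Pi.neg_def, derivWithin.fun_neg] at this
    exact neg_le_neg_iff.1 this
  rw [le_antisymm hl1 hl2] at hleft
  have := hleft.Iic_of_Iio.union (hasDerivWithinAt_envelopeSlope hφ hq).Ici_of_Ioi
  rwa [Iic_union_Ici, hasDerivWithinAt_univ] at this

/-- The right derivative of the envelope does not jump at `q`, tested along a sequence. -/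
def NoJump (R : ℝ → ℝ) (q : ℝ) : Prop :=
  ∀ k : ℕ, ∃ n : ℕ, 0 < q - 1 / ((n : ℝ) + 1) ∧ R (q - 1 / ((n : ℝ) + 1)) < R q + 1 / ((k : ℝ) + 1)

lemma hasDerivAt_of_noJump (hφ : ContinuousOn φ (Icc 0 1)) (hq : q ∈ Ioo (0 : ℝ) 1)
    (h : NoJump (envelopeSlope φ) q) : HasDerivAt (concaveEnvelope φ) (envelopeSlope φ q) q := by
  refine hasDerivAt_concaveEnvelope hφ hq fun ε hε => ?_
  obtain ⟨k, hk⟩ := exists_nat_one_div_lt hε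
  obtain ⟨n, h0, h1⟩ := h k
  exact ⟨_, ⟨h0, sub_lt_self _ Nat.one_div_pos_of_nat⟩, h1.trans (by linarith)⟩

/-- A monotone function has countably many discontinuities. The good points are described by
`NoJump` because its countable quantifiers yield a jointly measurable set when the envelope is
random. -/
lemma countable_not_noJump (hφ : ContinuousOn φ (Icc 0 1)) :
    {q ∈ Ioo (0 : ℝ) 1 | ¬ NoJump (envelopeSlope φ) q}.Countable := by
  refine ((antitoneOn_envelopeSlope hφ).countable_not_continuousWithinAt).mono ?_
  rintro q ⟨hq, hnd⟩
  refine ⟨hq, fun hc => hnd fun k => ?_⟩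
  have hc' : ContinuousAt (envelopeSlope φ) q := hc.continuousAt (Ioo_mem_nhds hq.1 hq.2)
  have hs : Tendsto (fun n : ℕ => q - 1 / ((n : ℝ) + 1)) atTop (𝓝 q) := by
    simpa using tendsto_one_div_add_atTop_nhds_zero_nat.const_sub q
  have hk : envelopeSlope φ q < envelopeSlope φ q + 1 / ((k : ℝ) + 1) :=
    lt_add_of_pos_right _ Nat.one_div_pos_of_nat
  have h1 : ∀ᶠ n : ℕ in atTop, 0 < q - 1 / ((n : ℝ) + 1) := (tendsto_order.1 hs).1 0 hq.1
  exact (h1.and ((tendsto_order.1 (hc'.tendsto.comp hs)).2 _ hk)).exists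

lemma countable_not_hasDerivAt_concaveEnvelope (hφ : ContinuousOn φ (Icc 0 1)) :
    {q ∈ Ioo (0 : ℝ) 1 | ¬ HasDerivAt (concaveEnvelope φ) (envelopeSlope φ q) q}.Countable :=
  (countable_not_noJump hφ).mono fun q (h : q ∈ Ioo (0 : ℝ) 1 ∧ _) =>
    And.intro h.1 fun hj => h.2 (hasDerivAt_of_noJump hφ h.1 hj)

/-- The fundamental theorem of calculus for the concave envelope. -/
lemma integral_envelopeSlope (hφ : ContinuousOn φ (Icc 0 1)) (hm : StrictMonoOn φ (Icc 0 1))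
    {a : ℝ} (ha : a ∈ Icc (0 : ℝ) 1) :
    IntervalIntegrable (envelopeSlope φ) volume a 1 ∧
      ∫ q in a..1, envelopeSlope φ q = φ 1 - concaveEnvelope φ a := by
  have hsub : Icc a 1 ⊆ Icc 0 1 := Icc_subset_Icc_left ha.1
  have hsub' : ∀ q ∈ Ioo a 1, q ∈ Ioo (0 : ℝ) 1 := fun q hq => ⟨ha.1.trans_lt hq.1, hq.2⟩
  have hc := (continuousOn_concaveEnvelope hφ hm.monotoneOn).mono hsub
  have hd : ∀ q ∈ Ioo a 1, HasDerivWithinAt (concaveEnvelope φ) (envelopeSlope φ q) (Ioi q) q :=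
    fun q hq => hasDerivWithinAt_envelopeSlope hφ (hsub' q hq)
  have hi : IntervalIntegrable (envelopeSlope φ) volume a 1 := by
    rw [intervalIntegrable_iff_integrableOn_Ioc_of_le ha.2]
    exact intervalIntegral.integrableOn_deriv_right_of_nonneg hc hd
      fun q hq => (envelopeSlope_pos hφ hm (hsub' q hq)).le
  refine ⟨hi, ?_⟩
  rw [intervalIntegral.integral_eq_sub_of_hasDeriv_right_of_le ha.2 hc hd hi, concaveEnvelope_one]

/-- Where the envelope lies strictly above the function its slope is locally constant. -/
lemma envelopeSlope_const_of_lt (hφ : ContinuousOn φ (Icc 0 1)) (hq : q ∈ Ioo (0 : ℝ) 1)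
    (hlt : φ q < concaveEnvelope φ q) :
    ∃ α β s, 0 ≤ α ∧ α < q ∧ q < β ∧ β ≤ 1 ∧ ∀ z ∈ Ioo α β, envelopeSlope φ z = s := by
  obtain ⟨α, β, c, s, h0, h1, h2, h3, h⟩ := concaveEnvelope_affine_of_lt hφ hq hlt
  refine ⟨α, β, s, h0, h1, h2, h3, fun z hz => ?_⟩
  have hd : HasDerivAt (fun z => c + s * z) s z := by
    simpa using ((hasDerivAt_id z).const_mul s).const_add c
  have : HasDerivAt (concaveEnvelope φ) s z :=
    hd.congr_of_eventuallyEq (by filter_upwards [Ioo_mem_nhds hz.1 hz.2] with y hy using h y hy)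
  exact this.hasDerivWithinAt.derivWithin (uniqueDiffWithinAt_Ioi z)

end Envelope

end RDPFPP

namespace RDPFPP

/-! ### Utilities and inverse marginals -/

lemma contDiffOn_succ_of_hasDerivAt {n : ℕ} {f g : ℝ → ℝ}
    (h : ∀ x, 0 < x → HasDerivAt f (g x) x) (hg : ContDiffOn ℝ n g (Ioi 0)) :
    ContDiffOn ℝ (n + 1) f (Ioi 0) := by
  rw [contDiffOn_succ_iff_deriv_of_isOpen isOpen_Ioi]
  refine ⟨fun x hx => (h x hx).differentiableAt.differentiableWithinAt, fun hn => ?_, ?_⟩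
  · simp at hn
  · exact hg.congr fun x hx => (h x hx).deriv

namespace IsInverseMarginal

variable {I : ℝ → ℝ}

lemma hasDerivAt (h : IsInverseMarginal I) {y : ℝ} (hy : 0 < y) : HasDerivAt I (deriv I y) y :=
  (differentiableAt_of_deriv_ne_zero (h.deriv_neg y hy).ne).hasDerivAt

lemma continuousOn (h : IsInverseMarginal I) : ContinuousOn I (Ioi 0) := h.contDiffOn.continuousOn

lemma strictAntiOn (h : IsInverseMarginal I) : StrictAntiOn I (Ioi 0) :=
  strictAntiOn_of_deriv_neg (convex_Ioi 0) h.continuousOn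
    (by rw [interior_Ioi]; exact fun x hx => h.deriv_neg x hx)

lemma pos (h : IsInverseMarginal I) {y : ℝ} (hy : 0 < y) : 0 < I y := by
  have h1 : 0 ≤ I (y + 1) := by
    refine le_of_tendsto h.top ?_
    filter_upwards [eventually_ge_atTop (y + 1)] with z hz
    exact h.strictAntiOn.antitoneOn (show 0 < y + 1 by linarith) (show 0 < z by linarith) hz
  exact h1.trans_lt (h.strictAntiOn hy (show 0 < y + 1 by linarith) (by linarith))

lemma surjOn (h : IsInverseMarginal I) : SurjOn I (Ioi 0) (Ioi 0) := by
  intro x hx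
  obtain ⟨a, ha, ha'⟩ : ∃ a, I a > x ∧ 0 < a :=
    ((h.zero.eventually_gt_atTop x).and self_mem_nhdsWithin).exists
  obtain ⟨b, hb, hb'⟩ : ∃ b, I b < x ∧ 0 < b :=
    (((tendsto_order.1 h.top).2 x hx).and (eventually_gt_atTop 0)).exists
  exact isPreconnected_Ioi.intermediate_value hb' ha' h.continuousOn ⟨hb.le, ha.le⟩

lemma posInv_pos (h : IsInverseMarginal I) {x : ℝ} (hx : 0 < x) : 0 < posInv I x :=
  Function.invFunOn_mem (h.surjOn hx)

lemma apply_posInv (h : IsInverseMarginal I) {x : ℝ} (hx : 0 < x) : I (posInv I x) = x :=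
  Function.invFunOn_eq (h.surjOn hx)

lemma posInv_apply (h : IsInverseMarginal I) {y : ℝ} (hy : 0 < y) : posInv I (I y) = y :=
  h.strictAntiOn.injOn (h.posInv_pos (h.pos hy)) hy (h.apply_posInv (h.pos hy))

lemma lt_iff (h : IsInverseMarginal I) {x y : ℝ} (hx : 0 < x) (hy : 0 < y) :
    x < I y ↔ y < posInv I x := by
  rw [← h.strictAntiOn.lt_iff_gt (h.posInv_pos hx) hy, h.apply_posInv hx]

lemma strictAntiOn_posInv (h : IsInverseMarginal I) : StrictAntiOn (posInv I) (Ioi 0) := by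
  intro x hx y hy hxy
  rw [← h.lt_iff hx (h.posInv_pos hy), h.apply_posInv hy]
  exact hxy

lemma hasDerivAt_posInv (h : IsInverseMarginal I) {x : ℝ} (hx : 0 < x) :
    HasDerivAt (posInv I) (deriv I (posInv I x))⁻¹ x := by
  refine HasDerivAt.of_local_left_inverse ?_ (h.hasDerivAt (h.posInv_pos hx))
    (h.deriv_neg _ (h.posInv_pos hx)).ne ?_
  · have hm : MonotoneOn (fun z => - posInv I z) (Ioi 0) :=
      fun a ha b hb hab => neg_le_neg (h.strictAntiOn_posInv.antitoneOn ha hb hab)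
    have himg : Iio (0 : ℝ) ⊆ (fun z => - posInv I z) '' Ioi 0 := by
      intro z hz
      have hz' : 0 < -z := neg_pos.2 hz
      exact ⟨I (-z), h.pos hz', by simp [h.posInv_apply hz']⟩
    have := continuousAt_of_monotoneOn_of_image_mem_nhds hm (Ioi_mem_nhds hx)
      (mem_of_superset (Iio_mem_nhds (neg_lt_zero.2 (h.posInv_pos hx))) himg)
    have h2 : ContinuousAt (fun z => - -RDPFPP.posInv I z) x := this.neg
    simpa only [neg_neg] using h2
  · filter_upwards [Ioi_mem_nhds hx] with z hz using h.apply_posInv hz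

lemma posInv (h : IsInverseMarginal I) : IsInverseMarginal (posInv I) where
  contDiffOn := by
    have hc : ContinuousOn (RDPFPP.posInv I) (Ioi 0) :=
      fun x hx => (h.hasDerivAt_posInv hx).continuousAt.continuousWithinAt
    have hd : ContinuousOn (deriv I) (Ioi 0) := by
      have := h.contDiffOn
      exact this.continuousOn_deriv_of_isOpen isOpen_Ioi le_rfl
    have := contDiffOn_succ_of_hasDerivAt (n := 0) (f := RDPFPP.posInv I)
      (fun x hx => h.hasDerivAt_posInv hx) (by
        rw [Nat.cast_zero, contDiffOn_zero]
        exact (hd.comp hc fun x hx => h.posInv_pos hx).inv₀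
          fun x hx => (h.deriv_neg _ (h.posInv_pos hx)).ne)
    simpa using this
  deriv_neg x hx := by
    rw [(h.hasDerivAt_posInv hx).deriv]
    exact inv_lt_zero.2 (h.deriv_neg _ (h.posInv_pos hx))
  zero := by
    rw [tendsto_atTop]
    intro M
    have hM : 0 < max M 1 := lt_max_of_lt_right one_pos
    filter_upwards [Ioo_mem_nhdsGT (h.pos hM)] with z hz
    exact (le_max_left M 1).trans ((h.lt_iff hz.1 hM).1 hz.2).le
  top := by
    rw [tendsto_order]
    constructor
    · intro a ha
      filter_upwards [eventually_gt_atTop 0] with z hz using ha.trans (h.posInv_pos hz)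
    · intro a ha
      filter_upwards [eventually_gt_atTop (I a)] with z hz
      have hz0 := (h.pos ha).trans hz
      rwa [← h.apply_posInv hz0, h.strictAntiOn.lt_iff_gt ha (h.posInv_pos hz0)] at hz

lemma congr {J : ℝ → ℝ} (h : IsInverseMarginal I) (hJ : ∀ y, 0 < y → J y = I y) :
    IsInverseMarginal J where
  contDiffOn := h.contDiffOn.congr hJ
  deriv_neg y hy := by
    have : J =ᶠ[𝓝 y] I := by filter_upwards [Ioi_mem_nhds hy] with z hz using hJ z hz
    rw [this.deriv_eq]
    exact h.deriv_neg y hy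
  zero := h.zero.congr' (by filter_upwards [self_mem_nhdsWithin] with z hz using (hJ z hz).symm)
  top := h.top.congr' (by filter_upwards [eventually_gt_atTop 0] with z hz using (hJ z hz).symm)

end IsInverseMarginal

lemma IsUtility.deriv {u : ℝ → ℝ} (h : IsUtility u) : IsInverseMarginal (deriv u) where
  contDiffOn := by
    have := h.contDiffOn
    rw [show (2 : WithTop ℕ∞) = 1 + 1 by norm_num,
      contDiffOn_succ_iff_deriv_of_isOpen isOpen_Ioi] at this
    exact this.2.2
  deriv_neg := h.deriv2_neg
  zero := h.deriv_zero
  top := h.deriv_top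

/-- `u` is a utility function and `I` is the inverse of `u'`. -/
structure IsDual (u I : ℝ → ℝ) : Prop where
  isInverseMarginal : IsInverseMarginal I
  hasDerivAt : ∀ x, 0 < x → HasDerivAt u (posInv I x) x

namespace IsDual

variable {u I : ℝ → ℝ}

lemma _root_.RDPFPP.IsUtility.isDual (h : IsUtility u) : IsDual u (posInv (_root_.deriv u)) where
  isInverseMarginal := h.deriv.posInv
  hasDerivAt x hx := by
    have h1 := (differentiableAt_of_deriv_ne_zero (h.deriv_pos x hx).ne').hasDerivAt
    -- Here `I` is itself the inverse of `u'`, and inverting it once more returns `u'`.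
    have h2 := h.deriv.posInv.posInv_apply (h.deriv.pos hx)
    rw [h.deriv.posInv_apply hx] at h2
    rwa [h2]

lemma congr {v J : ℝ → ℝ} (h : IsDual u I) (hv : ∀ x, 0 < x → v x = u x)
    (hJ : ∀ y, 0 < y → J y = I y) : IsDual v J := by
  have hI := h.isInverseMarginal.congr hJ
  refine ⟨hI, fun x hx => ?_⟩
  have : posInv J x = posInv I x := by
    have := hI.posInv_apply (h.isInverseMarginal.posInv_pos hx)
    rwa [hJ _ (h.isInverseMarginal.posInv_pos hx), h.isInverseMarginal.apply_posInv hx] at this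
  rw [this]
  exact (h.hasDerivAt x hx).congr_of_eventuallyEq
    (by filter_upwards [Ioi_mem_nhds hx] with z hz using hv z hz)

lemma deriv_eq (h : IsDual u I) {x : ℝ} (hx : 0 < x) : deriv u x = posInv I x :=
  (h.hasDerivAt x hx).deriv

lemma isUtility (h : IsDual u I) : IsUtility u where
  contDiffOn := by
    have := contDiffOn_succ_of_hasDerivAt (n := 1) h.hasDerivAt
      (by simpa using h.isInverseMarginal.posInv.contDiffOn)
    rwa [show ((1 : ℕ) : WithTop ℕ∞) + 1 = 2 by norm_num] at this
  deriv_pos x hx := by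
    rw [h.deriv_eq hx]
    exact h.isInverseMarginal.posInv_pos hx
  deriv2_neg x hx := (h.isInverseMarginal.posInv.congr fun y hy => h.deriv_eq hy).deriv_neg x hx
  deriv_zero := (h.isInverseMarginal.posInv.congr fun y hy => h.deriv_eq hy).zero
  deriv_top := (h.isInverseMarginal.posInv.congr fun y hy => h.deriv_eq hy).top

lemma deriv_pos (h : IsDual u I) {x : ℝ} (hx : 0 < x) : 0 < deriv u x := h.isUtility.deriv_pos x hx

lemma apply_deriv (h : IsDual u I) {x : ℝ} (hx : 0 < x) : I (deriv u x) = x := by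
  rw [h.deriv_eq hx, h.isInverseMarginal.apply_posInv hx]

lemma continuousOn (h : IsDual u I) : ContinuousOn u (Ioi 0) :=
  fun x hx => (h.hasDerivAt x hx).continuousAt.continuousWithinAt

end IsDual

/-- The convex conjugate `s ↦ u(I(s)) - s I(s)` of the utility function `u`. -/
def conjugate (u I : ℝ → ℝ) (s : ℝ) : ℝ := u (I s) - s * I s

namespace IsDual

variable {u I : ℝ → ℝ}

/-- The terms containing `I'` cancel because `u'(I(s)) = s`. -/
lemma hasDerivAt_conjugate (h : IsDual u I) {s : ℝ} (hs : 0 < s) :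
    HasDerivAt (conjugate u I) (-I s) s := by
  have hI := h.isInverseMarginal.hasDerivAt hs
  have hu := (h.hasDerivAt _ (h.isInverseMarginal.pos hs)).comp s hI
  rw [h.isInverseMarginal.posInv_apply hs] at hu
  have := hu.sub ((hasDerivAt_id s).mul hI)
  exact this.congr_deriv (by simp only [id]; ring)

/-- Fenchel's inequality: the concave `u` lies below its tangent at `I s`, whose slope is `s`. -/
lemma le_conjugate_add (h : IsDual u I) {x s : ℝ} (hx : 0 < x) (hs : 0 < s) :
    u x ≤ conjugate u I s + s * x := by
  have hc : ConcaveOn ℝ (Ioi 0) u := by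
    refine AntitoneOn.concaveOn_of_deriv (convex_Ioi 0) h.continuousOn ?_ ?_ <;> rw [interior_Ioi]
    · exact fun y hy => (h.hasDerivAt y hy).differentiableAt.differentiableWithinAt
    · exact h.isUtility.deriv.strictAntiOn.antitoneOn
  have hp := h.isInverseMarginal.pos hs
  have hd := h.hasDerivAt _ hp
  rw [h.isInverseMarginal.posInv_apply hs] at hd
  unfold conjugate
  rcases lt_trichotomy x (I s) with hlt | heq | hlt
  · have := hc.le_slope_of_hasDerivAt hx hp hlt hd
    rw [slope_def_field, le_div_iff₀ (by linarith)] at this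
    linarith
  · rw [← heq]; linarith
  · have := hc.slope_le_of_hasDerivAt hp hx hlt hd
    rw [slope_def_field, div_le_iff₀ (by linarith)] at this
    linarith

lemma extend_le (h : IsDual u I) {x s : ℝ} (hx : 0 ≤ x) (hs : 0 < s) :
    extend u x ≤ ((conjugate u I s + s * x : ℝ) : EReal) := by
  unfold extend
  split_ifs with hx'
  · exact EReal.coe_le_coe_iff.2 (h.le_conjugate_add hx' hs)
  · obtain rfl : x = 0 := le_antisymm (not_lt.1 hx') hx
    rw [← EReal.le_of_forall_lt_iff_le]
    intro c hc
    rw [EReal.coe_lt_coe_iff, mul_zero, add_zero] at hc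
    -- At zero wealth it suffices to bound `u` at one point; at this one the Fenchel bound is
    -- exactly `c`.
    have hz : 0 < (c - conjugate u I s) / s := div_pos (sub_pos.2 hc) hs
    refine (iInf_le _ (⟨_, hz⟩ : Ioi (0 : ℝ))).trans (EReal.coe_le_coe_iff.2 ?_)
    have := h.le_conjugate_add hz hs
    rwa [mul_div_cancel₀ _ hs.ne', add_sub_cancel] at this

lemma extend_of_pos {x : ℝ} (hx : 0 < x) : extend u x = (u x : EReal) := if_pos hx

/-- A bound that holds for all conjugate variables is a bound by the utility. -/
lemma le_extend_of_forall (h : IsDual u I) {x : ℝ} (hx : 0 ≤ x) {z : EReal}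
    (hz : ∀ y, 0 < y → z ≤ ((conjugate u I y + y * x : ℝ) : EReal)) : z ≤ extend u x := by
  unfold extend
  split_ifs with hx'
  -- The conjugate variable `u'(x)` turns Fenchel's inequality into an equality.
  · refine (hz _ (h.deriv_pos hx')).trans (EReal.coe_le_coe_iff.2 ?_)
    unfold conjugate
    rw [h.apply_deriv hx']
    linarith
  · obtain rfl : x = 0 := le_antisymm (not_lt.1 hx') hx
    -- At zero wealth `y = u'(w)` gives the bound `u(w) - w u'(w)`, which is below `u(w)`.
    refine le_iInf fun w => (hz _ (h.deriv_pos w.2)).trans (EReal.coe_le_coe_iff.2 ?_)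
    unfold conjugate
    rw [h.apply_deriv w.2]
    have := mul_pos (h.deriv_pos w.2) w.2
    linarith

lemma _root_.RDPFPP.IsInverseMarginal.measurable_indicator (h : IsInverseMarginal I) :
    Measurable ((Ioi (0 : ℝ)).indicator I) := by
  rw [← Set.piecewise_eq_indicator]
  exact h.continuousOn.measurable_piecewise continuousOn_const measurableSet_Ioi

/-- This is `V' = -I` integrated along the ray `t ↦ t d`. With `d` the envelope slope, the integrand
is the one of condition (ii). -/
lemma conjugate_sub (h : IsDual u I) {d y : ℝ} (hd : 0 < d) (hy : 0 < y) :
    conjugate u I (y * d) - conjugate u I d = -∫ t in (1 : ℝ)..y, I (t * d) * d := by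
  have hpos : ∀ t ∈ uIcc 1 y, 0 < t := fun t ht =>
    (lt_min one_pos hy).trans_le ht.1
  have hderiv : ∀ t ∈ uIcc 1 y, HasDerivAt (fun t => conjugate u I (t * d)) (-(I (t * d) * d)) t := by
    intro t ht
    have := (h.hasDerivAt_conjugate (mul_pos (hpos t ht) hd)).comp t
      ((hasDerivAt_id t).mul_const d)
    exact this.congr_deriv (by ring)
  have hcont : ContinuousOn (fun t => -(I (t * d) * d)) (uIcc 1 y) :=
    ((h.isInverseMarginal.continuousOn.comp (by fun_prop)
      fun t ht => mul_pos (hpos t ht) hd).mul continuousOn_const).neg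
  have := intervalIntegral.integral_eq_sub_of_hasDerivAt hderiv hcont.intervalIntegrable
  rw [intervalIntegral.integral_neg, one_mul] at this
  exact this.symm

end IsDual

/-! ### Integrating the conjugate utility over the envelope slopes -/

section Fubini

variable {α : Type*} {mα : MeasurableSpace α} {ν : Measure α} {D : α → ℝ}
  {u I U J : ℝ → ℝ}

/-- A nonintegrable function has Bochner integral `0` by convention, whereas `J y > 0`. -/
lemma integrable_of_integral_eq_inverseMarginal (hJ : IsInverseMarginal J)
    (h : ∀ y, 0 < y → ∫ a, I (y * D a) * D a ∂ν = J y) {y : ℝ} (hy : 0 < y) :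
    Integrable (fun a => I (y * D a) * D a) ν := by
  by_contra hn
  have := h y hy
  rw [integral_undef hn] at this
  exact (hJ.pos hy).ne this

/-- The conjugate utilities of consecutive periods are related as their inverse marginals are. -/
lemma integral_conjugate [SFinite ν] (hu : IsDual u I) (hU : IsDual U J) (hDm : Measurable D)
    (hD : ∀ᵐ a ∂ν, 0 < D a) (h : ∀ y, 0 < y → ∫ a, I (y * D a) * D a ∂ν = J y)
    (hi : Integrable (fun a => u (I (D a))) ν) (h1 : ∫ a, u (I (D a)) ∂ν = U (J 1))
    {y : ℝ} (hy : 0 < y) :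
    Integrable (fun a => conjugate u I (y * D a)) ν ∧
      ∫ a, conjugate u I (y * D a) ∂ν = conjugate U J y := by
  have hID : ∀ {t}, 0 < t → Integrable (fun a => I (t * D a) * D a) ν :=
    fun ht => integrable_of_integral_eq_inverseMarginal hU.isInverseMarginal h ht
  have hpos : ∀ t ∈ uIoc 1 y, 0 < t := fun t ht => (lt_min one_pos hy).trans ht.1
  -- Nothing is known about `I` outside `(0,∞)`; cutting it off there gives joint measurability.
  set f : ℝ × α → ℝ := fun p => (Ioi (0 : ℝ)).indicator I (p.1 * D p.2) * D p.2 with hf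
  have hfm : Measurable f :=
    (hu.isInverseMarginal.measurable_indicator.comp (by fun_prop)).mul (by fun_prop)
  have hfeq : ∀ t, 0 < t → ∀ᵐ a ∂ν, f (t, a) = I (t * D a) * D a := by
    intro t ht
    filter_upwards [hD] with a ha
    simp only [hf]
    rw [indicator_of_mem (show t * D a ∈ Ioi (0 : ℝ) from mul_pos ht ha)]
  -- Integrability on the product: the inner integral of the norm at `t` is `J t`, which is
  -- continuous on the compact interval.
  have hfint : Integrable f ((volume.restrict (uIoc 1 y)).prod ν) := by
    rw [integrable_prod_iff hfm.aestronglyMeasurable]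
    constructor
    · filter_upwards [ae_restrict_mem measurableSet_uIoc] with t ht
      exact (hID (hpos t ht)).congr (by
        filter_upwards [hfeq t (hpos t ht)] with a ha using ha.symm)
    · have hc : IntegrableOn J (uIoc 1 y) :=
        (ContinuousOn.intervalIntegrable (hU.isInverseMarginal.continuousOn.mono
          fun t ht => (lt_min one_pos hy).trans_le ht.1)).def'
      refine hc.congr ?_
      filter_upwards [ae_restrict_mem measurableSet_uIoc] with t ht
      rw [← h t (hpos t ht)]
      refine integral_congr_ae ?_
      filter_upwards [hfeq t (hpos t ht), hD] with a ha hDa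
      rw [ha, Real.norm_of_nonneg]
      exact mul_nonneg (hu.isInverseMarginal.pos (mul_pos (hpos t ht) hDa)).le hDa.le
  have hinner : ∀ᵐ a ∂ν, ∫ t in (1 : ℝ)..y, I (t * D a) * D a = ∫ t in (1 : ℝ)..y, f (t, a) := by
    filter_upwards [hD] with a ha
    refine intervalIntegral.integral_congr fun t ht => ?_
    have ht' : 0 < t := (lt_min one_pos hy).trans_le ht.1
    simp only [hf]
    rw [indicator_of_mem (show t * D a ∈ Ioi (0 : ℝ) from mul_pos ht' ha)]
  have hA : Integrable (fun a => ∫ t in (1 : ℝ)..y, f (t, a)) ν := by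
    simp only [intervalIntegral.intervalIntegral_eq_integral_uIoc]
    exact hfint.integral_prod_right.smul (if (1 : ℝ) ≤ y then (1 : ℝ) else -1)
  have hB : ∫ a, (∫ t in (1 : ℝ)..y, f (t, a)) ∂ν = ∫ t in (1 : ℝ)..y, J t := by
    simp only [intervalIntegral.intervalIntegral_eq_integral_uIoc, integral_smul]
    rw [← integral_integral_swap (f := fun t a => f (t, a)) hfint]
    congr 1
    refine setIntegral_congr_fun measurableSet_uIoc fun t ht => ?_
    rw [← h t (hpos t ht)]
    exact integral_congr_ae (hfeq t (hpos t ht))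
  have hV : conjugate U J y - conjugate U J 1 = -∫ t in (1 : ℝ)..y, J t := by
    simpa using hU.conjugate_sub one_pos hy
  -- The case `y = 1` comes from `V(D) = u(I(D)) - D I(D)`; other `y` follow by integrating in `t`.
  have h1' : Integrable (fun a => conjugate u I (D a)) ν := by
    have := hID one_pos
    simp only [one_mul] at this
    refine (hi.sub this).congr (Eventually.of_forall fun a => ?_)
    simp [conjugate, mul_comm]
  have h1'' : ∫ a, conjugate u I (D a) ∂ν = conjugate U J 1 := by
    have h2 := hID one_pos
    have h3 := h 1 one_pos
    simp only [one_mul] at h2 h3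
    calc ∫ a, conjugate u I (D a) ∂ν = ∫ a, (u (I (D a)) - I (D a) * D a) ∂ν := by
          simp [conjugate, mul_comm]
      _ = _ := by rw [integral_sub hi h2, h1, h3]; simp [conjugate]
  have heq : ∀ᵐ a ∂ν, conjugate u I (y * D a)
      = conjugate u I (D a) - ∫ t in (1 : ℝ)..y, f (t, a) := by
    filter_upwards [hD, hinner] with a ha hin
    have := hu.conjugate_sub ha hy
    rw [← hin]
    linarith
  refine ⟨(h1'.sub hA).congr (by filter_upwards [heq] with a ha using ha.symm), ?_⟩
  rw [integral_congr_ae heq, integral_sub h1' hA, h1'', hB]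
  linarith

end Fubini

end RDPFPP

namespace RDPFPP

/-! ### Quantile functions -/

/-- The uniform law on `(0,1)`. -/
noncomputable abbrev unif : Measure ℝ := volume.restrict (Ioo (0 : ℝ) 1)

instance : IsProbabilityMeasure unif := ⟨by simp⟩

lemma ae_unif_mem : ∀ᵐ p ∂unif, p ∈ Ioo (0 : ℝ) 1 := ae_restrict_mem measurableSet_Ioo

lemma ae_unif_ne (a : ℝ) : ∀ᵐ p ∂unif, p ≠ a := by
  rw [ae_iff]
  simp

lemma unif_Iic {a : ℝ} (ha : a ∈ Icc (0 : ℝ) 1) : unif (Iic a) = ENNReal.ofReal a := by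
  have h : unif (Iic a) = unif (Iio a) := measure_congr Iio_ae_eq_Iic.symm
  rw [h, Measure.restrict_apply measurableSet_Iio, show Iio a ∩ Ioo 0 1 = Ioo 0 a by
    ext x; constructor
    · rintro ⟨h1, h2⟩; exact ⟨h2.1, h1⟩
    · rintro ⟨h1, h2⟩; exact ⟨h2, h1, lt_of_lt_of_le h2 ha.2⟩]
  simp

lemma intervalIntegral_eq_unif (f : ℝ → ℝ) : ∫ p in (0 : ℝ)..1, f p = ∫ p, f p ∂unif := by
  rw [intervalIntegral.integral_of_le zero_le_one, integral_Ioc_eq_integral_Ioo]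

section Quantile

variable (μ : Measure ℝ) [IsProbabilityMeasure μ]

lemma quantile_set_nonempty {p : ℝ} (hp : 0 < p) : {x : ℝ | μ.real (Iic x) ≤ p}.Nonempty := by
  obtain ⟨x, hx⟩ := ((tendsto_order.1 (tendsto_cdf_atBot μ)).2 p hp).exists
  rw [cdf_eq_real] at hx
  exact ⟨x, hx.le⟩

lemma quantile_set_bddAbove {p : ℝ} (hp : p < 1) : BddAbove {x : ℝ | μ.real (Iic x) ≤ p} := by
  obtain ⟨x, hx⟩ := ((tendsto_order.1 (tendsto_cdf_atTop μ)).1 p hp).exists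
  rw [cdf_eq_real] at hx
  refine ⟨x, fun y hy => ?_⟩
  by_contra hxy
  exact (hx.trans_le (measureReal_mono (Iic_subset_Iic.2 (not_le.1 hxy).le))).not_ge hy

variable {μ}

lemma quantile_le_of_lt {p x : ℝ} (hp : 0 < p) (h : p < μ.real (Iic x)) : quantile μ p ≤ x := by
  refine csSup_le (quantile_set_nonempty μ hp) fun y hy => ?_
  by_contra hxy
  exact (h.trans_le (measureReal_mono (Iic_subset_Iic.2 (not_le.1 hxy).le))).not_ge hy

lemma lt_quantile_of_lt {p x : ℝ} (hp : p < 1) (h : μ.real (Iic x) < p) : x < quantile μ p := by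
  have hr := (cdf μ).right_continuous x
  have hx : cdf μ x < p := by rwa [cdf_eq_real]
  have := (tendsto_order.1 (hr.tendsto.mono_left (nhdsWithin_mono x Ioi_subset_Ici_self))).2 p hx
  obtain ⟨y, hy, hxy⟩ := (this.and self_mem_nhdsWithin).exists
  rw [cdf_eq_real] at hy
  exact lt_of_lt_of_le hxy (le_csSup (quantile_set_bddAbove μ hp) hy.le)

/-- With the supremum over `≤`, the equivalence can fail only at the single value `p = F(x)`. -/
lemma ae_lt_quantile_iff (μ : Measure ℝ) [IsProbabilityMeasure μ] (x : ℝ) :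
    ∀ᵐ p ∂unif, x < quantile μ p ↔ μ.real (Iic x) < p := by
  filter_upwards [ae_unif_mem, ae_unif_ne (μ.real (Iic x))] with p hp hne
  refine ⟨fun h => ?_, lt_quantile_of_lt hp.2⟩
  by_contra hn
  exact (quantile_le_of_lt hp.1 (lt_of_le_of_ne (not_lt.1 hn) hne)).not_gt h

lemma monotoneOn_quantile (μ : Measure ℝ) [IsProbabilityMeasure μ] :
    MonotoneOn (quantile μ) (Ioo 0 1) := fun _ hp _ hq hpq =>
  csSup_le_csSup (quantile_set_bddAbove μ hq.2) (quantile_set_nonempty μ hp.1)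
    fun _ hx => le_trans hx hpq

lemma aemeasurable_quantile (μ : Measure ℝ) [IsProbabilityMeasure μ] :
    AEMeasurable (quantile μ) unif :=
  aemeasurable_restrict_of_monotoneOn measurableSet_Ioo (monotoneOn_quantile μ)

/-- The law of the quantile function. -/
lemma map_quantile (μ : Measure ℝ) [IsProbabilityMeasure μ] : unif.map (quantile μ) = μ := by
  have := Measure.isProbabilityMeasure_map (aemeasurable_quantile μ)
  refine Measure.ext_of_Iic _ _ fun x => ?_
  rw [Measure.map_apply_of_aemeasurable (aemeasurable_quantile μ) measurableSet_Iic]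
  have : quantile μ ⁻¹' Iic x =ᵐ[unif] Iic (μ.real (Iic x)) := by
    filter_upwards [ae_lt_quantile_iff μ x] with p hp
    exact propext ⟨fun h => not_lt.1 fun h' => (not_lt.2 h) (hp.2 h'),
      fun h => not_lt.1 fun h' => (not_lt.2 h) (hp.1 h')⟩
  rw [measure_congr this, unif_Iic ⟨measureReal_nonneg, measureReal_le_one⟩, ofReal_measureReal]

end Quantile

/-! ### Weighting functions and distorted laws -/

namespace IsWeighting

variable {w : ℝ → ℝ}

lemma continuousOn (h : IsWeighting w) : ContinuousOn w (Icc 0 1) := h.contDiffOn.continuousOn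

lemma mem (h : IsWeighting w) {p : ℝ} (hp : p ∈ Icc (0 : ℝ) 1) : w p ∈ Icc (0 : ℝ) 1 := by
  have h0 := h.strictMonoOn.monotoneOn (left_mem_Icc.2 zero_le_one) hp hp.1
  have h1 := h.strictMonoOn.monotoneOn hp (right_mem_Icc.2 zero_le_one) hp.2
  rw [h.map_zero] at h0
  rw [h.map_one] at h1
  exact ⟨h0, h1⟩

lemma surjOn (h : IsWeighting w) : SurjOn w (Icc 0 1) (Icc 0 1) := by
  have := intermediate_value_Icc zero_le_one h.continuousOn
  rwa [h.map_zero, h.map_one] at this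

lemma weightInv_mem (h : IsWeighting w) {r : ℝ} (hr : r ∈ Icc (0 : ℝ) 1) :
    weightInv w r ∈ Icc (0 : ℝ) 1 := Function.invFunOn_mem (h.surjOn hr)

lemma apply_weightInv (h : IsWeighting w) {r : ℝ} (hr : r ∈ Icc (0 : ℝ) 1) :
    w (weightInv w r) = r := Function.invFunOn_eq (h.surjOn hr)

lemma weightInv_apply (h : IsWeighting w) {p : ℝ} (hp : p ∈ Icc (0 : ℝ) 1) :
    weightInv w (w p) = p :=
  h.strictMonoOn.injOn (h.weightInv_mem (h.mem hp)) hp (h.apply_weightInv (h.mem hp))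

lemma lt_weightInv_iff (h : IsWeighting w) {p r : ℝ} (hp : p ∈ Icc (0 : ℝ) 1)
    (hr : r ∈ Icc (0 : ℝ) 1) : p < weightInv w r ↔ w p < r := by
  rw [← h.strictMonoOn.lt_iff_lt hp (h.weightInv_mem hr), h.apply_weightInv hr]

lemma weightInv_lt_iff (h : IsWeighting w) {p r : ℝ} (hp : p ∈ Icc (0 : ℝ) 1)
    (hr : r ∈ Icc (0 : ℝ) 1) : weightInv w r < p ↔ r < w p := by
  rw [← h.strictMonoOn.lt_iff_lt (h.weightInv_mem hr) hp, h.apply_weightInv hr]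

lemma strictMonoOn_weightInv (h : IsWeighting w) : StrictMonoOn (weightInv w) (Icc 0 1) := by
  intro a ha b hb hab
  rwa [h.weightInv_lt_iff (h.weightInv_mem hb) ha, h.apply_weightInv hb]

lemma weightInv_zero (h : IsWeighting w) : weightInv w 0 = 0 := by
  simpa [h.map_zero] using h.weightInv_apply (left_mem_Icc.2 zero_le_one)

lemma continuousOn_weightInv (h : IsWeighting w) : ContinuousOn (weightInv w) (Icc 0 1) := by
  intro r hr
  have hm := h.weightInv_mem hr
  unfold ContinuousWithinAt
  rw [tendsto_order]
  constructor
  · intro a ha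
    rcases lt_or_ge a 0 with h0 | h0
    · filter_upwards [self_mem_nhdsWithin] with z hz using h0.trans_le (h.weightInv_mem hz).1
    · have ha' : a ∈ Icc (0 : ℝ) 1 := ⟨h0, ha.le.trans hm.2⟩
      filter_upwards [self_mem_nhdsWithin,
        mem_nhdsWithin_of_mem_nhds (Ioi_mem_nhds ((h.lt_weightInv_iff ha' hr).1 ha))] with z hz hz'
      exact (h.lt_weightInv_iff ha' hz).2 hz'
  · intro a ha
    rcases lt_or_ge 1 a with h0 | h0
    · filter_upwards [self_mem_nhdsWithin] with z hz using (h.weightInv_mem hz).2.trans_lt h0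
    · have ha' : a ∈ Icc (0 : ℝ) 1 := ⟨hm.1.trans ha.le, h0⟩
      filter_upwards [self_mem_nhdsWithin,
        mem_nhdsWithin_of_mem_nhds (Iio_mem_nhds ((h.weightInv_lt_iff ha' hr).1 ha))] with z hz hz'
      exact (h.weightInv_lt_iff ha' hz).2 hz'

lemma one_sub_mem {p : ℝ} (hp : p ∈ Icc (0 : ℝ) 1) : 1 - p ∈ Icc (0 : ℝ) 1 :=
  ⟨sub_nonneg.2 hp.2, sub_le_self 1 hp.1⟩

lemma real_Iic_mem (ν : Measure ℝ) [IsProbabilityMeasure ν] (x : ℝ) :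
    ν.real (Iic x) ∈ Icc (0 : ℝ) 1 := ⟨measureReal_nonneg, measureReal_le_one⟩

lemma phi_one_sub (h : IsWeighting w) (μ : Measure ℝ) {q : ℝ} (hq : q ∈ Icc (0 : ℝ) 1) :
    Phi w μ (1 - w q) = -∫ p in (0 : ℝ)..q, quantile μ p := by
  rw [Phi, sub_sub_cancel, h.weightInv_apply hq]

lemma phi_one (h : IsWeighting w) (μ : Measure ℝ) : Phi w μ 1 = 0 := by
  simp [Phi, h.weightInv_zero]

variable (ν : Measure ℝ) [IsProbabilityMeasure ν]

lemma monotone_distorted (h : IsWeighting w) :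
    Monotone (fun ξ : ℝ => 1 - w (1 - ν.real (Iic ξ))) := by
  intro x y hxy
  have := h.strictMonoOn.monotoneOn (one_sub_mem (real_Iic_mem ν y))
    (one_sub_mem (real_Iic_mem ν x))
    (sub_le_sub_left (measureReal_mono (Iic_subset_Iic.2 hxy)) 1)
  simp only
  linarith

/-- Right-continuity passes from the cdf to its distortion, so the right limit built into
`stieltjesFunction` changes nothing. -/
lemma stieltjesFunction_distorted (h : IsWeighting w) (x : ℝ) :
    (h.monotone_distorted ν).stieltjesFunction x = 1 - w (1 - ν.real (Iic x)) := by
  rw [Monotone.stieltjesFunction_eq]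
  refine ContinuousWithinAt.rightLim_eq ?_
  have hc : ContinuousWithinAt (fun x => 1 - ν.real (Iic x)) (Ici x) x := by
    have := (cdf ν).right_continuous x
    simp only [funext fun x => cdf_eq_real ν x] at this
    exact continuousWithinAt_const.sub this
  have hw : ContinuousWithinAt w (Icc 0 1) (1 - ν.real (Iic x)) :=
    h.continuousOn _ (one_sub_mem (real_Iic_mem ν x))
  have := ContinuousWithinAt.comp (t := Icc 0 1) (f := fun x => 1 - ν.real (Iic x)) hw hc
    fun z _ => one_sub_mem (real_Iic_mem ν z)
  exact continuousWithinAt_const.sub this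

lemma tendsto_distorted {l : Filter ℝ} {a : ℝ} (h : IsWeighting w) (ha : a ∈ Icc (0 : ℝ) 1)
    (hl : Tendsto (cdf ν) l (𝓝 a)) :
    Tendsto (h.monotone_distorted ν).stieltjesFunction l (𝓝 (1 - w (1 - a))) := by
  have : ((h.monotone_distorted ν).stieltjesFunction : ℝ → ℝ)
      = fun x => 1 - w (1 - ν.real (Iic x)) := funext (h.stieltjesFunction_distorted ν)
  rw [this]
  simp only [funext fun x => cdf_eq_real ν x] at hl
  refine tendsto_const_nhds.sub ?_
  have hw : ContinuousWithinAt w (Icc 0 1) (1 - a) := h.continuousOn _ (one_sub_mem ha)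
  exact hw.tendsto.comp (tendsto_nhdsWithin_iff.2
    ⟨tendsto_const_nhds.sub hl, Eventually.of_forall fun z => one_sub_mem (real_Iic_mem ν z)⟩)

lemma tendsto_distorted_atBot (h : IsWeighting w) :
    Tendsto (h.monotone_distorted ν).stieltjesFunction atBot (𝓝 0) := by
  simpa [h.map_one] using h.tendsto_distorted ν (by simp) (tendsto_cdf_atBot ν)

lemma tendsto_distorted_atTop (h : IsWeighting w) :
    Tendsto (h.monotone_distorted ν).stieltjesFunction atTop (𝓝 1) := by
  simpa [h.map_zero] using h.tendsto_distorted ν (by simp) (tendsto_cdf_atTop ν)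

lemma distortedLaw_eq (h : IsWeighting w) :
    distortedLaw w ν = (h.monotone_distorted ν).stieltjesFunction.measure :=
  dif_pos (h.monotone_distorted ν)

lemma isProbabilityMeasure_distortedLaw (h : IsWeighting w) :
    IsProbabilityMeasure (distortedLaw w ν) := by
  rw [h.distortedLaw_eq ν]
  exact StieltjesFunction.isProbabilityMeasure _ (h.tendsto_distorted_atBot ν)
    (h.tendsto_distorted_atTop ν)

lemma distortedLaw_real_Iic (h : IsWeighting w) (x : ℝ) :
    (distortedLaw w ν).real (Iic x) = 1 - w (1 - ν.real (Iic x)) := by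
  rw [h.distortedLaw_eq ν, Measure.real, StieltjesFunction.measure_Iic _
    (h.tendsto_distorted_atBot ν), sub_zero, h.stieltjesFunction_distorted ν, ENNReal.toReal_ofReal]
  exact sub_nonneg.2 (h.mem (one_sub_mem (real_Iic_mem ν x))).2

end IsWeighting

/-! ### Laws of state-price densities -/

/-- Atomless laws on `(0,∞)` with finite mean. -/
structure IsPricingLaw (μ : Measure ℝ) : Prop where
  pos : ∀ᵐ x ∂μ, 0 < x
  integrable : Integrable (fun x => x) μ
  atomless : ∀ x : ℝ, μ {x} = 0

namespace IsPricingLaw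

variable {μ : Measure ℝ} [IsProbabilityMeasure μ]

lemma quantile_pos (h : IsPricingLaw μ) {p : ℝ} (hp : p ∈ Ioo (0 : ℝ) 1) : 0 < quantile μ p := by
  refine lt_quantile_of_lt hp.2 ?_
  have : μ (Iic 0) = 0 := by
    have := h.pos
    rw [ae_iff] at this
    simpa [Iic, not_lt] using this
  rw [Measure.real, this]
  exact hp.1

lemma integrableOn_quantile (h : IsPricingLaw μ) : IntegrableOn (quantile μ) (Ioo 0 1) := by
  have := h.integrable
  rw [← map_quantile μ] at this
  exact (integrable_map_measure aestronglyMeasurable_id (aemeasurable_quantile μ)).1 this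

lemma intervalIntegrable_quantile (h : IsPricingLaw μ) :
    IntervalIntegrable (quantile μ) volume 0 1 := by
  rw [intervalIntegrable_iff_integrableOn_Ioo_of_le zero_le_one]
  exact h.integrableOn_quantile

lemma continuousOn_integral_quantile (h : IsPricingLaw μ) :
    ContinuousOn (fun q => ∫ p in (0 : ℝ)..q, quantile μ p) (Icc 0 1) := by
  have := intervalIntegral.continuousOn_primitive_interval' h.intervalIntegrable_quantile
    left_mem_uIcc
  rwa [uIcc_of_le zero_le_one] at this

lemma strictMonoOn_integral_quantile (h : IsPricingLaw μ) :
    StrictMonoOn (fun q => ∫ p in (0 : ℝ)..q, quantile μ p) (Icc 0 1) := by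
  intro a ha b hb hab
  have hi : ∀ {x y : ℝ}, x ∈ Icc (0 : ℝ) 1 → y ∈ Icc (0 : ℝ) 1 →
      IntervalIntegrable (quantile μ) volume x y := fun hx hy =>
    h.intervalIntegrable_quantile.mono_set (by
      rw [uIcc_of_le zero_le_one]
      exact uIcc_subset_Icc hx hy)
  have h0 : (0 : ℝ) ∈ Icc (0 : ℝ) 1 := left_mem_Icc.2 zero_le_one
  have := intervalIntegral.intervalIntegral_pos_of_pos_on (hi ha hb)
    (fun x hx => h.quantile_pos ⟨ha.1.trans_lt hx.1, hx.2.trans_le hb.2⟩) hab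
  have h2 := intervalIntegral.integral_add_adjacent_intervals (hi h0 ha) (hi ha hb)
  simp only
  linarith

/-- The layer-cake formula for the integrated quantile function. -/
lemma ofReal_integral_quantile (h : IsPricingLaw μ) {q : ℝ} (hq : q ∈ Icc (0 : ℝ) 1) :
    ENNReal.ofReal (∫ p in (0 : ℝ)..q, quantile μ p) =
      ∫⁻ s in Ioi (0 : ℝ), ENNReal.ofReal (q - μ.real (Iic s)) := by
  have hsub : Ioo 0 q ⊆ Ioo (0 : ℝ) 1 := Ioo_subset_Ioo_right hq.2
  have hac : volume.restrict (Ioo 0 q) ≤ unif := Measure.restrict_mono hsub le_rfl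
  have hnn : 0 ≤ᵐ[volume.restrict (Ioo 0 q)] quantile μ := by
    filter_upwards [ae_restrict_mem measurableSet_Ioo] with p hp
      using (h.quantile_pos (hsub hp)).le
  rw [intervalIntegral.integral_of_le hq.1, integral_Ioc_eq_integral_Ioo,
    ofReal_integral_eq_lintegral_ofReal (h.integrableOn_quantile.mono_set hsub) hnn,
    lintegral_eq_lintegral_meas_lt _ hnn ((aemeasurable_quantile μ).mono_measure hac)]
  refine setLIntegral_congr_fun measurableSet_Ioi fun s _ => ?_
  have : {p | s < quantile μ p} =ᵐ[volume.restrict (Ioo 0 q)] Ioi (μ.real (Iic s)) := by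
    filter_upwards [ae_mono hac (ae_lt_quantile_iff μ s)] with p hp using propext hp
  rw [measure_congr this, Measure.restrict_apply measurableSet_Ioi,
    show Ioi (μ.real (Iic s)) ∩ Ioo 0 q = Ioo (μ.real (Iic s)) q by
      ext p
      constructor
      · rintro ⟨h1, h2⟩; exact ⟨h1, h2.2⟩
      · rintro ⟨h1, h2⟩; exact ⟨h1, measureReal_nonneg.trans_lt h1, h2⟩]
  simp

variable {w : ℝ → ℝ}

lemma continuousOn_phi (h : IsPricingLaw μ) (hw : IsWeighting w) :
    ContinuousOn (Phi w μ) (Icc 0 1) := by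
  have h1 : ContinuousOn (fun q => weightInv w (1 - q)) (Icc 0 1) :=
    hw.continuousOn_weightInv.comp (by fun_prop) fun q hq => IsWeighting.one_sub_mem hq
  exact (h.continuousOn_integral_quantile.comp h1
    fun q hq => hw.weightInv_mem (IsWeighting.one_sub_mem hq)).neg

lemma strictMonoOn_phi (h : IsPricingLaw μ) (hw : IsWeighting w) :
    StrictMonoOn (Phi w μ) (Icc 0 1) := by
  intro a ha b hb hab
  have ha' := IsWeighting.one_sub_mem ha
  have hb' := IsWeighting.one_sub_mem hb
  exact neg_lt_neg (h.strictMonoOn_integral_quantile (hw.weightInv_mem hb') (hw.weightInv_mem ha')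
    (hw.strictMonoOn_weightInv hb' ha' (by linarith)))

end IsPricingLaw

end RDPFPP

namespace RDPFPP

/-! ### Extended integrals of utilities -/

/-- The layer-cake formula for `g` under the measure with density `f`. It lets prices be compared
level set by level set. -/
lemma lintegral_ofReal_mul_ofReal {α : Type*} {mα : MeasurableSpace α} {m : Measure α} [SFinite m]
    {f g : α → ℝ} (hf : AEMeasurable f m) (hg : AEMeasurable g m) (hg0 : 0 ≤ᵐ[m] g) :
    ∫⁻ a, ENNReal.ofReal (f a) * ENNReal.ofReal (g a) ∂m =
      ∫⁻ t in Ioi (0 : ℝ), ∫⁻ a in {a | t < g a}, ENNReal.ofReal (f a) ∂m := by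
  have hac := withDensity_absolutelyContinuous m (fun a => ENNReal.ofReal (f a))
  have h1 := lintegral_withDensity_eq_lintegral_mul₀ hf.ennreal_ofReal hg.ennreal_ofReal
  simp only [Pi.mul_apply] at h1
  rw [← h1, lintegral_eq_lintegral_meas_lt _ (hac.ae_le hg0) (hg.mono_ac hac)]
  simp only [withDensity_apply']

lemma monotone_extend {u : ℝ → ℝ} (hu : MonotoneOn u (Ioi 0)) : Monotone (extend u) := by
  intro x y hxy
  unfold extend
  split_ifs with hx hy hy
  · exact EReal.coe_le_coe_iff.2 (hu hx hy hxy)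
  · exact absurd (hx.trans_le hxy) hy
  · exact iInf_le (fun z : Ioi (0 : ℝ) => ((u z : ℝ) : EReal)) ⟨y, hy⟩
  · exact le_rfl

lemma IsDual.monotoneOn {u I : ℝ → ℝ} (h : IsDual u I) : MonotoneOn u (Ioi 0) :=
  (strictMonoOn_of_deriv_pos (convex_Ioi 0) h.continuousOn
    (by rw [interior_Ioi]; exact fun x hx => h.deriv_pos hx)).monotoneOn

/-! ### Utilities integrated against image measures -/

section Map

variable {α : Type*} {mα : MeasurableSpace α} {m : Measure α} {Q : α → ℝ} {u : ℝ → ℝ}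

lemma restrict_map_Ici (hQ : AEMeasurable Q m) (hQ0 : ∀ᵐ a ∂m, 0 ≤ Q a) :
    (m.map Q).restrict (Ici 0) = m.map Q :=
  Measure.restrict_eq_self_of_ae_mem ((ae_map_iff hQ measurableSet_Ici).2 hQ0)

lemma posPart_map (hu : MonotoneOn u (Ioi 0)) (hQ : AEMeasurable Q m) (hQ0 : ∀ᵐ a ∂m, 0 ≤ Q a) :
    posPart u (m.map Q) = ∫⁻ a, (extend u (Q a)).toENNReal ∂m := by
  rw [posPart, restrict_map_Ici hQ hQ0, lintegral_map' _ hQ]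
  exact ((monotone_extend hu).measurable.ereal_toENNReal).aemeasurable

lemma negPart_map (hu : MonotoneOn u (Ioi 0)) (hQ : AEMeasurable Q m) (hQ0 : ∀ᵐ a ∂m, 0 ≤ Q a) :
    negPart u (m.map Q) = ∫⁻ a, (-extend u (Q a)).toENNReal ∂m := by
  rw [negPart, restrict_map_Ici hQ hQ0, lintegral_map' _ hQ]
  exact ((monotone_extend hu).measurable.neg.ereal_toENNReal).aemeasurable

/-- Both parts of an integrable function are finite, so the difference in `EReal` is the ordinary
one. -/
lemma coe_integral_eq {C : α → ℝ} (hC : Integrable C m) :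
    ((∫ a, C a ∂m : ℝ) : EReal) =
      ((∫⁻ a, ENNReal.ofReal (C a) ∂m : ENNReal) : EReal) -
        ((∫⁻ a, ENNReal.ofReal (-C a) ∂m : ENNReal) : EReal) := by
  have h1 : ∫⁻ a, ENNReal.ofReal (C a) ∂m ≠ ⊤ := by
    refine ne_top_of_le_ne_top hC.2.ne (lintegral_mono fun a => ?_)
    exact Real.ofReal_le_enorm (C a)
  have h2 : ∫⁻ a, ENNReal.ofReal (-C a) ∂m ≠ ⊤ := by
    refine ne_top_of_le_ne_top hC.neg.2.ne (lintegral_mono fun a => ?_)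
    exact Real.ofReal_le_enorm (-C a)
  rw [integral_eq_lintegral_pos_part_sub_lintegral_neg_part hC, EReal.coe_sub,
    EReal.coe_ennreal_toReal h1, EReal.coe_ennreal_toReal h2]

/-- The integrable majorant makes the positive part finite. The negative part may be infinite, and
the integral is then `-∞`. -/
lemma extIntegral_map_le (hu : MonotoneOn u (Ioi 0)) (hQ : AEMeasurable Q m)
    (hQ0 : ∀ᵐ a ∂m, 0 ≤ Q a) {C : α → ℝ} (hC : Integrable C m)
    (h : ∀ᵐ a ∂m, extend u (Q a) ≤ (C a : EReal)) :
    posPart u (m.map Q) < ⊤ ∧ extIntegral u (m.map Q) ≤ ((∫ a, C a ∂m : ℝ) : EReal) := by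
  have hp : ∫⁻ a, (extend u (Q a)).toENNReal ∂m ≤ ∫⁻ a, ENNReal.ofReal (C a) ∂m := by
    refine lintegral_mono_ae ?_
    filter_upwards [h] with a ha
    exact (EReal.toENNReal_le_toENNReal ha).trans_eq (EReal.real_coe_toENNReal _)
  have hn : ∫⁻ a, ENNReal.ofReal (-C a) ∂m ≤ ∫⁻ a, (-extend u (Q a)).toENNReal ∂m := by
    refine lintegral_mono_ae ?_
    filter_upwards [h] with a ha
    refine le_trans (le_of_eq ?_) (EReal.toENNReal_le_toENNReal (EReal.neg_le_neg_iff.2 ha))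
    rw [← EReal.coe_neg, EReal.real_coe_toENNReal]
  rw [extIntegral, posPart_map hu hQ hQ0, negPart_map hu hQ hQ0, coe_integral_eq hC]
  refine ⟨hp.trans_lt (lt_top_iff_ne_top.2 ?_), EReal.sub_le_sub (EReal.coe_ennreal_le_coe_ennreal_iff.2 hp)
    (EReal.coe_ennreal_le_coe_ennreal_iff.2 hn)⟩
  refine ne_top_of_le_ne_top hC.2.ne (lintegral_mono fun a => ?_)
  exact Real.ofReal_le_enorm (C a)

lemma extIntegral_map_eq (hu : MonotoneOn u (Ioi 0)) (hQ : AEMeasurable Q m)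
    (hQ0 : ∀ᵐ a ∂m, 0 < Q a) (hC : Integrable (fun a => u (Q a)) m) :
    posPart u (m.map Q) < ⊤ ∧ extIntegral u (m.map Q) = ((∫ a, u (Q a) ∂m : ℝ) : EReal) := by
  have hQ0' : ∀ᵐ a ∂m, 0 ≤ Q a := by filter_upwards [hQ0] with a ha using ha.le
  have he : ∀ᵐ a ∂m, extend u (Q a) = (u (Q a) : EReal) := by
    filter_upwards [hQ0] with a ha using if_pos ha
  refine ⟨(extIntegral_map_le hu hQ hQ0' hC (he.mono fun a ha => ha.le)).1, ?_⟩
  rw [extIntegral, posPart_map hu hQ hQ0', negPart_map hu hQ hQ0', coe_integral_eq hC]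
  congr 2
  · refine lintegral_congr_ae ?_
    filter_upwards [he] with a ha
    rw [ha, EReal.real_coe_toENNReal]
  · refine lintegral_congr_ae ?_
    filter_upwards [he] with a ha
    rw [ha, ← EReal.coe_neg, EReal.real_coe_toENNReal]

end Map

/-! ### The upper bound for rank-dependent utilities -/

section UpperBound

variable {μ : Measure ℝ} [IsProbabilityMeasure μ] {w : ℝ → ℝ}

lemma measurable_envelopeSlope (φ : ℝ → ℝ) : Measurable (envelopeSlope φ) :=
  measurable_derivWithin_Ioi _

lemma IsPricingLaw.ae_envelopeSlope_pos (h : IsPricingLaw μ) (hw : IsWeighting w) :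
    ∀ᵐ η ∂unif, 0 < envelopeSlope (Phi w μ) η := by
  filter_upwards [ae_unif_mem] with η hη
    using envelopeSlope_pos (h.continuousOn_phi hw) (h.strictMonoOn_phi hw) hη

/-- The fundamental theorem of calculus with `Φ(1) = 0`. The set is prescribed only up to null sets
because level sets of quantile functions are known only in that sense. -/
lemma setLIntegral_envelopeSlope (h : IsPricingLaw μ) (hw : IsWeighting w) {a : ℝ}
    (ha : a ∈ Icc (0 : ℝ) 1) {S : Set ℝ} (hS : ∀ᵐ η ∂unif, η ∈ S ↔ a < η) :
    ∫⁻ η in S, ENNReal.ofReal (envelopeSlope (Phi w μ) η) ∂unif =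
      ENNReal.ofReal (-concaveEnvelope (Phi w μ) a) := by
  have hS' : S =ᵐ[unif] Ioi a := by filter_upwards [hS] with η hη using propext hη
  have hset : Ioi a ∩ Ioo 0 1 = Ioo a 1 := by
    ext x; constructor
    · rintro ⟨h1, h2⟩; exact ⟨h1, h2.2⟩
    · rintro ⟨h1, h2⟩; exact ⟨h1, ha.1.trans_lt h1, h2⟩
  obtain ⟨hi, he⟩ := integral_envelopeSlope (h.continuousOn_phi hw) (h.strictMonoOn_phi hw) ha
  rw [hw.phi_one, zero_sub, intervalIntegral.integral_of_le ha.2,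
    integral_Ioc_eq_integral_Ioo] at he
  rw [intervalIntegrable_iff_integrableOn_Ioo_of_le ha.2] at hi
  rw [setLIntegral_congr hS', Measure.restrict_restrict measurableSet_Ioi, hset, ← he,
    ofReal_integral_eq_lintegral_ofReal hi]
  filter_upwards [ae_restrict_mem measurableSet_Ioo] with η hη
  exact (envelopeSlope_pos (h.continuousOn_phi hw) (h.strictMonoOn_phi hw)
    ⟨ha.1.trans_lt hη.1, hη.2⟩).le

/-- The Hardy-Littlewood inequality for the expectation of a state-price density on an event. -/
lemma integral_quantile_le_setLIntegral (h : IsPricingLaw μ) {κ : Measure (ℝ × ℝ)}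
    [IsProbabilityMeasure κ] (hκ : κ.map Prod.fst = μ) (t : ℝ) :
    ENNReal.ofReal (∫ p in (0 : ℝ)..(κ.map Prod.snd).real (Ioi t), quantile μ p) ≤
      ∫⁻ p in {p | t < p.2}, ENNReal.ofReal p.1 ∂κ := by
  have := Measure.isProbabilityMeasure_map (μ := κ) (f := Prod.snd) measurable_snd.aemeasurable
  rw [h.ofReal_integral_quantile ⟨measureReal_nonneg, measureReal_le_one⟩]
  have hnn : 0 ≤ᵐ[κ.restrict {p | t < p.2}] fun p : ℝ × ℝ => p.1 := by
    have h1 : ∀ᵐ p ∂κ, 0 < p.1 := by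
      have := h.pos
      rw [← hκ] at this
      exact ae_of_ae_map measurable_fst.aemeasurable this
    filter_upwards [ae_restrict_of_ae h1] with p hp using hp.le
  rw [lintegral_eq_lintegral_meas_lt _ hnn measurable_fst.aemeasurable]
  refine lintegral_mono fun s => ?_
  have hms : MeasurableSet {p : ℝ × ℝ | s < p.1} := measurableSet_lt measurable_const measurable_fst
  rw [Measure.restrict_apply hms, ENNReal.ofReal_sub _ measureReal_nonneg, ofReal_measureReal,
    ofReal_measureReal, tsub_le_iff_right, Measure.map_apply measurable_snd measurableSet_Ioi,
    ← hκ, Measure.map_apply measurable_fst measurableSet_Iic]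
  -- The event `{t < p.2}` is covered by `{s < p.1, t < p.2}` and `{p.1 ≤ s}`.
  refine (measure_mono ?_).trans (measure_union_le _ _)
  intro p hp
  rcases lt_or_ge s p.1 with h | h
  · exact Or.inl ⟨h, hp⟩
  · exact Or.inr h

/-- The price of a payoff is at least that of the payoff with the same distorted law that is
priced with the slope of the concave envelope. -/
lemma lintegral_envelopeSlope_mul_quantile_le (h : IsPricingLaw μ) (hw : IsWeighting w)
    {κ : Measure (ℝ × ℝ)} [IsProbabilityMeasure κ] (hκ : κ.map Prod.fst = μ)
    {ν : Measure ℝ} [IsProbabilityMeasure ν] (hν : κ.map Prod.snd = ν) (hν0 : ∀ᵐ x ∂ν, 0 ≤ x) :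
    (∀ᵐ η ∂unif, 0 ≤ quantile (distortedLaw w ν) η) ∧
    ∫⁻ η, ENNReal.ofReal (envelopeSlope (Phi w μ) η) *
        ENNReal.ofReal (quantile (distortedLaw w ν) η) ∂unif ≤
      ∫⁻ p, ENNReal.ofReal p.1 * ENNReal.ofReal p.2 ∂κ := by
  have := hw.isProbabilityMeasure_distortedLaw ν
  have hq0 : ∀ᵐ η ∂unif, 0 ≤ quantile (distortedLaw w ν) η := by
    filter_upwards [ae_unif_mem] with η hη
    refine le_of_forall_lt fun t ht => lt_quantile_of_lt hη.2 ?_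
    have : ν (Iic t) = 0 := by
      refine measure_mono_null (fun x hx => ?_) (ae_iff.1 hν0)
      exact not_le.2 (lt_of_le_of_lt hx ht)
    rw [hw.distortedLaw_real_Iic ν, Measure.real, this]
    simpa [hw.map_one] using hη.1
  refine ⟨hq0, ?_⟩
  have hκ0 : 0 ≤ᵐ[κ] fun p : ℝ × ℝ => p.2 := by
    rw [← hν] at hν0
    exact ae_of_ae_map measurable_snd.aemeasurable hν0
  rw [lintegral_ofReal_mul_ofReal (measurable_envelopeSlope _).aemeasurable
    (aemeasurable_quantile _) hq0, lintegral_ofReal_mul_ofReal measurable_fst.aemeasurable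
    measurable_snd.aemeasurable hκ0]
  refine lintegral_mono fun t => ?_
  have hq : ν.real (Ioi t) ∈ Icc (0 : ℝ) 1 := ⟨measureReal_nonneg, measureReal_le_one⟩
  have hG : (distortedLaw w ν).real (Iic t) = 1 - w (ν.real (Ioi t)) := by
    rw [hw.distortedLaw_real_Iic ν, ← compl_Iic, probReal_compl_eq_one_sub measurableSet_Iic]
  have hmem := IsWeighting.one_sub_mem (hw.mem hq)
  simp only
  -- At level `t` the left side is `-Φ̂(a)` and the Hardy-Littlewood bound is `-Φ(a)`, with `a` the
  -- distorted cdf at `t`.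
  rw [setLIntegral_envelopeSlope h hw hmem (by rw [← hG]; exact ae_lt_quantile_iff _ t)]
  refine le_trans (ENNReal.ofReal_le_ofReal ?_) (hν ▸ integral_quantile_le_setLIntegral h hκ t)
  have := le_concaveEnvelope (h.continuousOn_phi hw) hmem
  rw [hw.phi_one_sub _ hq] at this
  linarith

variable {u I U J : ℝ → ℝ}

/-- Payoffs that cost at most `ξ` have a rank-dependent utility of at most `V(y) + y ξ`, where `V` is
the conjugate of the previous utility function. -/
theorem extIntegral_distortedLaw_le (h : IsPricingLaw μ) (hw : IsWeighting w) (hu : IsDual u I)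
    {y v : ℝ} (hy : 0 < y)
    (hc : Integrable (fun η => conjugate u I (y * envelopeSlope (Phi w μ) η)) unif)
    (hv : ∫ η, conjugate u I (y * envelopeSlope (Phi w μ) η) ∂unif = v)
    {κ : Measure (ℝ × ℝ)} [IsProbabilityMeasure κ] (hκ : κ.map Prod.fst = μ)
    {ν : Measure ℝ} [IsProbabilityMeasure ν] (hν : κ.map Prod.snd = ν) (hν0 : ∀ᵐ x ∂ν, 0 ≤ x)
    {ξ : ℝ} (hξ : 0 ≤ ξ)
    (hb : ∫⁻ p, ENNReal.ofReal p.1 * ENNReal.ofReal p.2 ∂κ ≤ ENNReal.ofReal ξ) :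
    posPart u (distortedLaw w ν) < ⊤ ∧
      extIntegral u (distortedLaw w ν) ≤ ((v + y * ξ : ℝ) : EReal) := by
  have := hw.isProbabilityMeasure_distortedLaw ν
  obtain ⟨hq0, hle⟩ := lintegral_envelopeSlope_mul_quantile_le h hw hκ hν hν0
  set Q := quantile (distortedLaw w ν)
  set R := envelopeSlope (Phi w μ)
  have hRm : Measurable R := measurable_envelopeSlope _
  have hQm : AEMeasurable Q unif := aemeasurable_quantile _
  have hRQ0 : ∀ᵐ η ∂unif, 0 ≤ R η * Q η := by
    filter_upwards [hq0, h.ae_envelopeSlope_pos hw] with η h1 h2 using mul_nonneg h2.le h1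
  have hle' : ∫⁻ η, ENNReal.ofReal (R η * Q η) ∂unif ≤ ENNReal.ofReal ξ := by
    refine le_trans (le_of_eq ?_) (hle.trans hb)
    refine lintegral_congr_ae ?_
    filter_upwards [h.ae_envelopeSlope_pos hw] with η h2 using ENNReal.ofReal_mul h2.le
  have hRQ : Integrable (fun η => R η * Q η) unif := by
    refine ⟨(hRm.aemeasurable.mul hQm).aestronglyMeasurable, ?_⟩
    rw [hasFiniteIntegral_iff_ofReal hRQ0]
    exact hle'.trans_lt ENNReal.ofReal_lt_top
  have hint : ∫ η, R η * Q η ∂unif ≤ ξ := by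
    rw [integral_eq_lintegral_of_nonneg_ae hRQ0 hRQ.1]
    exact ENNReal.toReal_le_of_le_ofReal hξ hle'
  -- Fenchel's inequality, pointwise at the conjugate variable `y R η`.
  have key := extIntegral_map_le (m := unif) (Q := Q) hu.monotoneOn hQm hq0
    (C := fun η => conjugate u I (y * R η) + y * (R η * Q η)) (hc.add (hRQ.const_mul y)) (by
      filter_upwards [hq0, h.ae_envelopeSlope_pos hw] with η h1 h2
      have := hu.extend_le h1 (mul_pos hy h2)
      rwa [mul_assoc] at this)
  rw [map_quantile] at key
  refine ⟨key.1, key.2.trans (EReal.coe_le_coe_iff.2 ?_)⟩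
  rw [integral_add hc (hRQ.const_mul y), hv, integral_const_mul]
  have := mul_le_mul_of_nonneg_left hint hy.le
  linarith

end UpperBound

end RDPFPP

namespace RDPFPP

/-! ### The optimal payoff -/

section Optimum

variable {μ : Measure ℝ} [IsProbabilityMeasure μ] {w : ℝ → ℝ}

/-- An atomless law has a continuous cdf, so the quantile attains `p` exactly. This identifies
`F(ρ)` with the uniform variable in the optimal payoff. -/
lemma IsPricingLaw.real_Iic_quantile (h : IsPricingLaw μ) {p : ℝ} (hp : p ∈ Ioo (0 : ℝ) 1) :
    μ.real (Iic (quantile μ p)) = p := by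
  refine le_antisymm ?_ ?_
  · by_contra hlt
    rw [not_le] at hlt
    have hcont : Function.leftLim (cdf μ) (quantile μ p) = cdf μ (quantile μ p) := by
      have h1 := (cdf μ).measure_singleton (quantile μ p)
      rw [measure_cdf, h.atomless, eq_comm, ENNReal.ofReal_eq_zero, sub_nonpos] at h1
      exact le_antisymm ((monotone_cdf μ).leftLim_le le_rfl) h1
    have ht := (monotone_cdf μ).tendsto_leftLim (quantile μ p)
    rw [hcont, cdf_eq_real] at ht
    obtain ⟨x, hx, hxq⟩ := (((tendsto_order.1 ht).1 p hlt).and self_mem_nhdsWithin).exists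
    rw [cdf_eq_real] at hx
    exact (quantile_le_of_lt hp.1 hx).not_gt hxq
  · by_contra hlt
    exact lt_irrefl _ (lt_quantile_of_lt hp.2 (not_le.1 hlt))

/-- A monotone function on `(0,1)` exceeds a level to the right of a threshold. -/
lemma exists_threshold {h : ℝ → ℝ} (hm : MonotoneOn h (Ioo 0 1)) (t : ℝ) :
    ∃ a ∈ Icc (0 : ℝ) 1, ∀ η ∈ Ioo (0 : ℝ) 1, (η < a → h η ≤ t) ∧ (a < η → t < h η) := by
  -- Adjoining `1` keeps the set nonempty and gives threshold `1` if the level is never exceeded.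
  set S : Set ℝ := insert 1 {η ∈ Ioo (0 : ℝ) 1 | t < h η} with hS
  have hne : S.Nonempty := ⟨1, mem_insert _ _⟩
  have hbdd : BddBelow S := ⟨0, by
    rintro x (rfl | hx)
    · exact zero_le_one
    · exact hx.1.1.le⟩
  refine ⟨sInf S, ⟨le_csInf hne ?_, csInf_le hbdd (mem_insert _ _)⟩, fun η hη => ⟨fun hlt => ?_,
    fun hlt => ?_⟩⟩
  · rintro x (rfl | hx)
    · exact zero_le_one
    · exact hx.1.1.le
  · by_contra hn
    exact (csInf_le hbdd (mem_insert_of_mem _ ⟨hη, not_le.1 hn⟩)).not_gt hlt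
  · obtain ⟨x, hx, hxη⟩ := (csInf_lt_iff hbdd hne).1 hlt
    rcases hx with rfl | hx
    · exact absurd hη.2 hxη.not_gt
    · exact hx.2.trans_le (hm hx.1 hη hxη.le)

/-- Under a weighting function the law `h(1 - w(V))`, with `V` uniform, is distorted into the law of
`h(V)`. -/
lemma ae_threshold {h : ℝ → ℝ} (hw : IsWeighting w) {t a : ℝ} (ha : a ∈ Icc (0 : ℝ) 1)
    (hat : ∀ η ∈ Ioo (0 : ℝ) 1, (η < a → h η ≤ t) ∧ (a < η → t < h η)) :
    (∀ᵐ η ∂unif, t < h η ↔ a < η) ∧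
      ∀ᵐ p ∂unif, t < h (1 - w p) ↔ p < weightInv w (1 - a) := by
  have hsub := IsWeighting.one_sub_mem ha
  have key : ∀ η ∈ Ioo (0 : ℝ) 1, η ≠ a → (t < h η ↔ a < η) := by
    intro η hη hne
    refine ⟨fun hlt => ?_, (hat η hη).2⟩
    by_contra hn
    exact ((hat η hη).1 (lt_of_le_of_ne (not_lt.1 hn) hne)).not_gt hlt
  constructor
  · filter_upwards [ae_unif_mem, ae_unif_ne a] with η hη hne using key η hη hne
  · filter_upwards [ae_unif_mem, ae_unif_ne (weightInv w (1 - a))] with p hp hne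
    have hp' : p ∈ Icc (0 : ℝ) 1 := Ioo_subset_Icc_self hp
    have h0 := hw.strictMonoOn (left_mem_Icc.2 zero_le_one) hp' hp.1
    have h1 := hw.strictMonoOn hp' (right_mem_Icc.2 zero_le_one) hp.2
    rw [hw.map_zero] at h0
    rw [hw.map_one] at h1
    rw [key (1 - w p) ⟨by linarith, by linarith⟩, hw.lt_weightInv_iff hp' hsub]
    · constructor <;> intro h <;> linarith
    · intro h
      apply hne
      rw [← h, sub_sub_cancel, hw.weightInv_apply hp']

lemma IsWeighting.one_sub_mem_Ioo (hw : IsWeighting w) {p : ℝ} (hp : p ∈ Ioo (0 : ℝ) 1) :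
    1 - w p ∈ Ioo (0 : ℝ) 1 := by
  have hp' : p ∈ Icc (0 : ℝ) 1 := Ioo_subset_Icc_self hp
  have h0 := hw.strictMonoOn (left_mem_Icc.2 zero_le_one) hp' hp.1
  have h1 := hw.strictMonoOn hp' (right_mem_Icc.2 zero_le_one) hp.2
  rw [hw.map_zero] at h0
  rw [hw.map_one] at h1
  exact ⟨by linarith, by linarith⟩

lemma aemeasurable_comp_one_sub {h : ℝ → ℝ} (hw : IsWeighting w) (hm : MonotoneOn h (Ioo 0 1)) :
    AEMeasurable (fun p => h (1 - w p)) unif := by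
  refine aemeasurable_restrict_of_antitoneOn measurableSet_Ioo fun p hp q hq hpq => ?_
  refine hm (hw.one_sub_mem_Ioo hq) (hw.one_sub_mem_Ioo hp) ?_
  have := hw.strictMonoOn.monotoneOn (Ioo_subset_Icc_self hp) (Ioo_subset_Icc_self hq) hpq
  linarith

/-- The payoff exceeds `t` with probability `w⁻¹(1 - a)`. The weighting turns this into `1 - a`, the
probability that `h` of a uniform variable exceeds `t`. -/
lemma distortedLaw_map_one_sub {h : ℝ → ℝ} (hw : IsWeighting w) (hm : MonotoneOn h (Ioo 0 1)) :
    distortedLaw w (unif.map fun p => h (1 - w p)) = unif.map h := by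
  have h1 := aemeasurable_comp_one_sub hw hm
  have h2 : AEMeasurable h unif := aemeasurable_restrict_of_monotoneOn measurableSet_Ioo hm
  have := Measure.isProbabilityMeasure_map h1
  have := Measure.isProbabilityMeasure_map h2
  have := hw.isProbabilityMeasure_distortedLaw (unif.map fun p => h (1 - w p))
  refine Measure.ext_of_Iic _ _ fun t => ?_
  obtain ⟨a, ha, hat⟩ := exists_threshold hm t
  obtain ⟨e1, e2⟩ := ae_threshold hw ha hat
  have hsub := IsWeighting.one_sub_mem ha
  have hq := hw.weightInv_mem hsub
  have c1 : unif.map h (Iic t) = ENNReal.ofReal a := by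
    rw [Measure.map_apply_of_aemeasurable h2 measurableSet_Iic, ← unif_Iic ha]
    refine measure_congr ?_
    filter_upwards [e1] with η hη
    exact propext ⟨fun h => not_lt.1 fun h' => (not_lt.2 h) (hη.2 h'),
      fun h => not_lt.1 fun h' => (not_lt.2 h) (hη.1 h')⟩
  have c2 : (unif.map fun p => h (1 - w p)).real (Ioi t) = weightInv w (1 - a) := by
    rw [Measure.real, Measure.map_apply_of_aemeasurable h1 measurableSet_Ioi]
    have : (fun p => h (1 - w p)) ⁻¹' Ioi t =ᵐ[unif] Iic (weightInv w (1 - a)) := by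
      filter_upwards [e2, ae_unif_ne (weightInv w (1 - a))] with p hp hne
      exact propext (hp.trans ⟨le_of_lt, fun h => lt_of_le_of_ne h hne⟩)
    rw [measure_congr this, unif_Iic hq, ENNReal.toReal_ofReal hq.1]
  rw [c1, ← ofReal_measureReal, hw.distortedLaw_real_Iic (unif.map fun p => h (1 - w p)),
    ← probReal_compl_eq_one_sub measurableSet_Iic, compl_Iic, c2, hw.apply_weightInv hsub,
    sub_sub_cancel]

/-- The concave envelope touches the function where its slope jumps. -/
lemma concaveEnvelope_eq_of_threshold (hμ : IsPricingLaw μ) (hw : IsWeighting w) {k : ℝ → ℝ}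
    {t a : ℝ} (ha : a ∈ Icc (0 : ℝ) 1)
    (hat : ∀ η ∈ Ioo (0 : ℝ) 1, (η < a → k (envelopeSlope (Phi w μ) η) ≤ t) ∧
      (a < η → t < k (envelopeSlope (Phi w μ) η))) :
    concaveEnvelope (Phi w μ) a = Phi w μ a := by
  have hφ := hμ.continuousOn_phi hw
  rcases ha.1.eq_or_lt with rfl | h0
  · exact concaveEnvelope_zero _
  rcases ha.2.eq_or_lt with rfl | h1
  · exact concaveEnvelope_one _
  refine (le_antisymm (le_concaveEnvelope hφ ha) ?_).symm
  by_contra hlt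
  -- If the envelope were strictly above `Φ`, its slope would be constant on both sides of `a`, and
  -- the level `t` could not be crossed there.
  obtain ⟨α, β, s, hα, hαa, haβ, hβ, hs⟩ := envelopeSlope_const_of_lt hφ ⟨h0, h1⟩ (not_le.1 hlt)
  obtain ⟨x, hx1, hx2⟩ := exists_between hαa
  obtain ⟨z, hz1, hz2⟩ := exists_between haβ
  have e1 := (hat x ⟨by linarith, by linarith⟩).1 hx2
  have e2 := (hat z ⟨by linarith, by linarith⟩).2 hz1
  rw [hs x ⟨hx1, by linarith⟩] at e1
  rw [hs z ⟨by linarith, hz2⟩] at e2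
  exact e1.not_gt e2

/-- The equality case of the price bound. The payoff is nonincreasing in the state price, so its
level sets are those of Hardy-Littlewood equality, and at the threshold of each level the envelope
touches `Φ`. -/
lemma lintegral_quantile_mul_comp (hμ : IsPricingLaw μ) (hw : IsWeighting w) {k : ℝ → ℝ}
    (hm : MonotoneOn (fun η => k (envelopeSlope (Phi w μ) η)) (Ioo 0 1))
    (hk : ∀ η ∈ Ioo (0 : ℝ) 1, 0 ≤ k (envelopeSlope (Phi w μ) η)) :
    ∫⁻ p, ENNReal.ofReal (quantile μ p) *
        ENNReal.ofReal (k (envelopeSlope (Phi w μ) (1 - w p))) ∂unif =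
      ∫⁻ η, ENNReal.ofReal (envelopeSlope (Phi w μ) η) *
        ENNReal.ofReal (k (envelopeSlope (Phi w μ) η)) ∂unif := by
  have h1 := aemeasurable_comp_one_sub hw hm
  have h2 := aemeasurable_restrict_of_monotoneOn (μ := volume) measurableSet_Ioo hm
  rw [lintegral_ofReal_mul_ofReal (aemeasurable_quantile μ) h1
    (by filter_upwards [ae_unif_mem] with p hp using hk _ (hw.one_sub_mem_Ioo hp)),
    lintegral_ofReal_mul_ofReal (measurable_envelopeSlope _).aemeasurable h2
    (by filter_upwards [ae_unif_mem] with p hp using hk _ hp)]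
  refine setLIntegral_congr_fun measurableSet_Ioi fun t _ => ?_
  obtain ⟨a, ha, hat⟩ := exists_threshold hm t
  obtain ⟨e1, e2⟩ := ae_threshold hw ha hat
  have hsub := IsWeighting.one_sub_mem ha
  have hq := hw.weightInv_mem hsub
  rw [setLIntegral_envelopeSlope hμ hw ha
    (S := {η | t < k (envelopeSlope (Phi w μ) η)}) e1, concaveEnvelope_eq_of_threshold hμ hw ha hat, Phi,
    neg_neg, intervalIntegral.integral_of_le hq.1, integral_Ioc_eq_integral_Ioo]
  have hsubset : Ioo 0 (weightInv w (1 - a)) ⊆ Ioo (0 : ℝ) 1 := Ioo_subset_Ioo_right hq.2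
  rw [ofReal_integral_eq_lintegral_ofReal (hμ.integrableOn_quantile.mono_set hsubset)
    (by filter_upwards [ae_restrict_mem measurableSet_Ioo] with p hp
          using (hμ.quantile_pos (hsubset hp)).le)]
  have : {p | t < k (envelopeSlope (Phi w μ) (1 - w p))} =ᵐ[unif] Iio (weightInv w (1 - a)) := by
    filter_upwards [e2] with p hp using propext hp
  rw [setLIntegral_congr this, Measure.restrict_restrict measurableSet_Iio,
    show Iio (weightInv w (1 - a)) ∩ Ioo 0 1 = Ioo 0 (weightInv w (1 - a)) by
      ext x; constructor
      · rintro ⟨h1, h2⟩; exact ⟨h2.1, h1⟩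
      · rintro ⟨h1, h2⟩; exact ⟨h2, h1, h2.trans_le hq.2⟩]

lemma IsWeighting.ae_one_sub_notMem (hw : IsWeighting w) {N : Set ℝ} (hc : N.Countable) :
    ∀ᵐ p ∂unif, 1 - w p ∉ N := by
  filter_upwards [(hc.image fun q => weightInv w (1 - q)).ae_notMem unif, ae_unif_mem] with p hp hp01
  refine fun hN => hp ⟨1 - w p, hN, ?_⟩
  simp only
  rw [sub_sub_cancel, hw.weightInv_apply (Ioo_subset_Icc_self hp01)]

/-- Almost surely the envelope is differentiable at `1 - w(F(ρ))`. -/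
lemma IsPricingLaw.ae_deriv_eq (h : IsPricingLaw μ) (hw : IsWeighting w) :
    ∀ᵐ p ∂unif, deriv (concaveEnvelope (Phi w μ)) (1 - w p) = envelopeSlope (Phi w μ) (1 - w p) := by
  have hc := countable_not_hasDerivAt_concaveEnvelope (h.continuousOn_phi hw)
  filter_upwards [hw.ae_one_sub_notMem hc, ae_unif_mem] with p hp hp01
  by_contra hd
  exact hp ⟨hw.one_sub_mem_Ioo hp01, fun hh => hd hh.deriv⟩

/-- Almost everywhere the envelope is differentiable. -/
lemma IsPricingLaw.ae_deriv_eq' (h : IsPricingLaw μ) (hw : IsWeighting w) :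
    ∀ᵐ p ∂unif, deriv (concaveEnvelope (Phi w μ)) p = envelopeSlope (Phi w μ) p := by
  have hc := countable_not_hasDerivAt_concaveEnvelope (h.continuousOn_phi hw)
  filter_upwards [hc.ae_notMem unif, ae_unif_mem] with p hp hp01
  by_contra hd
  exact hp ⟨hp01, fun hh => hd hh.deriv⟩

lemma IsPricingLaw.ae_of_ae_quantile (μ : Measure ℝ) [IsProbabilityMeasure μ] {s : ℝ → Prop}
    (hs : ∀ᵐ r ∂μ, s r) : ∀ᵐ p ∂unif, s (quantile μ p) := by
  rw [← map_quantile μ] at hs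
  exact ae_of_ae_map (aemeasurable_quantile μ) hs

variable {u I U J : ℝ → ℝ}

lemma monotoneOn_optimal (hμ : IsPricingLaw μ) (hw : IsWeighting w) (hI : IsInverseMarginal I)
    {y : ℝ} (hy : 0 < y) :
    MonotoneOn (fun η => I (y * envelopeSlope (Phi w μ) η)) (Ioo 0 1) := by
  intro a ha b hb hab
  have hφ := hμ.continuousOn_phi hw
  have hm := hμ.strictMonoOn_phi hw
  exact hI.strictAntiOn.antitoneOn (mul_pos hy (envelopeSlope_pos hφ hm hb))
    (mul_pos hy (envelopeSlope_pos hφ hm ha))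
    (mul_le_mul_of_nonneg_left (antitoneOn_envelopeSlope hφ ha hb hab) hy.le)

/-- The optimal payoff is positive, has price `J y` and rank-dependent utility `U (J y)`. -/
theorem optimal_payoff (hμ : IsPricingLaw μ) (hw : IsWeighting w) (hu : IsDual u I)
    (hJ : IsInverseMarginal J)
    (hIJ : ∀ y, 0 < y → ∫ η, I (y * envelopeSlope (Phi w μ) η) * envelopeSlope (Phi w μ) η ∂unif = J y)
    {y : ℝ} (hy : 0 < y)
    (hc : Integrable (fun η => conjugate u I (y * envelopeSlope (Phi w μ) η)) unif)
    (hv : ∫ η, conjugate u I (y * envelopeSlope (Phi w μ) η) ∂unif = conjugate U J y)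
    {T : ℝ → ℝ} (hTm : AEMeasurable T μ)
    (hT : ∀ᵐ r ∂μ, T r =
      I (y * deriv (concaveEnvelope (Phi w μ)) (1 - w (μ.real (Iic r))))) :
    (∀ᵐ r ∂μ, 0 < T r) ∧
    ∫⁻ r, ENNReal.ofReal r * ENNReal.ofReal (T r) ∂μ = ENNReal.ofReal (J y) ∧
    posPart u (distortedLaw w (μ.map T)) < ⊤ ∧
    extIntegral u (distortedLaw w (μ.map T)) = ((U (J y) : ℝ) : EReal) := by
  set R := envelopeSlope (Phi w μ) with hR
  have hRpos : ∀ η ∈ Ioo (0 : ℝ) 1, 0 < R η := fun η hη =>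
    envelopeSlope_pos (hμ.continuousOn_phi hw) (hμ.strictMonoOn_phi hw) hη
  have hI := hu.isInverseMarginal
  have hm : MonotoneOn (fun η => I (y * R η)) (Ioo 0 1) := monotoneOn_optimal hμ hw hI hy
  have hIpos : ∀ η ∈ Ioo (0 : ℝ) 1, 0 < I (y * R η) := fun η hη =>
    hI.pos (mul_pos hy (hRpos η hη))
  -- Expressed in the uniform variable `p = F(r)`; the kinks of the envelope are met with
  -- probability zero.
  have hTQ : ∀ᵐ p ∂unif, T (quantile μ p) = I (y * R (1 - w p)) := by
    filter_upwards [IsPricingLaw.ae_of_ae_quantile μ hT, hμ.ae_deriv_eq hw, ae_unif_mem]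
      with p h1 h2 h3
    rw [h1, hμ.real_Iic_quantile h3, h2]
  have hQm := aemeasurable_quantile μ
  have hTm' : AEMeasurable T (unif.map (quantile μ)) := by rwa [map_quantile]
  have hlaw : μ.map T = unif.map fun p => I (y * R (1 - w p)) := by
    conv_lhs => rw [← map_quantile μ]
    rw [AEMeasurable.map_map_of_aemeasurable hTm' hQm]
    exact Measure.map_congr hTQ
  have hpos : ∀ᵐ r ∂μ, 0 < T r := by
    have h1 : ∀ᵐ x ∂(μ.map T), 0 < x := by
      rw [hlaw, ae_map_iff (aemeasurable_comp_one_sub hw hm) measurableSet_Ioi]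
      filter_upwards [ae_unif_mem] with p hp using hIpos _ (hw.one_sub_mem_Ioo hp)
    exact ae_of_ae_map hTm h1
  have hIR : ∀ {y}, 0 < y → Integrable (fun η => I (y * R η) * R η) unif := fun hy =>
    integrable_of_integral_eq_inverseMarginal hJ hIJ hy
  refine ⟨hpos, ?_, ?_⟩
  · calc ∫⁻ r, ENNReal.ofReal r * ENNReal.ofReal (T r) ∂μ
        = ∫⁻ p, ENNReal.ofReal (quantile μ p) * ENNReal.ofReal (T (quantile μ p)) ∂unif := by
          conv_lhs => rw [← map_quantile μ]
          exact lintegral_map' (f := fun r => ENNReal.ofReal r * ENNReal.ofReal (T r))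
            (measurable_id.ennreal_ofReal.aemeasurable.mul hTm'.ennreal_ofReal) hQm
      _ = ∫⁻ p, ENNReal.ofReal (quantile μ p) * ENNReal.ofReal (I (y * R (1 - w p))) ∂unif := by
          refine lintegral_congr_ae ?_
          filter_upwards [hTQ] with p hp
          rw [hp]
      _ = ∫⁻ η, ENNReal.ofReal (R η) * ENNReal.ofReal (I (y * R η)) ∂unif :=
          lintegral_quantile_mul_comp hμ hw (k := fun s => I (y * s)) hm fun η hη => (hIpos η hη).le
      _ = ∫⁻ η, ENNReal.ofReal (I (y * R η) * R η) ∂unif := by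
          refine lintegral_congr_ae ?_
          filter_upwards [ae_unif_mem] with η hη
          rw [ENNReal.ofReal_mul (hIpos η hη).le, mul_comm]
      _ = ENNReal.ofReal (J y) := by
          rw [← hIJ y hy, ofReal_integral_eq_lintegral_ofReal (hIR hy)]
          filter_upwards [ae_unif_mem] with η hη using (mul_pos (hIpos η hη) (hRpos η hη)).le
  · rw [hlaw, distortedLaw_map_one_sub hw hm]
    -- Equality in Fenchel: `u(I(s)) = V(s) + s I(s)` at `s = y R`. Integrated, this gives the
    -- conjugate of `U` at `y` plus `y J(y)`, that is `U(J y)`.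
    have hint : Integrable (fun η => conjugate u I (y * R η) + y * (I (y * R η) * R η)) unif :=
      hc.add ((hIR hy).const_mul y)
    have heq : (fun η => conjugate u I (y * R η) + y * (I (y * R η) * R η))
        = fun η => u (I (y * R η)) := by
      funext η
      simp only [conjugate]
      ring
    have hval : ∫ η, u (I (y * R η)) ∂unif = U (J y) := by
      rw [← heq, integral_add hc ((hIR hy).const_mul y), hv, integral_const_mul, hIJ y hy]
      simp [conjugate]
    rw [heq] at hint
    rw [← hval]
    exact extIntegral_map_eq hu.monotoneOn
      (aemeasurable_restrict_of_monotoneOn measurableSet_Ioo hm)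
      (by filter_upwards [ae_unif_mem] with η hη using hIpos η hη) hint

end Optimum

end RDPFPP

namespace RDPFPP

/-! ### Measurability in the random parameter -/

/-- Turns inverses and quantiles into countable suprema of measurable functions. The default `0` is
harmless as `v ≥ 0`, and the predicate is left free at `t = v`. -/
lemma iSup_rat_ite_eq {v : ℝ} (hv : 0 ≤ v) (s : ℚ → Prop) [DecidablePred s] (h1 : ∀ t, s t → (t : ℝ) ≤ v)
    (h2 : ∀ t : ℚ, 0 < (t : ℝ) → (t : ℝ) < v → s t) : ⨆ t : ℚ, (if s t then (t : ℝ) else 0) = v := by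
  refine ciSup_eq_of_forall_le_of_forall_lt_exists_gt (fun t => ?_) fun x hx => ?_
  · split_ifs with h
    · exact h1 t h
    · exact hv
  · rcases lt_or_ge x 0 with h0 | h0
    · refine ⟨0, ?_⟩
      simpa using h0
    · obtain ⟨t, ht1, ht2⟩ := exists_rat_btwn hx
      refine ⟨t, ?_⟩
      rw [if_pos (h2 t (h0.trans_lt ht1) ht2)]
      exact ht1

section Measurability

variable {Ω : Type*} [MeasurableSpace Ω]

-- The measurable version is built from `g` alone, before `ω` and `I` are chosen. The same order of
-- quantifiers below allows bad `ω` to be ignored.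
open Classical in
lemma exists_measurable_posInv {g : Ω × ℝ → ℝ} (hg : Measurable g) :
    ∃ j : Ω × ℝ → ℝ, Measurable j ∧ ∀ ω, ∀ I : ℝ → ℝ, IsInverseMarginal I →
      (∀ y, 0 < y → I y = g (ω, y)) → ∀ x, 0 < x → posInv I x = j (ω, x) := by
  refine ⟨fun z => ⨆ t : ℚ, if (0 : ℝ) < t ∧ z.2 < g (z.1, (t : ℝ)) then (t : ℝ) else 0,
    .iSup fun t => .ite ?_ measurable_const measurable_const, fun ω I hI hIg x hx => ?_⟩
  · exact (MeasurableSet.const _).inter (measurableSet_lt measurable_snd (by fun_prop))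
  · refine (iSup_rat_ite_eq (hI.posInv_pos hx).le
      (fun t : ℚ => (0 : ℝ) < t ∧ x < g (ω, (t : ℝ))) ?_ ?_).symm
    · rintro t ⟨h0, h⟩
      rw [← hIg _ h0, hI.lt_iff hx h0] at h
      exact h.le
    · intro t h0 h
      refine ⟨h0, ?_⟩
      rw [← hIg _ h0]
      exact (hI.lt_iff hx h0).2 h

open Classical in
lemma exists_measurable_weightInv {g : Ω × ℝ → ℝ} (hg : Measurable g) :
    ∃ v : Ω × ℝ → ℝ, Measurable v ∧ ∀ ω, ∀ w : ℝ → ℝ, IsWeighting w →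
      (∀ p ∈ Icc (0 : ℝ) 1, w p = g (ω, p)) → ∀ r ∈ Icc (0 : ℝ) 1, weightInv w r = v (ω, r) := by
  refine ⟨fun z => ⨆ t : ℚ, if (t : ℝ) ∈ Icc (0 : ℝ) 1 ∧ g (z.1, (t : ℝ)) ≤ z.2 then (t : ℝ) else 0,
    .iSup fun t => .ite ?_ measurable_const measurable_const, fun ω w hw hwg r hr => ?_⟩
  · exact (MeasurableSet.const _).inter (measurableSet_le (by fun_prop) measurable_snd)
  · have hm := hw.weightInv_mem hr
    refine (iSup_rat_ite_eq hm.1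
      (fun t : ℚ => (t : ℝ) ∈ Icc (0 : ℝ) 1 ∧ g (ω, (t : ℝ)) ≤ r) ?_ ?_).symm
    · rintro t ⟨h0, h⟩
      rw [← hwg _ h0] at h
      exact not_lt.1 fun hlt => ((hw.weightInv_lt_iff h0 hr).1 hlt).not_ge h
    · intro t h0 h
      have ht : (t : ℝ) ∈ Icc (0 : ℝ) 1 := ⟨h0.le, h.le.trans hm.2⟩
      refine ⟨ht, ?_⟩
      rw [← hwg _ ht]
      exact ((hw.lt_weightInv_iff ht hr).1 h).le

lemma measurable_real_Iic (κ : Kernel Ω ℝ) (x : ℝ) : Measurable fun ω => (κ ω).real (Iic x) :=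
  (κ.measurable_coe measurableSet_Iic).ennreal_toReal

-- By right-continuity the value at `x` is an infimum over rationals to its right; the default `1`
-- bounds every cdf.
open Classical in
lemma exists_measurable_cdf (κ : Kernel Ω ℝ) [IsMarkovKernel κ] :
    ∃ f : Ω × ℝ → ℝ, Measurable f ∧ ∀ ω x, (κ ω).real (Iic x) = f (ω, x) := by
  refine ⟨fun z => ⨅ t : ℚ, if z.2 < t then (κ z.1).real (Iic (t : ℝ)) else 1,
    .iInf fun t => .ite (measurableSet_lt measurable_snd measurable_const)
      ((measurable_real_Iic κ _).comp measurable_fst) measurable_const, fun ω x => ?_⟩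
  refine (ciInf_eq_of_forall_ge_of_forall_gt_exists_lt (fun t => ?_) fun y hy => ?_).symm
  · split_ifs with h
    · exact measureReal_mono (Iic_subset_Iic.2 h.le)
    · exact measureReal_le_one
  · have hr := (cdf (κ ω)).right_continuous x
    rw [← cdf_eq_real] at hy
    have := (tendsto_order.1 (hr.tendsto.mono_left (nhdsWithin_mono x Ioi_subset_Ici_self))).2 y hy
    obtain ⟨z, hz, hxz⟩ := (this.and self_mem_nhdsWithin).exists
    obtain ⟨t, ht1, ht2⟩ := exists_rat_btwn hxz
    refine ⟨t, ?_⟩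
    rw [cdf_eq_real] at hz
    rw [if_pos ht1]
    exact (measureReal_mono (Iic_subset_Iic.2 ht2.le)).trans_lt hz

open Classical in
lemma exists_measurable_quantile (κ : Kernel Ω ℝ) [IsMarkovKernel κ] :
    ∃ v : Ω × ℝ → ℝ, Measurable v ∧ ∀ ω, IsPricingLaw (κ ω) →
      ∀ p ∈ Ioo (0 : ℝ) 1, quantile (κ ω) p = v (ω, p) := by
  refine ⟨fun z => ⨆ t : ℚ, if (κ z.1).real (Iic (t : ℝ)) ≤ z.2 then (t : ℝ) else 0,
    .iSup fun t => .ite ?_ measurable_const measurable_const, fun ω hω p hp => ?_⟩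
  · exact measurableSet_le ((measurable_real_Iic κ _).comp measurable_fst) measurable_snd
  · refine (iSup_rat_ite_eq (hω.quantile_pos hp).le
      (fun t : ℚ => (κ ω).real (Iic (t : ℝ)) ≤ p) ?_ ?_).symm
    · exact fun t ht => le_csSup (quantile_set_bddAbove _ hp.2) ht
    · intro t _ ht
      exact not_lt.1 fun h => (quantile_le_of_lt hp.1 h).not_gt ht

-- The variable limit of integration is moved into the integrand, so that measurability of parameter
-- integrals applies.
open Classical in
lemma exists_measurable_phi (κ : Kernel Ω ℝ) [IsMarkovKernel κ] {g : Ω × ℝ → ℝ}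
    (hg : Measurable g) :
    ∃ f : Ω × ℝ → ℝ, Measurable f ∧ ∀ ω, ∀ w : ℝ → ℝ, IsWeighting w →
      (∀ p ∈ Icc (0 : ℝ) 1, w p = g (ω, p)) → IsPricingLaw (κ ω) →
      ∀ q ∈ Icc (0 : ℝ) 1, Phi w (κ ω) q = f (ω, q) := by
  obtain ⟨v, hv, hv'⟩ := exists_measurable_weightInv hg
  obtain ⟨Q, hQ, hQ'⟩ := exists_measurable_quantile κ
  refine ⟨fun z => -∫ p, (if 0 < p ∧ p < v (z.1, 1 - z.2) then Q (z.1, p) else 0),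
    ?_, fun ω w hw hwg hω q hq => ?_⟩
  · refine Measurable.neg (StronglyMeasurable.measurable
      (StronglyMeasurable.integral_prod_right (f := fun (z : Ω × ℝ) p =>
        if 0 < p ∧ p < v (z.1, 1 - z.2) then Q (z.1, p) else 0) (Measurable.stronglyMeasurable ?_)))
    refine Measurable.ite ?_ (hQ.comp (by fun_prop)) measurable_const
    exact (measurableSet_lt measurable_const measurable_snd).inter
      (measurableSet_lt measurable_snd (hv.comp (by fun_prop)))
  · have hsub := IsWeighting.one_sub_mem hq
    have hm := hw.weightInv_mem hsub
    rw [Phi, intervalIntegral.integral_of_le hm.1, integral_Ioc_eq_integral_Ioo,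
      ← integral_indicator measurableSet_Ioo]
    congr 2
    funext p
    rw [indicator_apply, ← hv' ω w hw hwg _ hsub]
    refine ite_congr rfl (fun hp => ?_) fun _ => rfl
    exact hQ' ω hω p ⟨hp.1, hp.2.trans_le hm.2⟩

/-- The concave envelope is a supremum over rational chords. -/
lemma exists_rat_chord {φ : ℝ → ℝ} (hφ : ContinuousOn φ (Icc 0 1)) {q x : ℝ}
    (hq : q ∈ Ioo (0 : ℝ) 1) (hx : x < concaveEnvelope φ q) :
    ∃ a b : ℚ, (a : ℝ) ∈ Icc 0 q ∧ (b : ℝ) ∈ Icc q 1 ∧ (a : ℝ) < b ∧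
      x < ((b - q) * φ a + (q - a) * φ b) / (b - a) := by
  obtain ⟨_, ⟨α, hα, β, hβ, hαβ, rfl⟩, hlt⟩ := exists_lt_of_lt_csSup
    (concaveEnvelope_set_nonempty φ (Ioo_subset_Icc_self hq)) hx
  set K : Set (ℝ × ℝ) := Icc 0 q ×ˢ Icc q 1 with hK
  set f : ℝ × ℝ → ℝ := fun p => ((p.2 - q) * φ p.1 + (q - p.1) * φ p.2) / (p.2 - p.1) with hf
  have hmem : (α, β) ∈ K := ⟨hα, hβ⟩
  have c1 : ContinuousWithinAt (fun p : ℝ × ℝ => φ p.1) K (α, β) :=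
    (hφ.comp continuousOn_fst (s := K) fun p hp => ⟨hp.1.1, hp.1.2.trans hq.2.le⟩) _ hmem
  have c2 : ContinuousWithinAt (fun p : ℝ × ℝ => φ p.2) K (α, β) :=
    (hφ.comp continuousOn_snd (s := K) fun p hp => ⟨hq.1.le.trans hp.2.1, hp.2.2⟩) _ hmem
  have hc : ContinuousWithinAt f K (α, β) := by
    refine ContinuousWithinAt.div ?_ (by fun_prop) (sub_pos.2 hαβ).ne'
    exact ((by fun_prop : ContinuousWithinAt (fun p : ℝ × ℝ => p.2 - q) K _).mul c1).add
      ((by fun_prop : ContinuousWithinAt (fun p : ℝ × ℝ => q - p.1) K _).mul c2)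
  have hc' : ContinuousWithinAt (fun p : ℝ × ℝ => p.2 - p.1) K (α, β) := by fun_prop
  have hev := ((tendsto_order.1 hc).1 x hlt).and ((tendsto_order.1 hc').1 0 (sub_pos.2 hαβ))
  rw [eventually_nhdsWithin_iff, Metric.eventually_nhds_iff] at hev
  obtain ⟨δ, hδ, hδ'⟩ := hev
  -- As `q` is interior, rationals exist strictly inside `(0, q)` and `(q, 1)` near `α` and `β`,
  -- even when these sit at an end of their interval.
  obtain ⟨a, ha1, ha2⟩ := exists_rat_btwn
    (show max 0 (α - δ) < min q (α + δ) from max_lt (lt_min hq.1 (by linarith [hα.1]))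
      (lt_min (by linarith [hα.2]) (by linarith)))
  obtain ⟨b, hb1, hb2⟩ := exists_rat_btwn
    (show max q (β - δ) < min 1 (β + δ) from max_lt (lt_min hq.2 (by linarith [hβ.1]))
      (lt_min (by linarith [hβ.2]) (by linarith)))
  rw [max_lt_iff] at ha1 hb1
  rw [lt_min_iff] at ha2 hb2
  have hab := hδ' (y := ((a : ℝ), (b : ℝ))) (by
    rw [Prod.dist_eq, max_lt_iff, Real.dist_eq, Real.dist_eq, abs_lt, abs_lt]
    exact ⟨⟨by linarith [ha1.2], by linarith [ha2.2]⟩, by linarith [hb1.2], by linarith [hb2.2]⟩)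
    ⟨⟨ha1.1.le, ha2.1.le⟩, hb1.1.le, hb2.1.le⟩
  exact ⟨a, b, ⟨ha1.1.le, ha2.1.le⟩, ⟨hb1.1.le, hb2.1.le⟩, sub_pos.1 hab.2, hab.1⟩

open Classical in
lemma exists_measurable_concaveEnvelope {f : Ω × ℝ → ℝ} (hf : Measurable f) :
    ∃ e : Ω × ℝ → ℝ, Measurable e ∧ ∀ ω, ∀ φ : ℝ → ℝ, ContinuousOn φ (Icc 0 1) →
      MonotoneOn φ (Icc 0 1) → (∀ q ∈ Icc (0 : ℝ) 1, φ q = f (ω, q)) →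
      ∀ q ∈ Ioo (0 : ℝ) 1, concaveEnvelope φ q = e (ω, q) := by
  -- The default `f (ω, 0)` is `φ 0`, which is at most the envelope because `φ` is monotone, so
  -- inadmissible pairs do not affect the supremum.
  refine ⟨fun z => ⨆ t : ℚ × ℚ,
    if ((t.1 : ℝ) ∈ Icc 0 z.2 ∧ (t.2 : ℝ) ∈ Icc z.2 1 ∧ (t.1 : ℝ) < t.2) then
      ((t.2 - z.2) * f (z.1, (t.1 : ℝ)) + (z.2 - t.1) * f (z.1, (t.2 : ℝ))) / (t.2 - t.1)
    else f (z.1, 0), .iSup fun t => .ite ?_ ?_ ?_, fun ω φ hφ hm hφf q hq => ?_⟩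
  · refine MeasurableSet.inter ?_ (MeasurableSet.inter ?_ (MeasurableSet.const _))
    · exact (MeasurableSet.const _).inter (measurableSet_le measurable_const measurable_snd)
    · exact (measurableSet_le measurable_snd measurable_const).inter (MeasurableSet.const _)
  · have h1 : Measurable fun z : Ω × ℝ => f (z.1, (t.1 : ℝ)) := by fun_prop
    have h2 : Measurable fun z : Ω × ℝ => f (z.1, (t.2 : ℝ)) := by fun_prop
    fun_prop
  · fun_prop
  · have hqm : q ∈ Icc (0 : ℝ) 1 := Ioo_subset_Icc_self hq
    refine (ciSup_eq_of_forall_le_of_forall_lt_exists_gt (fun t => ?_) fun x hx => ?_).symm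
    · split_ifs with h
      · rw [← hφf _ ⟨h.1.1, h.1.2.trans hq.2.le⟩, ← hφf _ ⟨hq.1.le.trans h.2.1.1, h.2.1.2⟩]
        exact chord_le_concaveEnvelope hφ h.1 h.2.1 h.2.2
      · have h0 : (0 : ℝ) ∈ Icc (0 : ℝ) 1 := left_mem_Icc.2 zero_le_one
        rw [← hφf 0 h0]
        exact (hm h0 hqm hq.1.le).trans (le_concaveEnvelope hφ hqm)
    · obtain ⟨a, b, ha, hb, hab, hlt⟩ := exists_rat_chord hφ hq hx
      refine ⟨(a, b), ?_⟩
      rw [if_pos ⟨ha, hb, hab⟩]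
      rwa [← hφf _ ⟨ha.1, ha.2.trans hq.2.le⟩, ← hφf _ ⟨hq.1.le.trans hb.1, hb.2⟩]

/-- The right derivative is the limit of difference quotients with steps `1/(n+1)`; a `limsup` is
measurable even where there is no convergence. -/
lemma exists_measurable_envelopeSlope (κ : Kernel Ω ℝ) [IsMarkovKernel κ] {g : Ω × ℝ → ℝ}
    (hg : Measurable g) :
    ∃ d : Ω × ℝ → ℝ, Measurable d ∧ ∀ ω, ∀ w : ℝ → ℝ, IsWeighting w →
      (∀ p ∈ Icc (0 : ℝ) 1, w p = g (ω, p)) → IsPricingLaw (κ ω) →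
      ∀ q ∈ Ioo (0 : ℝ) 1, envelopeSlope (Phi w (κ ω)) q = d (ω, q) := by
  obtain ⟨f, hf, hf'⟩ := exists_measurable_phi κ hg
  obtain ⟨e, he, he'⟩ := exists_measurable_concaveEnvelope hf
  refine ⟨fun z => limsup (fun n : ℕ =>
      (1 / ((n : ℝ) + 1))⁻¹ * (e (z.1, z.2 + 1 / ((n : ℝ) + 1)) - e (z.1, z.2))) atTop,
    .limsup fun n => by fun_prop, fun ω w hw hwg hω q hq => ?_⟩
  have hφ := hω.continuousOn_phi hw
  have hE := he' ω _ hφ (hω.strictMonoOn_phi hw).monotoneOn (hf' ω w hw hwg hω)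
  have hd := hasDerivWithinAt_envelopeSlope hφ hq
  rw [hasDerivWithinAt_iff_tendsto_slope' (by simp)] at hd
  have hs0 : Tendsto (fun n : ℕ => q + 1 / ((n : ℝ) + 1)) atTop (𝓝 q) := by
    simpa using tendsto_one_div_add_atTop_nhds_zero_nat.const_add q
  have hs : Tendsto (fun n : ℕ => q + 1 / ((n : ℝ) + 1)) atTop (𝓝[>] q) := by
    refine tendsto_nhdsWithin_iff.2 ⟨hs0, Eventually.of_forall fun n => ?_⟩
    have : (0 : ℝ) < 1 / ((n : ℝ) + 1) := by positivity
    simpa using this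
  refine (Tendsto.limsup_eq ((hd.comp hs).congr' ?_)).symm
  filter_upwards [(tendsto_order.1 hs0).2 1 hq.2] with n hn
  have : (0 : ℝ) < 1 / ((n : ℝ) + 1) := by positivity
  simp only [Function.comp]
  rw [slope_def_field, hE q hq, hE _ ⟨by linarith [hq.1], hn⟩, add_sub_cancel_left, div_eq_inv_mul]

/-- The slope of the envelope at `1 - w(F(r))` is jointly measurable, outside a null set of `r`. -/
lemma exists_measurable_deriv (κ : Kernel Ω ℝ) [IsMarkovKernel κ] {g : Ω × ℝ → ℝ}
    (hg : Measurable g) :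
    ∃ d : Ω × ℝ → ℝ, ∃ S : Set (Ω × ℝ), Measurable d ∧ MeasurableSet S ∧
      ∀ ω, ∀ w : ℝ → ℝ, IsWeighting w →
      (∀ p ∈ Icc (0 : ℝ) 1, w p = g (ω, p)) → IsPricingLaw (κ ω) →
      (∀ᵐ r ∂κ ω, (ω, r) ∈ S) ∧ ∀ r, (ω, r) ∈ S →
        deriv (concaveEnvelope (Phi w (κ ω))) (1 - w ((κ ω).real (Iic r))) = d (ω, r) ∧
        0 < d (ω, r) := by
  obtain ⟨d, hd, hd'⟩ := exists_measurable_envelopeSlope κ hg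
  obtain ⟨f, hf, hf'⟩ := exists_measurable_cdf κ
  have hq : Measurable fun z : Ω × ℝ => 1 - g (z.1, f z) :=
    (hg.comp (measurable_fst.prodMk hf)).const_sub 1
  have hS : MeasurableSet {z : Ω × ℝ | 1 - g (z.1, f z) ∈ Ioo (0 : ℝ) 1 ∧
      NoJump (fun q => d (z.1, q)) (1 - g (z.1, f z))} := by
    have hj : MeasurableSet {z : Ω × ℝ | NoJump (fun q => d (z.1, q)) (1 - g (z.1, f z))} := by
      have : {z : Ω × ℝ | NoJump (fun q => d (z.1, q)) (1 - g (z.1, f z))} = ⋂ k : ℕ, ⋃ n : ℕ,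
          {z : Ω × ℝ | 0 < 1 - g (z.1, f z) - 1 / ((n : ℝ) + 1) ∧
            d (z.1, 1 - g (z.1, f z) - 1 / ((n : ℝ) + 1)) <
              d (z.1, 1 - g (z.1, f z)) + 1 / ((k : ℝ) + 1)} := by
        ext z
        simp [NoJump]
      rw [this]
      refine .iInter fun k => .iUnion fun n => ?_
      have h1 := hq.sub_const (1 / ((n : ℝ) + 1))
      have h2 := hd.comp (measurable_fst.prodMk h1)
      have h3 := (hd.comp (measurable_fst.prodMk hq)).add_const (1 / ((k : ℝ) + 1))
      exact (measurableSet_lt measurable_const h1).inter (measurableSet_lt h2 h3)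
    exact (hq measurableSet_Ioo).inter hj
  refine ⟨fun z => d (z.1, 1 - g (z.1, f z)), _, hd.comp (measurable_fst.prodMk hq), hS,
    fun ω w hw hwg hω => ?_⟩
  have hφ := hω.continuousOn_phi hw
  have hR := hd' ω w hw hwg hω
  have hj : ∀ q ∈ Ioo (0 : ℝ) 1,
      (NoJump (fun q => d (ω, q)) q ↔ NoJump (envelopeSlope (Phi w (κ ω))) q) := by
    intro q hq
    refine forall_congr' fun k => exists_congr fun n => and_congr_right fun hn => ?_
    rw [hR q hq, hR _ ⟨hn, (sub_lt_self _ Nat.one_div_pos_of_nat).trans hq.2⟩]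
  have hwF : ∀ r, w ((κ ω).real (Iic r)) = g (ω, f (ω, r)) := fun r => by
    rw [hwg _ ⟨measureReal_nonneg, measureReal_le_one⟩, hf']
  refine ⟨?_, fun r hr => ?_⟩
  -- At a quantile, `1 - w(F(r))` becomes `1 - w(p)`, which avoids the countably many jumps for
  -- almost every `p`.
  · have h1 : ∀ᵐ p ∂unif, (ω, quantile (κ ω) p) ∈ {z : Ω × ℝ | 1 - g (z.1, f z) ∈ Ioo (0 : ℝ) 1 ∧
        NoJump (fun q => d (z.1, q)) (1 - g (z.1, f z))} := by
      filter_upwards [hw.ae_one_sub_notMem (countable_not_noJump hφ), ae_unif_mem] with p hp hp01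
      have hm := hw.one_sub_mem_Ioo hp01
      have e : 1 - g (ω, f (ω, quantile (κ ω) p)) = 1 - w p := by
        rw [← hwF, hω.real_Iic_quantile hp01]
      show 1 - g (ω, f (ω, quantile (κ ω) p)) ∈ Ioo (0 : ℝ) 1 ∧
        NoJump (fun q => d (ω, q)) (1 - g (ω, f (ω, quantile (κ ω) p)))
      rw [e, hj _ hm]
      exact ⟨hm, by_contra fun h => hp ⟨hm, h⟩⟩
    have h2 := (ae_map_iff (aemeasurable_quantile (κ ω)) (measurable_prodMk_left hS)).2 h1
    rwa [map_quantile] at h2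
  · obtain ⟨h1, h2⟩ := hr
    simp only at h1 h2 ⊢
    rw [hwF, ← hR _ h1]
    exact ⟨(hasDerivAt_of_noJump hφ h1 ((hj _ h1).1 h2)).deriv,
      envelopeSlope_pos hφ (hω.strictMonoOn_phi hw) h1⟩

open Classical in
lemma exists_measurable_primitive {j : Ω × ℝ → ℝ} (hj : Measurable j) :
    ∃ k : Ω × ℝ → ℝ, Measurable k ∧ ∀ ω x, 0 < x → ∫ ξ in (1 : ℝ)..x, j (ω, ξ) = k (ω, x) := by
  refine ⟨fun z => (∫ ξ, if 1 < ξ ∧ ξ ≤ z.2 then j (z.1, ξ) else 0) -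
    ∫ ξ, if z.2 < ξ ∧ ξ ≤ 1 then j (z.1, ξ) else 0, Measurable.sub ?_ ?_, fun ω x hx => ?_⟩
  · refine StronglyMeasurable.measurable (StronglyMeasurable.integral_prod_right
      (f := fun (z : Ω × ℝ) ξ => if 1 < ξ ∧ ξ ≤ z.2 then j (z.1, ξ) else 0)
      (Measurable.stronglyMeasurable (.ite ?_ (hj.comp (by fun_prop)) measurable_const)))
    exact (measurableSet_lt measurable_const measurable_snd).inter
      (measurableSet_le measurable_snd (by fun_prop))
  · refine StronglyMeasurable.measurable (StronglyMeasurable.integral_prod_right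
      (f := fun (z : Ω × ℝ) ξ => if z.2 < ξ ∧ ξ ≤ 1 then j (z.1, ξ) else 0)
      (Measurable.stronglyMeasurable (.ite ?_ (hj.comp (by fun_prop)) measurable_const)))
    exact (measurableSet_lt (by fun_prop) measurable_snd).inter
      (measurableSet_le measurable_snd measurable_const)
  · rw [intervalIntegral, ← integral_indicator measurableSet_Ioc,
      ← integral_indicator measurableSet_Ioc]
    congr 1 <;> exact integral_congr_ae (Eventually.of_forall fun ξ => by simp [indicator_apply])

/-- A utility function that is obtained by integrating the marginal utility is jointly measurable. -/
lemma exists_measurable_utility {c : Ω → ℝ} (hc : Measurable c) {g : Ω × ℝ → ℝ} (hg : Measurable g)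
    {d : Ω × ℝ → ℝ} (hd : Measurable d) :
    ∃ f : Ω × ℝ → ℝ, Measurable f ∧ ∀ ω, ∀ I D : ℝ → ℝ, IsInverseMarginal I →
      (∀ y, 0 < y → I y = g (ω, y)) → (∀ᵐ p ∂unif, 0 < D p) →
      (∀ᵐ p ∂unif, D p = d (ω, p)) →
      ∀ x, 0 < x → c ω + ∫ p in (0 : ℝ)..1, ∫ ξ in (I (D p))..x, posInv I ξ = f (ω, x) := by
  obtain ⟨j, hj, hj'⟩ := exists_measurable_posInv hg
  obtain ⟨k, hk, hk'⟩ := exists_measurable_primitive hj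
  refine ⟨fun z => c z.1 + ∫ p, (k (z.1, z.2) - k (z.1, g (z.1, d (z.1, p)))) ∂unif,
    ?_, fun ω I D hI hIg hD hDd x hx => ?_⟩
  · refine (hc.comp measurable_fst).add (StronglyMeasurable.measurable
      (StronglyMeasurable.integral_prod_right (f := fun (z : Ω × ℝ) p =>
        k (z.1, z.2) - k (z.1, g (z.1, d (z.1, p)))) (Measurable.stronglyMeasurable ?_)))
    have h1 : Measurable fun z : (Ω × ℝ) × ℝ => k (z.1.1, z.1.2) := hk.comp (by fun_prop)
    have h2 : Measurable fun z : (Ω × ℝ) × ℝ => d (z.1.1, z.2) := hd.comp (by fun_prop)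
    have h3 : Measurable fun z : (Ω × ℝ) × ℝ => g (z.1.1, d (z.1.1, z.2)) :=
      hg.comp ((measurable_fst.comp measurable_fst).prodMk h2)
    exact h1.sub (hk.comp ((measurable_fst.comp measurable_fst).prodMk h3))
  · rw [intervalIntegral_eq_unif]
    congr 1
    refine integral_congr_ae ?_
    filter_upwards [hD, hDd] with p hp hpd
    have hIp : 0 < I (D p) := hI.pos hp
    have hii : ∀ {a b : ℝ}, 0 < a → 0 < b → IntervalIntegrable (posInv I) volume a b :=
      fun ha hb => (hI.posInv.continuousOn.mono fun t ht =>
        (lt_min ha hb).trans_le ht.1).intervalIntegrable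
    have hkI : ∀ b, 0 < b → ∫ ξ in (1 : ℝ)..b, posInv I ξ = k (ω, b) := by
      intro b hb
      rw [← hk' ω b hb]
      refine intervalIntegral.integral_congr fun ξ hξ => ?_
      exact hj' ω I hI hIg ξ ((lt_min one_pos hb).trans_le hξ.1)
    -- The integral from `I (D p)` to `x` is a difference of primitives based at `1`.
    have e := intervalIntegral.integral_interval_sub_left (hii one_pos hx) (hii one_pos hIp)
    rw [hkI _ hx, hkI _ hIp] at e
    rw [← hpd, ← hIg _ hp, e]

end Measurability

end RDPFPP

namespace RDPFPP

/-! ### Conditional laws -/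

lemma lintegral_condDistrib {α γ β : Type*} [MeasurableSpace α] [MeasurableSpace γ]
    [MeasurableSpace β] [StandardBorelSpace β] [Nonempty β] {P : Measure α} [IsFiniteMeasure P]
    {X : α → γ} {Y : α → β} (hX : Measurable X) (hY : Measurable Y) {g : γ × β → ENNReal}
    (hg : Measurable g) :
    ∫⁻ a, ∫⁻ y, g (X a, y) ∂condDistrib Y X P (X a) ∂P = ∫⁻ a, g (X a, Y a) ∂P := by
  have h1 : Measurable fun x => ∫⁻ y, g (x, y) ∂condDistrib Y X P x :=
    hg.lintegral_kernel_prod_right'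
  rw [← lintegral_map h1 hX, ← Measure.lintegral_compProd hg,
    compProd_map_condDistrib hY.aemeasurable, lintegral_map hg (hX.prodMk hY)]

/-- Conditional laws are determined by the conditional probabilities of rational half-lines. -/
lemma ae_eq_of_forall_rat_Iic {Ω : Type*} {mΩ : MeasurableSpace Ω} {P : Measure Ω} {μ ν : Ω → Measure ℝ} (hμ : ∀ ω, IsProbabilityMeasure (μ ω))
    (hν : ∀ ω, IsProbabilityMeasure (ν ω))
    (h : ∀ q : ℚ, ∀ᵐ ω ∂P, μ ω (Iic (q : ℝ)) = ν ω (Iic (q : ℝ))) : ∀ᵐ ω ∂P, μ ω = ν ω := by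
  filter_upwards [ae_all_iff.2 h] with ω hω
  refine ext_of_generate_finite _ (Real.borel_eq_generateFrom_Iic_rat) Real.isPiSystem_Iic_rat ?_ ?_
  · intro s hs
    simp only [mem_iUnion, mem_singleton_iff] at hs
    obtain ⟨q, rfl⟩ := hs
    exact hω q
  · simp

section Conditional

variable {Ω : Type*} {m : MeasurableSpace Ω} {mΩ : MeasurableSpace Ω} {P : Measure Ω}
  [IsProbabilityMeasure P] {β : Type*} [MeasurableSpace β] [StandardBorelSpace β] [Nonempty β]

/-- The regular conditional law of a random element given a sub-σ-algebra, as a kernel. -/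
noncomputable def condKer (P : Measure Ω) [IsFiniteMeasure P] (m : MeasurableSpace Ω) (Y : Ω → β) :
    @Kernel Ω β m _ :=
  @condDistrib Ω Ω β _ _ _ mΩ m Y id P _

instance (Y : Ω → β) : @IsMarkovKernel Ω β m _ (condKer P m Y) := by
  unfold condKer
  infer_instance

lemma condLaw_eq (X : Ω → ℝ) (ω : Ω) : condLaw P m X ω = condKer P m X ω := rfl

instance (X : Ω → ℝ) (ω : Ω) : IsProbabilityMeasure (condLaw P m X ω) := by
  rw [condLaw_eq]
  infer_instance

/-- Freezing: the first argument of `g` is known given `m`, so only `Y` is averaged. -/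
lemma condLExp_ae_eq_lintegral_condKer (hm : m ≤ mΩ) {Y : Ω → β} (hY : Measurable Y)
    {g : Ω × β → ENNReal} (hg : Measurable[m.prod inferInstance] g) :
    condLExp m P (fun ω => g (ω, Y ω)) =ᵐ[P] fun ω => ∫⁻ y, g (ω, y) ∂condKer P m Y ω := by
  refine (ae_eq_condLExp hm P _ ?_ fun s hs => ?_).symm
  · exact @Measurable.lintegral_kernel_prod_right' Ω β m _ (condKer P m Y) _ g hg
  -- The conditioning event is absorbed into the integrand, which reduces the claim to
  -- disintegration.
  · have hg' : Measurable[m.prod inferInstance] fun z : Ω × β => s.indicator (fun _ => g z) z.1 := by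
      have : (fun z : Ω × β => s.indicator (fun _ => g z) z.1) = (Prod.fst ⁻¹' s).indicator g := by
        funext z
        by_cases h : z.1 ∈ s <;> simp [h]
      rw [this]
      exact hg.indicator (@measurable_fst Ω β m _ s hs)
    have := @lintegral_condDistrib Ω Ω β mΩ m _ _ _ P _ id Y (measurable_id'' hm) hY _ hg'
    rw [← lintegral_indicator (hm s hs), ← lintegral_indicator (hm s hs)]
    convert this using 1
    · refine lintegral_congr fun ω => ?_
      by_cases h : ω ∈ s <;> simp [h, condKer]
    · refine lintegral_congr fun ω => ?_
      by_cases h : ω ∈ s <;> simp [h]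

lemma condKer_map (hm : m ≤ mΩ) {γ : Type*} [MeasurableSpace γ] [StandardBorelSpace γ] [Nonempty γ]
    {Y : Ω → β} (hY : Measurable Y) {f : β → γ} (hf : Measurable f) :
    ∀ᵐ ω ∂P, condKer P m (fun ω => f (Y ω)) ω = (condKer P m Y ω).map f := by
  have := @condDistrib_comp Ω Ω β _ _ _ mΩ P _ Y m γ _ _ _ id hY.aemeasurable f hf
  filter_upwards [ae_of_ae_map (@Measurable.aemeasurable Ω Ω mΩ m _ P (measurable_id'' hm)) this] with ω hω
  exact hω.trans (@Kernel.map_apply Ω β m _ γ _ f _ hf ω)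

lemma condLaw_ae_eq_condExp (hm : m ≤ mΩ) {X : Ω → ℝ} (hX : Measurable X) {B : Set ℝ}
    (hB : MeasurableSet B) :
    (fun ω => (condLaw P m X ω).real B) =ᵐ[P] P[(X ⁻¹' B).indicator (fun _ => (1 : ℝ)) | m] := by
  have := @condDistrib_ae_eq_condExp Ω Ω ℝ _ _ _ mΩ P _ id X m _ (measurable_id'' hm) hX hB
  rwa [MeasurableSpace.comap_id] at this

/-- The conditional law of a function of the parameters and of a random variable. -/
lemma condLaw_comp (hm : m ≤ mΩ) {X : Ω → ℝ} (hX : Measurable X) {f : Ω × ℝ → ℝ}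
    (hf : Measurable[m.prod (borel ℝ)] f) :
    ∀ᵐ ω ∂P, condLaw P m (fun ω => f (ω, X ω)) ω = (condLaw P m X ω).map fun x => f (ω, x) := by
  have hsec : ∀ ω, Measurable fun x => f (ω, x) := fun ω =>
    hf.comp (@measurable_prodMk_left Ω ℝ m _ ω)
  have hfX : Measurable fun ω => f (ω, X ω) :=
    (hf.comp (@Measurable.prodMk Ω mΩ Ω ℝ m _ _ _ (measurable_id'' hm) hX))
  refine ae_eq_of_forall_rat_Iic (fun ω => inferInstance)
    (fun ω => Measure.isProbabilityMeasure_map (hsec ω).aemeasurable) fun q => ?_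
  -- Two expressions for the conditional probability of `f (ω, X ω) ≤ q`: through the law of the
  -- composite, and through the law of `X` with `ω` frozen.
  have h1 := condLExp_ae_eq_lintegral_condKer (P := P) hm hfX
    (g := fun z => (Iic (q : ℝ)).indicator 1 z.2)
    ((measurable_one.indicator measurableSet_Iic).comp (@measurable_snd Ω ℝ m _))
  have h2 := condLExp_ae_eq_lintegral_condKer (P := P) hm hX
    (g := fun z => (Iic (q : ℝ)).indicator 1 (f z))
    ((measurable_one.indicator measurableSet_Iic).comp hf)
  filter_upwards [h1, h2] with ω e1 e2
  rw [e1] at e2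
  rw [lintegral_indicator_one measurableSet_Iic] at e2
  have e3 : ∀ x, (Iic (q : ℝ)).indicator (1 : ℝ → ENNReal) (f (ω, x))
      = ((fun x => f (ω, x)) ⁻¹' Iic (q : ℝ)).indicator 1 x := fun x => rfl
  simp only [e3] at e2
  rw [lintegral_indicator_one ((hsec ω) measurableSet_Iic)] at e2
  rw [Measure.map_apply (hsec ω) measurableSet_Iic]
  exact e2

/-- Almost sure properties are those that hold almost everywhere under the conditional laws. -/
lemma ae_ae_condKer_iff (hm : m ≤ mΩ) {Y : Ω → β} (hY : Measurable Y) {S : Set (Ω × β)}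
    (hS : MeasurableSet[m.prod inferInstance] S) :
    (∀ᵐ ω ∂P, ∀ᵐ y ∂condKer P m Y ω, (ω, y) ∈ S) ↔ ∀ᵐ ω ∂P, (ω, Y ω) ∈ S := by
  have hg : Measurable[m.prod inferInstance] (Sᶜ.indicator (1 : Ω × β → ENNReal)) :=
    @Measurable.indicator _ _ _ _ (m.prod inferInstance) _ _
      (@measurable_one _ _ _ (m.prod inferInstance) _) hS.compl
  -- Disintegration equates the two ways of computing the probability of the exceptional event.
  have h1 := @lintegral_condDistrib Ω Ω β mΩ m _ _ _ P _ id Y (measurable_id'' hm) hY _ hg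
  have hmeas1 : Measurable fun ω => ∫⁻ y, Sᶜ.indicator 1 (ω, y) ∂condKer P m Y ω :=
    (@Measurable.lintegral_kernel_prod_right' Ω β m _ (condKer P m Y) _ _ hg).mono hm le_rfl
  have hmeas2 : Measurable fun ω => Sᶜ.indicator (1 : Ω × β → ENNReal) (ω, Y ω) :=
    (hg.comp (@Measurable.prodMk Ω mΩ Ω β m _ _ _ (measurable_id'' hm) hY))
  have e1 : (∀ᵐ ω ∂P, ∀ᵐ y ∂condKer P m Y ω, (ω, y) ∈ S) ↔
      ∫⁻ ω, ∫⁻ y, Sᶜ.indicator 1 (ω, y) ∂condKer P m Y ω ∂P = 0 := by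
    rw [lintegral_eq_zero_iff hmeas1]
    refine eventually_congr (Eventually.of_forall fun ω => ?_)
    have hsec : Measurable fun y => Sᶜ.indicator (1 : Ω × β → ENNReal) (ω, y) :=
      hg.comp (@measurable_prodMk_left Ω β m _ ω)
    rw [Pi.zero_apply, lintegral_eq_zero_iff hsec]
    refine eventually_congr (Eventually.of_forall fun y => ?_)
    by_cases h : (ω, y) ∈ S <;> simp [h]
  have e2 : (∀ᵐ ω ∂P, (ω, Y ω) ∈ S) ↔
      ∫⁻ ω, Sᶜ.indicator (1 : Ω × β → ENNReal) (ω, Y ω) ∂P = 0 := by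
    rw [lintegral_eq_zero_iff hmeas2]
    refine eventually_congr (Eventually.of_forall fun ω => ?_)
    by_cases h : (ω, Y ω) ∈ S <;> simp [h]
  rw [e1, e2]
  exact iff_of_eq (congrArg (· = 0) h1)

lemma condLaw_congr {X Y : Ω → ℝ} (h : X =ᵐ[P] Y) (ω : Ω) : condLaw P m X ω = condLaw P m Y ω := by
  rw [condLaw, condLaw, condDistrib_congr_left h]

end Conditional

end RDPFPP

namespace RDPFPP

/-! ### One period of the forward construction -/

/-- The relations between the utilities `U`, `u` at the beginning and at the end of a period with
pricing law `μ` and weighting function `w`. -/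
structure IsPeriod (w : ℝ → ℝ) (μ : Measure ℝ) (u I U J : ℝ → ℝ) : Prop where
  isPricingLaw : IsPricingLaw μ
  isWeighting : IsWeighting w
  isDual : IsDual u I
  isDual_initial : IsDual U J
  integral_eq : ∀ y, 0 < y →
    ∫ η, I (y * envelopeSlope (Phi w μ) η) * envelopeSlope (Phi w μ) η ∂unif = J y
  integrable_conjugate : ∀ y, 0 < y →
    Integrable (fun η => conjugate u I (y * envelopeSlope (Phi w μ) η)) unif
  integral_conjugate : ∀ y, 0 < y →
    ∫ η, conjugate u I (y * envelopeSlope (Phi w μ) η) ∂unif = conjugate U J y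

section Period

variable {w : ℝ → ℝ} {μ : Measure ℝ} [IsProbabilityMeasure μ] {u I U J : ℝ → ℝ}

lemma intervalIntegrable_posInv (h : IsInverseMarginal I) {a b : ℝ} (ha : 0 < a)
    (hb : 0 < b) : IntervalIntegrable (posInv I) volume a b :=
  (h.posInv.continuousOn.mono fun _ ht => (lt_min ha hb).trans_le ht.1).intervalIntegrable

lemma isDual_of_forall_sub_eq (h : IsInverseMarginal I)
    (hu : ∀ a b, 0 < a → 0 < b → u b - u a = ∫ ξ in a..b, posInv I ξ) : IsDual u I where
  isInverseMarginal := h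
  hasDerivAt x hx := by
    have hc : ContinuousAt (posInv I) x :=
      h.posInv.continuousOn.continuousAt (Ioi_mem_nhds hx)
    have hm : StronglyMeasurableAtFilter (posInv I) (𝓝 x) volume :=
      h.posInv.continuousOn.stronglyMeasurableAtFilter isOpen_Ioi x hx
    have hd := (intervalIntegral.integral_hasDerivAt_right
      (intervalIntegrable_posInv h one_pos hx) hm hc).const_add (u 1)
    refine hd.congr_of_eventuallyEq ?_
    filter_upwards [Ioi_mem_nhds hx] with y hy
    rw [← hu 1 y one_pos hy]
    ring

/-- `I` determines `u` up to a constant. The constant in the recursion is the one with `∫ u(I(R)) =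
U(J 1)`, the normalization at `y = 1` from which the relation between the conjugates spreads to all
`y`. -/
lemma IsPeriod.of_recursion (hμ : IsPricingLaw μ) (hw : IsWeighting w) (hI : IsInverseMarginal I)
    (hUJ : IsDual U J)
    (heq : ∀ y, 0 < y → ∫ η in (0 : ℝ)..1, I (y * deriv (concaveEnvelope (Phi w μ)) η) *
      deriv (concaveEnvelope (Phi w μ)) η = J y)
    (hint : ∀ x, 0 < x → IntegrableOn (fun p => ∫ ξ in
      (I (deriv (concaveEnvelope (Phi w μ)) p))..x, posInv I ξ) (Ioo (0 : ℝ) 1))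
    (hu : ∀ x, 0 < x → u x = U (J 1) + ∫ p in (0 : ℝ)..1, ∫ ξ in
      (I (deriv (concaveEnvelope (Phi w μ)) p))..x, posInv I ξ) :
    IsPeriod w μ u I U J := by
  set D := deriv (concaveEnvelope (Phi w μ)) with hD
  have hDR : ∀ᵐ p ∂unif, D p = envelopeSlope (Phi w μ) p := hμ.ae_deriv_eq' hw
  have hRpos := hμ.ae_envelopeSlope_pos hw
  have hadd : ∀ p, 0 < D p → ∀ a b, 0 < a → 0 < b →
      ∫ ξ in (I (D p))..b, posInv I ξ = (∫ ξ in (I (D p))..a, posInv I ξ) + ∫ ξ in a..b, posInv I ξ :=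
    fun p hp a b ha hb => (intervalIntegral.integral_add_adjacent_intervals
      (intervalIntegrable_posInv hI (hI.pos hp) ha) (intervalIntegrable_posInv hI ha hb)).symm
  have hDpos : ∀ᵐ p ∂unif, 0 < D p := by
    filter_upwards [hDR, hRpos] with p h1 h2
    rwa [h1]
  have hsub : ∀ a b, 0 < a → 0 < b → u b - u a = ∫ ξ in a..b, posInv I ξ := by
    intro a b ha hb
    have e : ∫ p, (∫ ξ in (I (D p))..b, posInv I ξ) ∂unif =
        ∫ p, ((∫ ξ in (I (D p))..a, posInv I ξ) + ∫ ξ in a..b, posInv I ξ) ∂unif :=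
      integral_congr_ae (by filter_upwards [hDpos] with p hp using hadd p hp a b ha hb)
    rw [integral_add (hint a ha) (integrable_const _), integral_const, probReal_univ, one_smul] at e
    rw [hu a ha, hu b hb, intervalIntegral_eq_unif, intervalIntegral_eq_unif, e]
    ring
  have hdual := isDual_of_forall_sub_eq hI hsub
  have heq' : ∀ y, 0 < y →
      ∫ η, I (y * envelopeSlope (Phi w μ) η) * envelopeSlope (Phi w μ) η ∂unif = J y := by
    intro y hy
    rw [← heq y hy, intervalIntegral_eq_unif]
    exact integral_congr_ae (by filter_upwards [hDR] with p hp using by rw [hp])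
  have hval : (fun p => u (I (envelopeSlope (Phi w μ) p))) =ᵐ[unif]
      fun p => u 1 - ∫ ξ in (I (D p))..1, posInv I ξ := by
    filter_upwards [hDR, hDpos] with p h1 h2
    rw [← h1, ← hsub _ _ (hI.pos h2) one_pos]
    ring
  have hi : Integrable (fun p => u (I (envelopeSlope (Phi w μ) p))) unif :=
    ((integrable_const _).sub (hint 1 one_pos)).congr hval.symm
  have h1 : ∫ p, u (I (envelopeSlope (Phi w μ) p)) ∂unif = U (J 1) := by
    rw [integral_congr_ae hval, integral_sub (integrable_const _) (hint 1 one_pos), integral_const,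
      probReal_univ, one_smul, hu 1 one_pos, intervalIntegral_eq_unif]
    ring
  have key := fun y hy => RDPFPP.integral_conjugate (y := y) hdual hUJ
    (measurable_envelopeSlope _) hRpos heq' hi h1 hy
  exact ⟨hμ, hw, hdual, hUJ, heq', fun y hy => (key y hy).1, fun y hy => (key y hy).2⟩

end Period

/-! ### The one-period problem conditionally on a σ-algebra -/

section Conditional

variable {Ω : Type*} {m : MeasurableSpace Ω} {mΩ : MeasurableSpace Ω} {P : Measure Ω}
  [IsProbabilityMeasure P] {ρ X ξ : Ω → ℝ} {w u I U J : Ω → ℝ → ℝ}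

/-- No payoff that can be financed by the wealth `ξ` has a larger rank-dependent utility than
`U ξ`. -/
lemma rdUtility_le (hm : m ≤ mΩ) (hρ : Measurable ρ)
    (hper : ∀ᵐ ω ∂P, IsPeriod (w ω) (condLaw P m ρ ω) (u ω) (I ω) (U ω) (J ω))
    (hρ0 : ∀ᵐ ω ∂P, 0 < ρ ω) (hX : Measurable X) (hX0 : ∀ᵐ ω ∂P, 0 ≤ X ω)
    (hξ : ∀ᵐ ω ∂P, 0 ≤ ξ ω)
    (hb : condLExp m P (fun ω => ENNReal.ofReal (ρ ω * X ω)) =ᵐ[P] fun ω => ENNReal.ofReal (ξ ω)) :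
    ∀ᵐ ω ∂P, posPart (u ω) (rdLaw P m w X ω) < ⊤ ∧
      rdUtility P m u w X ω ≤ extend (U ω) (ξ ω) := by
  -- The conditional joint law of `(ρ, X)` serves as the coupling: its marginals are the conditional
  -- laws, and the integral of the product is the price.
  have hY : Measurable fun ω => (ρ ω, X ω) := hρ.prodMk hX
  have h1 : ∀ᵐ ω ∂P, condLaw P m ρ ω = (condKer P m (fun ω => (ρ ω, X ω)) ω).map Prod.fst :=
    condKer_map hm hY measurable_fst
  have h2 : ∀ᵐ ω ∂P, condLaw P m X ω = (condKer P m (fun ω => (ρ ω, X ω)) ω).map Prod.snd :=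
    condKer_map hm hY measurable_snd
  have h3 : condLExp m P (fun ω => ENNReal.ofReal (ρ ω) * ENNReal.ofReal (X ω)) =ᵐ[P]
      fun ω => ∫⁻ p, ENNReal.ofReal p.1 * ENNReal.ofReal p.2 ∂condKer P m (fun ω => (ρ ω, X ω)) ω :=
    condLExp_ae_eq_lintegral_condKer hm hY
      (g := fun z => ENNReal.ofReal z.2.1 * ENNReal.ofReal z.2.2)
      ((show Measurable fun p : ℝ × ℝ => ENNReal.ofReal p.1 * ENNReal.ofReal p.2 by fun_prop).comp
        (@measurable_snd Ω (ℝ × ℝ) m _))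
  have h4 : condLExp m P (fun ω => ENNReal.ofReal (ρ ω) * ENNReal.ofReal (X ω)) =ᵐ[P]
      condLExp m P (fun ω => ENNReal.ofReal (ρ ω * X ω)) :=
    condLExp_congr_ae (by filter_upwards [hρ0] with ω h using (ENNReal.ofReal_mul h.le).symm)
  have h5 : ∀ᵐ ω ∂P, ∀ᵐ x ∂condLaw P m X ω, 0 ≤ x :=
    (ae_ae_condKer_iff hm hX (S := Prod.snd ⁻¹' Ici 0)
      (@measurable_snd Ω ℝ m _ _ measurableSet_Ici)).2 hX0
  filter_upwards [hper, h1, h2, h3, h4, h5, hb, hξ] with ω hp e1 e2 e3 e4 h0 hb hξ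
  -- `ω` is fixed before `y`: the exceptional null set does not depend on the conjugate variable, so
  -- one may minimize over all `y`.
  have key := fun y hy => extIntegral_distortedLaw_le hp.isPricingLaw hp.isWeighting hp.isDual hy
    (hp.integrable_conjugate y hy) (hp.integral_conjugate y hy) e1.symm e2.symm h0 hξ
    (by rw [← e3, e4, hb])
  exact ⟨(key 1 one_pos).1, hp.isDual_initial.le_extend_of_forall hξ fun y hy => (key y hy).2⟩

/-- The payoff that attains the utility `U ξ`. -/
lemma rdUtility_eq (hm : m ≤ mΩ) (hρ : Measurable ρ)
    (hper : ∀ᵐ ω ∂P, IsPeriod (w ω) (condLaw P m ρ ω) (u ω) (I ω) (U ω) (J ω))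
    (hρ0 : ∀ᵐ ω ∂P, 0 < ρ ω) (hξ : ∀ᵐ ω ∂P, 0 < ξ ω) {T : Ω × ℝ → ℝ}
    (hT : Measurable[m.prod (borel ℝ)] T)
    (hTeq : ∀ᵐ ω ∂P, ∀ᵐ r ∂condLaw P m ρ ω, T (ω, r) = I ω (deriv (U ω) (ξ ω) *
      deriv (concaveEnvelope (Phi (w ω) (condLaw P m ρ ω)))
        (1 - w ω ((condLaw P m ρ ω).real (Iic r)))))
    (hX : ∀ᵐ ω ∂P, X ω = T (ω, ρ ω)) :
    (∀ᵐ ω ∂P, 0 < X ω) ∧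
    condLExp m P (fun ω => ENNReal.ofReal (ρ ω * X ω)) =ᵐ[P] (fun ω => ENNReal.ofReal (ξ ω)) ∧
    ∀ᵐ ω ∂P, posPart (u ω) (rdLaw P m w X ω) < ⊤ ∧
      rdUtility P m u w X ω = ((U ω (ξ ω) : ℝ) : EReal) := by
  have hsec : ∀ ω, Measurable fun x => T (ω, x) := fun ω =>
    hT.comp (@measurable_prodMk_left Ω ℝ m _ ω)
  have key : ∀ᵐ ω ∂P, (∀ᵐ r ∂condLaw P m ρ ω, 0 < T (ω, r)) ∧
      ∫⁻ r, ENNReal.ofReal r * ENNReal.ofReal (T (ω, r)) ∂condLaw P m ρ ω = ENNReal.ofReal (ξ ω) ∧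
      posPart (u ω) (distortedLaw (w ω) ((condLaw P m ρ ω).map fun r => T (ω, r))) < ⊤ ∧
      extIntegral (u ω) (distortedLaw (w ω) ((condLaw P m ρ ω).map fun r => T (ω, r))) =
        ((U ω (ξ ω) : ℝ) : EReal) := by
    filter_upwards [hper, hξ, hTeq] with ω hp hξ hTω
    -- The conjugate variable is `y = U'(ξ)`, for which the price `J y` is `ξ`.
    have hy := hp.isDual_initial.deriv_pos hξ
    have := optimal_payoff hp.isPricingLaw hp.isWeighting hp.isDual
      hp.isDual_initial.isInverseMarginal hp.integral_eq hy (hp.integrable_conjugate _ hy)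
      (hp.integral_conjugate _ hy) (hsec ω).aemeasurable hTω
    rwa [hp.isDual_initial.apply_deriv hξ] at this
  refine ⟨?_, ?_, ?_⟩
  · have h1 : ∀ᵐ ω ∂P, 0 < T (ω, ρ ω) :=
      (ae_ae_condKer_iff hm hρ (S := T ⁻¹' Ioi 0) (hT measurableSet_Ioi)).1
        (key.mono fun ω h => h.1)
    filter_upwards [h1, hX] with ω h1 h2
    rwa [h2]
  · have hg : Measurable[m.prod (borel ℝ)]
        fun z : Ω × ℝ => ENNReal.ofReal z.2 * ENNReal.ofReal (T z) :=
      (ENNReal.measurable_ofReal.comp (@measurable_snd Ω ℝ m _)).mul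
        (ENNReal.measurable_ofReal.comp hT)
    have h1 := condLExp_ae_eq_lintegral_condKer (P := P) hm hρ hg
    have h2 : condLExp m P (fun ω => ENNReal.ofReal (ρ ω * X ω)) =ᵐ[P]
        condLExp m P (fun ω => ENNReal.ofReal (ρ ω) * ENNReal.ofReal (T (ω, ρ ω))) :=
      condLExp_congr_ae (by
        filter_upwards [hρ0, hX] with ω h hx using by rw [hx, ENNReal.ofReal_mul h.le])
    filter_upwards [h1, h2, key] with ω h1 h2 hk
    rw [h2, h1]
    exact hk.2.1
  · filter_upwards [condLaw_comp hm hρ hT, key] with ω h1 hk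
    rw [rdUtility, rdLaw, condLaw_congr hX, h1]
    exact hk.2.2

end Conditional

end RDPFPP

namespace RDPFPP

/-! ### The market -/

section Market

variable {Ω : Type*} {mΩ : MeasurableSpace Ω} {P : Measure Ω}

/-- Completeness is needed because the formula for the next wealth agrees with a measurable function
only off a null set. -/
lemma measurable_of_ae_eq {m : MeasurableSpace Ω} (hc : ∀ s : Set Ω, P s = 0 → MeasurableSet[m] s)
    {X Y : Ω → ℝ} (hY : Measurable[m] Y) (h : ∀ᵐ ω ∂P, X ω = Y ω) : Measurable[m] X := by
  intro B hB
  have h0 : P {ω | X ω ≠ Y ω} = 0 := h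
  have e : X ⁻¹' B = (Y ⁻¹' B ∩ {ω | X ω ≠ Y ω}ᶜ) ∪ (X ⁻¹' B ∩ {ω | X ω ≠ Y ω}) := by
    ext ω
    by_cases hω : X ω = Y ω <;> simp [hω]
  rw [e]
  exact ((hY hB).inter (hc _ h0).compl).union (hc _ (measure_mono_null inter_subset_right h0))

lemma plus_le (F G : Filtration ℕ mΩ) (n : ℕ) : plus F G n ≤ mΩ := sup_le (F.le n) (G.le (n + 1))

lemma le_plus (F G : Filtration ℕ mΩ) (n : ℕ) : G (n + 1) ≤ plus F G n := le_sup_right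

variable [IsProbabilityMeasure P] {F G : Filtration ℕ mΩ} {ρ : ℕ → Ω → ℝ}

namespace IsMarket

lemma plus_le_F (h : IsMarket P F G ρ) (n : ℕ) : plus F G n ≤ F (n + 1) :=
  sup_le (F.mono n.le_succ) (h.G_le_F (n + 1) n.succ_pos)

lemma measurable (h : IsMarket P F G ρ) (n : ℕ) : Measurable (ρ (n + 1)) :=
  (h.measurable_rho n).mono (F.le _) le_rfl

/-- Conditional independence holds event by event. Countably many half-lines determine a law, so one
null set suffices. -/
lemma condLaw_plus (h : IsMarket P F G ρ) (n : ℕ) :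
    ∀ᵐ ω ∂P, condLaw P (plus F G n) (ρ (n + 1)) ω = condLaw P (G (n + 1)) (ρ (n + 1)) ω := by
  refine ae_eq_of_forall_rat_Iic (fun ω => inferInstance) (fun ω => inferInstance) fun q => ?_
  filter_upwards [condLaw_ae_eq_condExp (P := P) (plus_le F G n) (h.measurable n)
      (measurableSet_Iic (a := (q : ℝ))),
    condLaw_ae_eq_condExp (P := P) (G.le (n + 1)) (h.measurable n)
      (measurableSet_Iic (a := (q : ℝ))), h.condIndep n _ measurableSet_Iic] with ω h1 h2 h3
  rw [← h1, ← h2] at h3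
  exact (ENNReal.toReal_eq_toReal_iff' (measure_ne_top _ _) (measure_ne_top _ _)).1 h3

/-- Otherwise `condExp` would be `0` by convention instead of `1`. -/
lemma integrable (h : IsMarket P F G ρ) (n : ℕ) : Integrable (ρ (n + 1)) P := by
  by_contra hi
  have h1 := h.condExp_rho n
  rw [condExp_of_not_integrable hi] at h1
  obtain ⟨ω, hω⟩ := h1.exists
  exact zero_ne_one hω

lemma isPricingLaw (h : IsMarket P F G ρ) (n : ℕ) :
    ∀ᵐ ω ∂P, IsPricingLaw (condLaw P (G (n + 1)) (ρ (n + 1)) ω) := by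
  have hm := G.le (n + 1)
  have h1 : ∀ᵐ ω ∂P, ∀ᵐ x ∂condLaw P (G (n + 1)) (ρ (n + 1)) ω, 0 < x :=
    (ae_ae_condKer_iff hm (h.measurable n) (S := Prod.snd ⁻¹' Ioi 0)
      (@measurable_snd Ω ℝ (G (n + 1)) _ _ measurableSet_Ioi)).2 (h.rho_pos n)
  have h2 := condLExp_ae_eq_lintegral_condKer (P := P) hm (h.measurable n)
    (g := fun z => ‖z.2‖ₑ) ((measurable_enorm (ε := ℝ)).comp (@measurable_snd Ω ℝ (G (n + 1)) _))
  have h3 := condLExp_lt_top (mΩ := G (n + 1)) (h.integrable n).hasFiniteIntegral.ne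
  filter_upwards [h1, h2, h3, h.atomless n] with ω h1 h2 h3 h4
  refine ⟨h1, ⟨aestronglyMeasurable_id, ?_⟩, h4⟩
  rw [h2] at h3
  exact h3

/-- The tower property; a constant price is measurable for the smaller σ-algebra too. This is why
the last part of the theorem concerns deterministic wealth. -/
lemma condLExp_G (n : ℕ) {x : ENNReal} {f : Ω → ENNReal}
    (hf : condLExp (plus F G n) P f =ᵐ[P] fun _ => x) :
    condLExp (G (n + 1)) P f =ᵐ[P] fun _ => x := by
  refine (ae_eq_condLExp (G.le (n + 1)) P f measurable_const fun s hs => ?_).symm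
  rw [← setLIntegral_condLExp (plus_le F G n) P f (le_plus F G n s hs)]
  exact lintegral_congr_ae (ae_restrict_of_ae (hf.mono fun ω h => h.symm))

end IsMarket

end Market

/-! ### The forward construction -/

/-- The data of the recursive construction of the utility functions `U` from the inverse marginals
`I`. -/
structure IsConstruction {Ω : Type*} {mΩ : MeasurableSpace Ω} (P : Measure Ω)
    [IsProbabilityMeasure P] (F G : Filtration ℕ mΩ) (ρ : ℕ → Ω → ℝ) (W : ℕ → Ω → ℝ → ℝ)
    (U₀ : ℝ → ℝ) (I U : ℕ → Ω → ℝ → ℝ) : Prop where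
  market : IsMarket P F G ρ
  weighting : IsRandomWeighting P G W
  isUtility_initial : IsUtility U₀
  I_zero : ∀ᵐ ω ∂P, ∀ y, 0 < y → I 0 ω y = posInv (deriv U₀) y
  measurable_I : ∀ n, IsRandomFunction P (G (n + 1)) (Ioi 0) (I (n + 1))
  isInverseMarginal : ∀ n, ∀ᵐ ω ∂P, IsInverseMarginal (I (n + 1) ω)
  integral_eq : ∀ n, ∀ᵐ ω ∂P, ∀ y, 0 < y →
    ∫ η in (0 : ℝ)..1, I (n + 1) ω (y * phiHatDeriv P G ρ W (n + 1) ω η) *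
      phiHatDeriv P G ρ W (n + 1) ω η = I n ω y
  integrableOn : ∀ n, ∀ᵐ ω ∂P, ∀ x, 0 < x →
    IntegrableOn (fun p => ∫ ξ in (I (n + 1) ω (phiHatDeriv P G ρ W (n + 1) ω p))..x,
      posInv (I (n + 1) ω) ξ) (Ioo (0 : ℝ) 1)
  U_zero : ∀ᵐ ω ∂P, ∀ x, 0 < x → U 0 ω x = U₀ x
  U_succ : ∀ n, ∀ᵐ ω ∂P, ∀ x, 0 < x →
    U (n + 1) ω x = U n ω (I n ω 1) +
      ∫ p in (0 : ℝ)..1, ∫ ξ in (I (n + 1) ω (phiHatDeriv P G ρ W (n + 1) ω p))..x,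
        posInv (I (n + 1) ω) ξ

namespace IsConstruction

variable {Ω : Type*} {mΩ : MeasurableSpace Ω} {P : Measure Ω} [IsProbabilityMeasure P]
  {F G : Filtration ℕ mΩ} {ρ : ℕ → Ω → ℝ} {W : ℕ → Ω → ℝ → ℝ} {U₀ : ℝ → ℝ} {I U : ℕ → Ω → ℝ → ℝ}

lemma isPeriod_of_isDual (h : IsConstruction P F G ρ W U₀ I U) (n : ℕ)
    (hn : ∀ᵐ ω ∂P, IsDual (U n ω) (I n ω)) :
    ∀ᵐ ω ∂P, IsPeriod (W (n + 1) ω) (condLaw P (G (n + 1)) (ρ (n + 1)) ω) (U (n + 1) ω)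
      (I (n + 1) ω) (U n ω) (I n ω) := by
  filter_upwards [hn, h.market.isPricingLaw n, h.weighting.isWeighting n, h.isInverseMarginal n,
    h.integral_eq n, h.integrableOn n, h.U_succ n] with ω h1 h2 h3 h4 h5 h6 h7
  exact IsPeriod.of_recursion h2 h3 h4 h1 h5 h6 h7

/-- Duality at the beginning of a period is what the one-period argument needs, and it returns
duality at the end. -/
lemma isDual (h : IsConstruction P F G ρ W U₀ I U) (n : ℕ) :
    ∀ᵐ ω ∂P, IsDual (U n ω) (I n ω) := by
  induction n with
  | zero =>
    filter_upwards [h.I_zero, h.U_zero] with ω h1 h2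
    exact h.isUtility_initial.isDual.congr h2 h1
  | succ n ih => exact (h.isPeriod_of_isDual n ih).mono fun ω hω => hω.isDual

lemma isPeriod (h : IsConstruction P F G ρ W U₀ I U) (n : ℕ) :
    ∀ᵐ ω ∂P, IsPeriod (W (n + 1) ω) (condLaw P (G (n + 1)) (ρ (n + 1)) ω) (U (n + 1) ω)
      (I (n + 1) ω) (U n ω) (I n ω) :=
  h.isPeriod_of_isDual n (h.isDual n)

lemma isPeriod_plus (h : IsConstruction P F G ρ W U₀ I U) (n : ℕ) :
    ∀ᵐ ω ∂P, IsPeriod (W (n + 1) ω) (condLaw P (plus F G n) (ρ (n + 1)) ω) (U (n + 1) ω)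
      (I (n + 1) ω) (U n ω) (I n ω) := by
  filter_upwards [h.isPeriod n, h.market.condLaw_plus n] with ω h1 h2
  rwa [h2]

/-- Isolates the only term of the recursion inherited from earlier periods. -/
lemma isRandomFunction_of_const (h : IsConstruction P F G ρ W U₀ I U) (n : ℕ) {c : Ω → ℝ}
    (hc : Measurable[G (n + 1)] c) (hcU : ∀ᵐ ω ∂P, U n ω (I n ω 1) = c ω) :
    IsRandomFunction P (G (n + 1)) (Ioi 0) (U (n + 1)) := by
  obtain ⟨gW, hgW, hgW'⟩ := h.weighting.measurable n
  obtain ⟨gI, hgI, hgI'⟩ := h.measurable_I n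
  obtain ⟨d, hd, hd'⟩ := @exists_measurable_envelopeSlope Ω (G (n + 1))
    (condKer P (G (n + 1)) (ρ (n + 1))) inferInstance gW hgW
  obtain ⟨f, hf, hf'⟩ := @exists_measurable_utility Ω (G (n + 1)) c hc gI hgI d hd
  refine ⟨f, hf, ?_⟩
  filter_upwards [hcU, hgW', hgI', h.isPeriod n, h.U_succ n] with ω h1 h2 h3 hp h5 x hx
  rw [h5 x hx, h1]
  have hR := hd' ω _ hp.isWeighting h2 hp.isPricingLaw
  have hD : ∀ᵐ p ∂unif, phiHatDeriv P G ρ W (n + 1) ω p = envelopeSlope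
      (Phi (W (n + 1) ω) (condLaw P (G (n + 1)) (ρ (n + 1)) ω)) p :=
    hp.isPricingLaw.ae_deriv_eq' hp.isWeighting
  refine hf' ω _ _ hp.isDual.isInverseMarginal h3 ?_ ?_ x hx
  · filter_upwards [hD, hp.isPricingLaw.ae_envelopeSlope_pos hp.isWeighting] with p e1 e2
    rwa [e1]
  · filter_upwards [hD, ae_unif_mem] with p e1 e2
    rw [e1]
    exact hR p e2

lemma isRandomFunction (h : IsConstruction P F G ρ W U₀ I U) (n : ℕ) :
    IsRandomFunction P (G (n + 1)) (Ioi 0) (U (n + 1)) := by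
  induction n with
  | zero =>
    refine h.isRandomFunction_of_const 0 (c := fun _ => U₀ (posInv (deriv U₀) 1)) measurable_const ?_
    filter_upwards [h.I_zero, h.U_zero] with ω h1 h2
    rw [h1 1 one_pos, h2 _ (h.isUtility_initial.isDual.isInverseMarginal.pos one_pos)]
  | succ n ih =>
    obtain ⟨gU, hgU, hgU'⟩ := ih
    obtain ⟨gI, hgI, hgI'⟩ := h.measurable_I n
    refine h.isRandomFunction_of_const (n + 1) (c := fun ω => gU (ω, gI (ω, 1))) ?_ ?_
    · have h1 : Measurable[G (n + 1)] fun ω => gI (ω, 1) :=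
        hgI.comp (@measurable_prodMk_right Ω ℝ (G (n + 1)) _ 1)
      have h2 : Measurable[G (n + 1)] fun ω => gU (ω, gI (ω, 1)) :=
        hgU.comp (@Measurable.prodMk Ω (G (n + 1)) Ω ℝ (G (n + 1)) _ _ _ measurable_id h1)
      exact h2.mono (G.mono (n + 1).le_succ) le_rfl
    · filter_upwards [hgU', hgI', h.isInverseMarginal n] with ω h1 h2 h3
      rw [h1 _ (h3.pos one_pos), h2 1 (mem_Ioi.2 one_pos)]

/-- `U_n'` is the inverse of `I_n`, so its measurability follows from that of `I_n` without
differentiating in a parameter. -/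
lemma isRandomFunction_deriv (h : IsConstruction P F G ρ W U₀ I U) (n : ℕ) :
    IsRandomFunction P (G (n + 1)) (Ioi 0) fun ω => deriv (U n ω) := by
  cases n with
  | zero =>
    refine ⟨fun z => (Ioi (0 : ℝ)).indicator (deriv U₀) z.2,
      h.isUtility_initial.deriv.measurable_indicator.comp (@measurable_snd Ω ℝ (G 1) _), ?_⟩
    filter_upwards [h.U_zero] with ω h1 x hx
    have hd := h.isUtility_initial.isDual
    rw [(hd.congr h1 fun _ _ => rfl).deriv_eq hx, ← hd.deriv_eq hx, indicator_of_mem hx]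
  | succ n =>
    obtain ⟨gI, hgI, hgI'⟩ := h.measurable_I n
    obtain ⟨j, hj, hj'⟩ := @exists_measurable_posInv Ω (G (n + 1)) gI hgI
    refine ⟨j, hj.mono (sup_le_sup_right
      (MeasurableSpace.comap_mono (G.mono (n + 1).le_succ)) _) le_rfl, ?_⟩
    filter_upwards [hgI', h.isDual (n + 1)] with ω h1 h2 x hx
    rw [h2.deriv_eq hx]
    exact hj' ω _ h2.isInverseMarginal h1 x hx

/-- The optimal payoff is a measurable function of the parameters and of the state price density. -/
lemma exists_payoff (h : IsConstruction P F G ρ W U₀ I U) (n : ℕ) {m : MeasurableSpace Ω}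
    (hm : G (n + 1) ≤ m) {ξ : Ω → ℝ} (hξm : Measurable[m] ξ) (hξ : ∀ᵐ ω ∂P, 0 < ξ ω) :
    ∃ T : Ω × ℝ → ℝ, Measurable[m.prod (borel ℝ)] T ∧
      (∀ᵐ ω ∂P, ∀ᵐ r ∂condLaw P (G (n + 1)) (ρ (n + 1)) ω, T (ω, r) =
        I (n + 1) ω (deriv (U n ω) (ξ ω) * deriv (concaveEnvelope (Phi (W (n + 1) ω)
          (condLaw P (G (n + 1)) (ρ (n + 1)) ω)))
            (1 - W (n + 1) ω ((condLaw P (G (n + 1)) (ρ (n + 1)) ω).real (Iic r))))) ∧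
      ∀ᵐ ω ∂P, nextWealth P G ρ W I U n ω (ξ ω) = T (ω, ρ (n + 1) ω) := by
  obtain ⟨gW, hgW, hgW'⟩ := h.weighting.measurable n
  obtain ⟨gI, hgI, hgI'⟩ := h.measurable_I n
  obtain ⟨j, hj, hj'⟩ := h.isRandomFunction_deriv n
  obtain ⟨d, S, hd, hS, hdS⟩ := @exists_measurable_deriv Ω (G (n + 1))
    (condKer P (G (n + 1)) (ρ (n + 1))) inferInstance gW hgW
  have hle : (G (n + 1)).prod (borel ℝ) ≤ m.prod (borel ℝ) :=
    sup_le_sup_right (MeasurableSpace.comap_mono hm) _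
  have hfst : Measurable[m.prod (borel ℝ), m] (Prod.fst : Ω × ℝ → Ω) := @measurable_fst Ω ℝ m _
  have h1 : Measurable[m.prod (borel ℝ)] fun z : Ω × ℝ => j (z.1, ξ z.1) :=
    (hj.mono hle le_rfl).comp
      (@Measurable.prodMk _ (m.prod (borel ℝ)) _ _ m _ _ _ hfst (hξm.comp hfst))
  have h2 : Measurable[m.prod (borel ℝ)] fun z : Ω × ℝ => j (z.1, ξ z.1) * d z :=
    h1.mul (hd.mono hle le_rfl)
  have hT : Measurable[m.prod (borel ℝ)] fun z : Ω × ℝ => gI (z.1, j (z.1, ξ z.1) * d z) :=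
    (hgI.mono hle le_rfl).comp
      (@Measurable.prodMk _ (m.prod (borel ℝ)) _ _ m _ _ _ hfst h2)
  -- On `S` the derivative is the measurable slope and is positive, as required because `I` is
  -- controlled only on `(0,∞)`. Kinks lie outside `S`.
  have key : ∀ᵐ ω ∂P, ∀ r, (ω, r) ∈ S → gI (ω, j (ω, ξ ω) * d (ω, r)) =
      I (n + 1) ω (deriv (U n ω) (ξ ω) * deriv (concaveEnvelope (Phi (W (n + 1) ω)
        (condLaw P (G (n + 1)) (ρ (n + 1)) ω)))
          (1 - W (n + 1) ω ((condLaw P (G (n + 1)) (ρ (n + 1)) ω).real (Iic r)))) := by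
    filter_upwards [hgW', hgI', hj', h.isPeriod n, hξ] with ω e1 e2 e3 hp e5 r hr
    obtain ⟨e6, e7⟩ := (hdS ω _ hp.isWeighting e1 hp.isPricingLaw).2 r hr
    rw [condLaw_eq, e6, e3 _ e5]
    refine (e2 _ (mul_pos ?_ e7)).symm
    rw [← e3 _ e5]
    exact hp.isDual_initial.deriv_pos e5
  have hS1 : ∀ᵐ ω ∂P, ∀ᵐ r ∂condLaw P (G (n + 1)) (ρ (n + 1)) ω, (ω, r) ∈ S := by
    filter_upwards [hgW', h.isPeriod n] with ω e1 hp
    exact (hdS ω _ hp.isWeighting e1 hp.isPricingLaw).1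
  have hS2 : ∀ᵐ ω ∂P, (ω, ρ (n + 1) ω) ∈ S :=
    (ae_ae_condKer_iff (G.le (n + 1)) (h.market.measurable n) hS).1 hS1
  refine ⟨_, hT, ?_, ?_⟩
  · filter_upwards [key, hS1] with ω e1 e2
    exact e2.mono e1
  · filter_upwards [key, hS2] with ω e1 e2
    exact (e1 _ e2).symm

/-- The next wealth is optimal, conditionally on any information `m` that contains `G_{n+1}` and
under which the law of the state price density is the same. -/
lemma nextWealth_optimal (h : IsConstruction P F G ρ W U₀ I U) (n : ℕ) {m : MeasurableSpace Ω}
    (hGm : G (n + 1) ≤ m) (hm : m ≤ plus F G n)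
    (hlaw : ∀ᵐ ω ∂P, condLaw P m (ρ (n + 1)) ω = condLaw P (G (n + 1)) (ρ (n + 1)) ω)
    {ξ X : Ω → ℝ} (hξm : Measurable[m] ξ) (hξ : ∀ᵐ ω ∂P, 0 < ξ ω)
    (hX : ∀ᵐ ω ∂P, X ω = nextWealth P G ρ W I U n ω (ξ ω)) :
    Measurable[F (n + 1)] X ∧ (∀ᵐ ω ∂P, 0 < X ω) ∧
    condLExp m P (fun ω => ENNReal.ofReal (ρ (n + 1) ω * X ω)) =ᵐ[P]
      (fun ω => ENNReal.ofReal (ξ ω)) ∧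
    ∀ᵐ ω ∂P, posPart (U (n + 1) ω) (rdLaw P m (W (n + 1)) X ω) < ⊤ ∧
      rdUtility P m (U (n + 1)) (W (n + 1)) X ω = ((U n ω (ξ ω) : ℝ) : EReal) := by
  obtain ⟨T, hT, hT1, hT2⟩ := h.exists_payoff n hGm hξm hξ
  have hXT : ∀ᵐ ω ∂P, X ω = T (ω, ρ (n + 1) ω) := by
    filter_upwards [hX, hT2] with ω e1 e2
    rw [e1, e2]
  have hper : ∀ᵐ ω ∂P, IsPeriod (W (n + 1) ω) (condLaw P m (ρ (n + 1)) ω) (U (n + 1) ω)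
      (I (n + 1) ω) (U n ω) (I n ω) := by
    filter_upwards [h.isPeriod n, hlaw] with ω e1 e2
    rwa [e2]
  refine ⟨?_, rdUtility_eq (hm.trans (plus_le F G n)) (h.market.measurable n) hper
    (h.market.rho_pos n) hξ hT ?_ hXT⟩
  · refine measurable_of_ae_eq (h.market.complete_F (n + 1)) ?_ hXT
    exact hT.comp (@Measurable.prodMk Ω (F (n + 1)) Ω ℝ m _ _ _
      (measurable_id'' (hm.trans (h.market.plus_le_F n))) (h.market.measurable_rho n))
  · filter_upwards [hT1, hlaw] with ω e1 e2
    rwa [e2]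

lemma isOptimalWealth (h : IsConstruction P F G ρ W U₀ I U) {x₀ : ℝ} (hx₀ : 0 < x₀)
    {X : ℕ → Ω → ℝ} (hX0 : ∀ᵐ ω ∂P, X 0 ω = x₀)
    (hX : ∀ n, ∀ᵐ ω ∂P, X (n + 1) ω = nextWealth P G ρ W I U n ω (X n ω)) :
    IsOptimalWealth P F G ρ W U X := by
  have step := fun n (hXm : Measurable[F n] (X n)) (hXpos : ∀ᵐ ω ∂P, 0 < X n ω) =>
    h.nextWealth_optimal n (le_plus F G n) le_rfl
    (h.market.condLaw_plus n) (ξ := X n) (hXm.mono (le_sup_left : F n ≤ plus F G n) le_rfl) hXpos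
    (hX n)
  -- Each period needs its initial wealth to be measurable and positive, and delivers the same for
  -- the next.
  have key : ∀ n, Measurable[F n] (X n) ∧ ∀ᵐ ω ∂P, 0 < X n ω := by
    intro n
    induction n with
    | zero =>
      refine ⟨measurable_of_ae_eq (h.market.complete_F 0) measurable_const hX0, ?_⟩
      filter_upwards [hX0] with ω e
      rwa [e]
    | succ n ih => exact ⟨(step n ih.1 ih.2).1, (step n ih.1 ih.2).2.1⟩
  have key' := fun n => step n (key n).1 (key n).2
  exact {
    admissible := {
      measurable_zero := (key 0).1
      nonneg_zero := (key 0).2.mono fun ω e => e.le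
      step := fun n => ⟨(key (n + 1)).1, (key (n + 1)).2.mono fun ω e => e.le, (key' n).2.2.1⟩ }
    pos := fun n => (key n).2
    wellDefined := fun n => (key' n).2.2.2.mono fun ω e => e.1
    optimal := fun n => (key' n).2.2.2.mono fun ω e => e.2.symm }

lemma isRDPFPP (h : IsConstruction P F G ρ W U₀ I U) : IsRDPFPP P F G ρ W U where
  initial := ⟨U₀, h.isUtility_initial, h.U_zero⟩
  measurable := h.isRandomFunction
  isUtility n := (h.isDual (n + 1)).mono fun ω e => e.isUtility
  supermartingale X hX n := by
    have hX0 : ∀ᵐ ω ∂P, 0 ≤ X n ω := by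
      cases n with
      | zero => exact hX.nonneg_zero
      | succ n => exact (hX.step n).nonneg
    exact rdUtility_le (plus_le F G n) (h.market.measurable n) (h.isPeriod_plus n)
      (h.market.rho_pos n) ((hX.step n).measurable.mono (F.le _) le_rfl) (hX.step n).nonneg hX0
      (hX.step n).budget
  exists_optimal :=
    ⟨fun n => Nat.rec (fun _ => 1) (fun n Y ω => nextWealth P G ρ W I U n ω (Y ω)) n,
      h.isOptimalWealth one_pos (Eventually.of_forall fun _ => rfl)
        fun _ => Eventually.of_forall fun _ => rfl⟩

lemma rdUtility_le_of_isAdmissibleStep (h : IsConstruction P F G ρ W U₀ I U) (n : ℕ) {x : ℝ}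
    (hx : 0 < x) {X : Ω → ℝ} (hX : IsAdmissibleStep P F G ρ n (fun _ => x) X) :
    ∀ᵐ ω ∂P, posPart (U (n + 1) ω) (rdLaw P (G (n + 1)) (W (n + 1)) X ω) < ⊤ ∧
      rdUtility P (G (n + 1)) (U (n + 1)) (W (n + 1)) X ω ≤ ((U n ω x : ℝ) : EReal) := by
  filter_upwards [rdUtility_le (ξ := fun _ => x) (G.le (n + 1)) (h.market.measurable n)
    (h.isPeriod n) (h.market.rho_pos n) (hX.measurable.mono (F.le _) le_rfl) hX.nonneg
    (Eventually.of_forall fun _ => hx.le) (IsMarket.condLExp_G n hX.budget)] with ω e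
  rwa [IsDual.extend_of_pos hx] at e

end IsConstruction

end RDPFPP

theorem theorem4p1 {Ω : Type*} {mΩ : MeasurableSpace Ω} (P : Measure Ω) [IsProbabilityMeasure P]
    (F G : Filtration ℕ mΩ) (ρ : ℕ → Ω → ℝ) (W : ℕ → Ω → ℝ → ℝ)
    (hmarket : RDPFPP.IsMarket P F G ρ)
    (hW : RDPFPP.IsRandomWeighting P G W)
    (U₀ : ℝ → ℝ) (hU₀ : RDPFPP.IsUtility U₀)
    (I : ℕ → Ω → ℝ → ℝ)
    (hI_zero : ∀ᵐ ω ∂P, ∀ y, 0 < y → I 0 ω y = RDPFPP.posInv (deriv U₀) y)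
    (hI_meas : ∀ n, RDPFPP.IsRandomFunction P (G (n + 1)) (Ioi 0) (I (n + 1)))
    (hI_mem : ∀ n, ∀ᵐ ω ∂P, RDPFPP.IsInverseMarginal (I (n + 1) ω))
    (hI_eq : ∀ n, ∀ᵐ ω ∂P, ∀ y, 0 < y →
      ∫ η in (0 : ℝ)..1, I (n + 1) ω (y * RDPFPP.phiHatDeriv P G ρ W (n + 1) ω η) *
        RDPFPP.phiHatDeriv P G ρ W (n + 1) ω η = I n ω y)
    (hI_int : ∀ n, ∀ᵐ ω ∂P, ∀ x, 0 < x →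
      IntegrableOn (fun p => ∫ ξ in (I (n + 1) ω (RDPFPP.phiHatDeriv P G ρ W (n + 1) ω p))..x,
        RDPFPP.posInv (I (n + 1) ω) ξ) (Ioo (0 : ℝ) 1))
    (U : ℕ → Ω → ℝ → ℝ)
    (hU_zero : ∀ᵐ ω ∂P, ∀ x, 0 < x → U 0 ω x = U₀ x)
    (hU_succ : ∀ n, ∀ᵐ ω ∂P, ∀ x, 0 < x →
      U (n + 1) ω x = U n ω (I n ω 1) +
        ∫ p in (0 : ℝ)..1, ∫ ξ in (I (n + 1) ω (RDPFPP.phiHatDeriv P G ρ W (n + 1) ω p))..x,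
          RDPFPP.posInv (I (n + 1) ω) ξ) :
    -- the process is an RDPFPP
    RDPFPP.IsRDPFPP P F G ρ W U ∧
    -- the recursively defined wealth process is optimal
    (∀ x₀ : ℝ, 0 < x₀ → ∀ X : ℕ → Ω → ℝ, (∀ᵐ ω ∂P, X 0 ω = x₀) →
      (∀ n, ∀ᵐ ω ∂P, X (n + 1) ω = RDPFPP.nextWealth P G ρ W I U n ω (X n ω)) →
      RDPFPP.IsOptimalWealth P F G ρ W U X) ∧
    -- for a deterministic wealth at the beginning of a period, the same holds over that period with
    -- the conditional cdf taken given the smaller sigma-algebra of model parameters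
    (∀ n, ∀ x : ℝ, 0 < x →
      (∀ X : Ω → ℝ, RDPFPP.IsAdmissibleStep P F G ρ n (fun _ => x) X → ∀ᵐ ω ∂P,
        RDPFPP.posPart (U (n + 1) ω) (RDPFPP.rdLaw P (G (n + 1)) (W (n + 1)) X ω) < ⊤ ∧
        RDPFPP.rdUtility P (G (n + 1)) (U (n + 1)) (W (n + 1)) X ω ≤ ((U n ω x : ℝ) : EReal)) ∧
      (∀ X : Ω → ℝ, (∀ᵐ ω ∂P, X ω = RDPFPP.nextWealth P G ρ W I U n ω x) →
        RDPFPP.IsAdmissibleStep P F G ρ n (fun _ => x) X ∧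
        ∀ᵐ ω ∂P, RDPFPP.rdUtility P (G (n + 1)) (U (n + 1)) (W (n + 1)) X ω =
          ((U n ω x : ℝ) : EReal))) := by
  have h : RDPFPP.IsConstruction P F G ρ W U₀ I U :=
    ⟨hmarket, hW, hU₀, hI_zero, hI_meas, hI_mem, hI_eq, hI_int, hU_zero, hU_succ⟩
  refine ⟨h.isRDPFPP, fun x₀ hx₀ X hX0 hX => h.isOptimalWealth hx₀ hX0 hX, fun n x hx =>
    ⟨fun X hX => h.rdUtility_le_of_isAdmissibleStep n hx hX, fun X hX => ?_⟩⟩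
  have hpos : ∀ᵐ ω ∂P, 0 < (fun _ : Ω => x) ω := Eventually.of_forall fun _ => hx
  -- Conditioning on `F_n⁺` yields the budget equation in the definition of admissibility;
  -- conditioning on `G_{n+1}` yields the equality of utilities.
  have h1 := h.nextWealth_optimal n (RDPFPP.le_plus F G n) le_rfl (hmarket.condLaw_plus n)
    measurable_const hpos hX
  have h2 := h.nextWealth_optimal n le_rfl (RDPFPP.le_plus F G n)
    (Eventually.of_forall fun _ => rfl) measurable_const hpos hX
  exact ⟨⟨h1.1, h1.2.1.mono fun ω e => e.le, h1.2.2.1⟩, h2.2.2.2.mono fun ω e => e.2⟩
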